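/- **Setting.** All superspaces and superalgebras are real unless stated otherwise. Let $V=V_0\oplus V_1$ be a finite-dimensional supervector space of dimension $(2p,n)$ with a symplectic form $B$: $V_0\perp V_1$, $B|_{V_0}$ is a nondegenerate alternating form and $B|_{V_1}$ is a nondegenerate symmetric form. Suppose $V$ is oriented by a symplectic basis: a symplectic basis of $V_0$ with coordinates $x^1,\dots,x^{2p}$, and a basis $f_1,\dots,f_n$ of $V_1\otimes\mathbb C$ with $B(f_i,f_j)=\delta_{ij}$ and each $f_j$ in $V_1$ or in $iV_1$, with dual coordinates $\xi^1,\dots,\xi^n$. For a function $\phi$ on $V$ put $$\int_V d_V(v)\,\phi(v)=\frac1{(2\pi)^{p}}\int_{\mathbb R^{2p}}|dx^1\cdots dx^{2p}|\,\Big(\frac{\partial}{\partial\xi^1}\cdots\frac{\partial}{\partial\xi^n}\phi\Big)_{\xi=0}(x).$$ Let $\mathcal P$ be a near superalgebra, that is, a supercommutative superalgebra that is finite dimensional, local, and has residue field $\mathbb R$; let ${\bf b}:\mathcal P\to\mathbb R$ be the residue map (the body), extended by scalars. For a supervector space $W$, $W_{\mathcal P}=(W\otimes\mathcal P)_0$;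 for a complex one, $W_{\mathcal P}=(W\otimes_{\mathbb C}(\mathcal P\otimes\mathbb C))_0$. Write $M\in\mathfrak{gl}(V)_{\mathcal P}$ in block form $M=\begin{pmatrix}A&B'\\C&D\end{pmatrix}$, and let $GL(V)_{\mathcal P}$ be the group of invertible elements of $\mathfrak{gl}(V)_{\mathcal P}$. Let $M^*$ be the adjoint of $M$ for $B$ (extended by the sign rule), $B(Mv,w)=B(v,M^*w)$. Put $SpO(V)_{\mathcal P}=\{g\in GL(V)_{\mathcal P}: g^*=g^{-1}\}$. For an invertible even element $\alpha\in\mathcal P_0$ let $|\alpha|=\frac{|{\bf b}(\alpha)|}{{\bf b}(\alpha)}\alpha$, and for $g\in GL(V)_{\mathcal P}$ let $$\operatorname{Ber}_{(1,0)}(g)=\big|\det(A-B'D^{-1}C)\big|\det(D)^{-1}.$$ Let $\mathfrak{spo}(V)$ be the Lie superalgebra of endomorphisms of $V$ that leave $B$ invariant, and let $\mathcal V^+\subset\mathfrak{spo}(V)_0=\mathfrak{sp}(V_0)\oplus\mathfrak{so}(V_1)$ be the set of $(X_0,X_1)$ such that $v\mapsto B(v,X_0v)$ is positive definite on $V_0$.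 For $X\in\mathfrak{spo}(V\otimes\mathbb C)_{\mathcal P}$ with ${\bf b}(X)\in\mathcal V^+ + i\,\mathfrak{spo}(V)_0$, the superPfaffian of $X$ is $$\operatorname{Spf}(X)=\int_V d_V(v)\,\exp\!\big(-\tfrac12B(v,Xv)\big)\in\mathcal P\otimes\mathbb C .$$ **Proposition.** Let $X\in\mathfrak{spo}(V\otimes\mathbb C)_{\mathcal P}$ with ${\bf b}(X)\in\mathcal V^+ + i\,\mathfrak{spo}(V)_0$, and let $g\in GL(V)_{\mathcal P}$. Then the integral that defines $\operatorname{Spf}(X)$ converges, $\operatorname{Ber}_{(1,0)}(g)$ is invertible, $g^*Xg$ is again a point of $\mathfrak{spo}(V\otimes\mathbb C)_{\mathcal P}$ with ${\bf b}(g^*Xg)\in\mathcal V^+ + i\,\mathfrak{spo}(V)_0$, and $$\operatorname{Spf}(g^*Xg)=\operatorname{Ber}_{(1,0)}(g)^{-1}\operatorname{Spf}(X).$$ In particular, if $g\in SpO(V)_{\mathcal P}$, then $$\operatorname{Spf}(g^{-1}Xg)=\det\big({\bf b}(g)|_{V_1}\big)\operatorname{Spf}(X).$$ -/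

import Mathlib

open scoped TensorProduct

noncomputable section

namespace SuperPfaffian

/-! ### Near superalgebras -/

/-- A near superalgebra: a supercommutative real superalgebra `P = 𝒜 0 ⊕ 𝒜 1` that is finite
dimensional, local, and has residue field `ℝ`. -/
class NearSuperalgebra {P : Type*} [Ring P] [Algebra ℝ P] (𝒜 : ZMod 2 → Submodule ℝ P)
    [GradedAlgebra 𝒜] : Prop where
  supercomm : ∀ (i j : ZMod 2) (a b : P), a ∈ 𝒜 i → b ∈ 𝒜 j →
    a * b = (-1) ^ (i * j).val * (b * a)
  finite : Module.Finite ℝ P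
  isLocal : IsLocalRing P
  residue : Nonempty (P →ₐ[ℝ] ℝ)

section Near

variable {P : Type*} [Ring P] [Algebra ℝ P] (𝒜 : ZMod 2 → Submodule ℝ P) [GradedAlgebra 𝒜]

/-- The body map `P → ℝ`, that is, the residue map (the only algebra morphism `P → ℝ`). -/
def body [h : NearSuperalgebra 𝒜] : P →ₐ[ℝ] ℝ := h.residue.some

/-- The even part of a near superalgebra is a commutative ring. -/
instance evenCommRing [h : NearSuperalgebra 𝒜] : CommRing (𝒜 0) :=
  { SetLike.GradeZero.instRing 𝒜 with
    mul_comm := fun a b => Subtype.ext (by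
      have := h.supercomm 0 0 a b a.2 b.2
      simpa using this) }

/-- The even component of an element. -/
def evenPart (x : P) : 𝒜 0 := DirectSum.decompose 𝒜 x 0

/-- The body map `P ⊗ ℂ → ℂ`. -/
def bodyC [NearSuperalgebra 𝒜] : ℂ ⊗[ℝ] P →ₐ[ℂ] ℂ :=
  Algebra.TensorProduct.lift (AlgHom.id ℂ ℂ) ((Algebra.ofId ℝ ℂ).comp (body 𝒜))
    (fun _ _ => Commute.all _ _)

/-- The grading of the complexification `P ⊗ ℂ`. -/
def gradingC (i : ZMod 2) : Submodule ℂ (ℂ ⊗[ℝ] P) := (𝒜 i).baseChange ℂ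

/-- The inclusion `P → P ⊗ ℂ`. -/
def toC : P →ₐ[ℝ] ℂ ⊗[ℝ] P := Algebra.TensorProduct.includeRight

/-- The absolute value `|α| = (|b(α)| / b(α)) α` of an invertible even element. -/
def absEven [NearSuperalgebra 𝒜] (a : 𝒜 0) : 𝒜 0 :=
  (|body 𝒜 a| / body 𝒜 a) • a

end Near

/-! ### Supermatrices

An even endomorphism of `V` with coefficients in a superalgebra `R` (a point of `𝔤𝔩(V)` with
values in `R`) is given by its matrix `M` in a homogeneous basis `(g_i)` of `V`: it is the right
`R`-linear map `g_j ↦ ∑ i, g_i M i j`. In block form `M = (A B; C D)`, with `A`, `D` even and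
`B`, `C` odd; composition is the matrix product. -/

/-- Indices of a homogeneous basis of a space of dimension `(2p, n)`. -/
abbrev Idx (p n : ℕ) : Type := (Fin p ⊕ Fin p) ⊕ Fin n

abbrev SuperMat (p n : ℕ) (R : Type*) : Type _ := Matrix (Idx p n) (Idx p n) R

/-- The parity of the basis vectors. -/
def parity {p n : ℕ} : Idx p n → ZMod 2 := Sum.elim (fun _ => 0) (fun _ => 1)

/-- `M` is a point of `𝔤𝔩(V)` with values in `R`: the diagonal blocks are even and the
off-diagonal blocks are odd. -/
def IsPointGl {S R : Type*} [CommRing S] [Ring R] [Algebra S R] (𝒜 : ZMod 2 → Submodule S R)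
    {p n : ℕ} (M : SuperMat p n R) : Prop :=
  ∀ i j, M i j ∈ 𝒜 (parity i + parity j)

/-- `v` is the coordinate vector of a point `∑ i, g_i v_i` of `V` with values in `R`. -/
def IsPointV {S R : Type*} [CommRing S] [Ring R] [Algebra S R] (𝒜 : ZMod 2 → Submodule S R)
    {p n : ℕ} (v : Idx p n → R) : Prop :=
  ∀ i, v i ∈ 𝒜 (parity i)

section Ber

variable {P : Type*} [Ring P] [Algebra ℝ P] (𝒜 : ZMod 2 → Submodule ℝ P) [GradedAlgebra 𝒜]
  [NearSuperalgebra 𝒜] {p n : ℕ}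

/-- The block `D`, with entries in the even part. -/
def oddBlock (M : SuperMat p n P) : Matrix (Fin n) (Fin n) (𝒜 0) :=
  M.toBlocks₂₂.map (evenPart 𝒜)

/-- The block `A - B D⁻¹ C`, with entries in the even part. -/
def schur (M : SuperMat p n P) : Matrix (Fin p ⊕ Fin p) (Fin p ⊕ Fin p) (𝒜 0) :=
  (M.toBlocks₁₁ - M.toBlocks₁₂ * ((oddBlock 𝒜 M)⁻¹.map (fun a => (a : P)) : Matrix _ _ P)
    * M.toBlocks₂₁).map (evenPart 𝒜)

/-- `Ber_(1,0)(M) = |det(A - B D⁻¹ C)| det(D)⁻¹`, for `D` invertible. -/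
def ber10 (M : SuperMat p n P) : 𝒜 0 :=
  absEven 𝒜 (schur 𝒜 M).det * Ring.inverse (oddBlock 𝒜 M).det

/-- `det (b(M)|_{V₁})`. -/
def detBodyOdd (M : SuperMat p n P) : ℝ := (M.toBlocks₂₂.map (body 𝒜)).det

end Ber

/-! ### Symplectic supervector spaces -/

/-- A symplectic form on the supervector space `V₀ ⊕ V₁`. -/
structure SymplecticForm (V₀ V₁ : Type*) [AddCommGroup V₀] [Module ℝ V₀] [AddCommGroup V₁]
    [Module ℝ V₁] where
  even : LinearMap.BilinForm ℝ V₀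
  odd : LinearMap.BilinForm ℝ V₁
  even_isAlt : even.IsAlt
  even_nondegenerate : even.Nondegenerate
  odd_isSymm : odd.IsSymm
  odd_nondegenerate : odd.Nondegenerate

/-- A symplectic basis of `V`: a symplectic basis `e` of `V₀`, where `e (inl k), e (inr k)` are the
symplectic pairs, and an orthonormal basis `f_j = c_j h_j` of `V₁ ⊗ ℂ`, where `h` is a basis of `V₁`
and `c_j ∈ {1, i}`. It determines an orientation `ξ¹⋯ξⁿ` of `V₁`, where `ξ` is the basis dual
to `f`. -/
structure SymplecticBasis {V₀ V₁ : Type*} [AddCommGroup V₀] [Module ℝ V₀] [AddCommGroup V₁]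
    [Module ℝ V₁] (B : SymplecticForm V₀ V₁) (p n : ℕ) where
  e : Module.Basis (Fin p ⊕ Fin p) ℝ V₀
  e_pair : ∀ k l, B.even (e (Sum.inl k)) (e (Sum.inr l)) = if k = l then 1 else 0
  e_left : ∀ k l, B.even (e (Sum.inl k)) (e (Sum.inl l)) = 0
  e_right : ∀ k l, B.even (e (Sum.inr k)) (e (Sum.inr l)) = 0
  h : Module.Basis (Fin n) ℝ V₁
  c : Fin n → ℂ
  c_eq : ∀ j, c j = 1 ∨ c j = Complex.I
  orthonormal : ∀ i j, c i * c j * (B.odd (h i) (h j) : ℂ) = if i = j then 1 else 0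

section Symplectic

variable {V₀ V₁ : Type*} [AddCommGroup V₀] [Module ℝ V₀] [AddCommGroup V₁] [Module ℝ V₁]
  {B : SymplecticForm V₀ V₁} {p n : ℕ} (b : SymplecticBasis B p n)

/-- The matrix of `B` in the real homogeneous basis `(e, h)` of `V`. -/
def gram : SuperMat p n ℝ :=
  Matrix.fromBlocks (Matrix.of fun i j => B.even (b.e i) (b.e j)) 0 0
    (Matrix.of fun i j => B.odd (b.h i) (b.h j))

/-- `B(v, w)` for points `v = ∑ g_i v_i`, `w = ∑ g_j w_j` of `V` with values in a superalgebra `R`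
(`g = (e, h)`). The rule of signs gives `B(g_i v_i, g_j w_j) = (-1)^{p(v_i) p(g_j)} B(g_i, g_j) v_i w_j`,
where `p(v_i) = p(g_i)`, and `p(g_i) = p(g_j)` if `B(g_i, g_j) ≠ 0`. -/
def superForm {R : Type*} [Ring R] [Algebra ℝ R] (v w : Idx p n → R) : R :=
  ∑ i, ∑ j, ((-1) ^ (parity i).val * gram b i j) • (v i * w j)

/-- The supertranspose of `M = (A B; C D)`. -/
def superTranspose {R : Type*} [Ring R] (M : SuperMat p n R) : SuperMat p n R :=
  Matrix.fromBlocks M.toBlocks₁₁.transpose (-M.toBlocks₂₁.transpose) M.toBlocks₁₂.transpose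
    M.toBlocks₂₂.transpose

/-- The adjoint `M^*` of `M` for `B`: `B(M v, w) = B(v, M^* w)`, see `superForm_adjoint`. -/
def adjoint {R : Type*} [Ring R] [Algebra ℝ R] (M : SuperMat p n R) : SuperMat p n R :=
  (gram b)⁻¹.map (algebraMap ℝ R) * superTranspose M * (gram b).map (algebraMap ℝ R)

theorem isUnit_det_gram : IsUnit (gram b).det := by
  rw [gram, Matrix.det_fromBlocks_zero₂₁, isUnit_iff_ne_zero]
  refine mul_ne_zero ?_ ?_
  · have := (LinearMap.BilinForm.nondegenerate_iff_det_ne_zero b.e).1 B.even_nondegenerate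
    convert this using 2
    ext i j; simp [LinearMap.BilinForm.toMatrix_apply]
  · have := (LinearMap.BilinForm.nondegenerate_iff_det_ne_zero b.h).1 B.odd_nondegenerate
    convert this using 2
    ext i j; simp [LinearMap.BilinForm.toMatrix_apply]

theorem superForm_eq {R : Type*} [Ring R] [Algebra ℝ R] (v w : Idx p n → R) :
    superForm b v w = ∑ i, ((-1) ^ (parity i).val : ℝ) •
      (v i * ((gram b).map (algebraMap ℝ R)).mulVec w i) := by
  unfold superForm
  refine Finset.sum_congr rfl fun i _ => ?_
  simp only [Matrix.mulVec, dotProduct, Finset.mul_sum, Finset.smul_sum, Matrix.map_apply]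
  refine Finset.sum_congr rfl fun j _ => ?_
  rw [mul_smul, ← mul_assoc, ← Algebra.commutes, mul_assoc, ← Algebra.smul_def]

/-- The adjoint satisfies `B(M v, w) = B(v, M^* w)` for all points `v`, `w` of `V`. -/
theorem superForm_adjoint {P : Type*} [Ring P] [Algebra ℝ P] (𝒜 : ZMod 2 → Submodule ℝ P)
    [GradedAlgebra 𝒜] [NearSuperalgebra 𝒜] {M : SuperMat p n P} (hM : IsPointGl 𝒜 M)
    {v : Idx p n → P} (hv : IsPointV 𝒜 v) (w : Idx p n → P) :
    superForm b (M.mulVec v) w = superForm b v ((adjoint b M).mulVec w) := by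
  have hG : (gram b).map (algebraMap ℝ P) * (gram b)⁻¹.map (algebraMap ℝ P) = 1 := by
    rw [← Matrix.map_mul, Matrix.mul_nonsing_inv _ (isUnit_det_gram b)]
    simp
  rw [superForm_eq, superForm_eq, adjoint, Matrix.mulVec_mulVec, Matrix.mul_assoc,
    ← Matrix.mul_assoc, hG, one_mul, ← Matrix.mulVec_mulVec]
  generalize ((gram b).map (algebraMap ℝ P)).mulVec w = u
  simp only [Matrix.mulVec, dotProduct, Finset.sum_mul, Finset.mul_sum, Finset.smul_sum]
  rw [Finset.sum_comm]
  refine Finset.sum_congr rfl fun j _ => Finset.sum_congr rfl fun i _ => ?_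
  have key := NearSuperalgebra.supercomm (𝒜 := 𝒜) _ _ _ _ (hM i j) (hv j)
  rw [key]
  have h2 : ((1 : ZMod 2) + 1).val = 0 := by decide
  rcases i with i | i <;> rcases j with j | j <;>
    simp [h2, parity, superTranspose, mul_assoc, Matrix.toBlocks₁₁, Matrix.toBlocks₁₂,
      Matrix.toBlocks₂₁, Matrix.toBlocks₂₂, ZMod.val_one]

/-! ### The Berezin integral -/

/-- The functions on the odd part of `V` with values in `P`: the superalgebra `Λ(V₁^*) ⊗ P`, with the
sign rule in the product. -/
abbrev OddFun (V₁ : Type*) [AddCommGroup V₁] [Module ℝ V₁] {P : Type*} [Ring P] [Algebra ℝ P]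
    (𝒜 : ZMod 2 → Submodule ℝ P) [GradedAlgebra 𝒜] : Type _ :=
  GradedTensorProduct ℝ
    (CliffordAlgebra.evenOdd (0 : QuadraticForm ℝ (Module.Dual ℝ V₁))) 𝒜

/-- The derivation `∂/∂η_j` of `Λ(V₁^*)`, where `η` is the basis of `V₁^*` dual to `h`. -/
def oddDeriv (w : V₁) : Module.End ℝ (ExteriorAlgebra ℝ (Module.Dual ℝ V₁)) :=
  CliffordAlgebra.contractLeft (Module.Dual.eval ℝ V₁ w)

/-- The linear form `φ ↦ (∂/∂η_1 ⋯ ∂/∂η_n φ)_ℝ` on `Λ(V₁^*)`. -/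
def berezinReal : ExteriorAlgebra ℝ (Module.Dual ℝ V₁) →ₗ[ℝ] ℝ :=
  ExteriorAlgebra.algebraMapInv.toLinearMap ∘ₗ (List.ofFn fun j => oddDeriv (b.h j)).prod

section Integral

variable {P : Type*} [Ring P] [Algebra ℝ P] (𝒜 : ZMod 2 → Submodule ℝ P) [GradedAlgebra 𝒜]

/-- The Liouville integral `φ ↦ (∂/∂ξ_1 ⋯ ∂/∂ξ_n φ)_ℝ` on `V₁`, for functions with values in
`P ⊗ ℂ`. Here `ξ` is dual to `f_j = c_j h_j`, so that `∂/∂ξ_j = c_j ∂/∂η_j`. -/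
def berezin : ℂ ⊗[ℝ] OddFun V₁ 𝒜 →ₗ[ℂ] ℂ ⊗[ℝ] P :=
  (∏ j, b.c j) • LinearMap.baseChange ℂ
    ((TensorProduct.lid ℝ P).toLinearMap ∘ₗ LinearMap.rTensor P (berezinReal b) ∘ₗ
      (GradedTensorProduct.of ℝ (CliffordAlgebra.evenOdd
        (0 : QuadraticForm ℝ (Module.Dual ℝ V₁))) 𝒜).symm.toLinearMap)

/-- The inclusion of the constants `P ⊗ ℂ → Λ(V₁^*) ⊗ P ⊗ ℂ`. -/
def constFun (V₁ : Type*) [AddCommGroup V₁] [Module ℝ V₁] :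
    ℂ ⊗[ℝ] P →ₐ[ℂ] ℂ ⊗[ℝ] OddFun V₁ 𝒜 :=
  Algebra.TensorProduct.map (AlgHom.id ℂ ℂ) (GradedTensorProduct.includeRight
    (CliffordAlgebra.evenOdd (0 : QuadraticForm ℝ (Module.Dual ℝ V₁))) 𝒜)

/-- The point `v = ∑ e_i x_i + ∑ h_j η_j = ∑ e_i x_i + ∑ f_j ξ_j`: generic in the odd directions,
and with even coordinates `x`. -/
def genericPoint (x : Fin p ⊕ Fin p → ℝ) : Idx p n → ℂ ⊗[ℝ] OddFun V₁ 𝒜 :=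
  Sum.elim (fun i => algebraMap ℝ _ (x i))
    (fun j => 1 ⊗ₜ[ℝ] (GradedTensorProduct.tmul ℝ
      (ExteriorAlgebra.ι ℝ (b.h.coord j) : ExteriorAlgebra ℝ (Module.Dual ℝ V₁)) (1 : P)))

/-- `μ(X, v) = -1/2 B(v, X v)` at `v = genericPoint x`. -/
def moment (X : SuperMat p n (ℂ ⊗[ℝ] P)) (x : Fin p ⊕ Fin p → ℝ) : ℂ ⊗[ℝ] OddFun V₁ 𝒜 :=
  (-1 / 2 : ℝ) • superForm b (genericPoint b 𝒜 x)
    ((X.map (constFun 𝒜 V₁)).mulVec (genericPoint b 𝒜 x))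

variable [NearSuperalgebra 𝒜]

/-- The body of `μ(X, v)`, which is `-1/2 B(v₀, b(X) v₀)` with `v₀ = ∑ e_i x_i`. -/
def momentBody (X : SuperMat p n (ℂ ⊗[ℝ] P)) (x : Fin p ⊕ Fin p → ℝ) : ℂ :=
  (-1 / 2 : ℂ) * ∑ i, ∑ j, ((B.even (b.e i) (b.e j) * x i : ℝ) : ℂ) *
    ∑ k, bodyC 𝒜 (X.toBlocks₁₁ j k) * (x k : ℂ)

/-- `exp(μ(X, v))` at `v = genericPoint x`. The exponential of an even element `a` with body `β` is
`e^β ∑ (a - β)^k / k!`, where `a - β` is nilpotent. -/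
def expMoment (X : SuperMat p n (ℂ ⊗[ℝ] P)) (x : Fin p ⊕ Fin p → ℝ) : ℂ ⊗[ℝ] OddFun V₁ 𝒜 :=
  Complex.exp (momentBody b 𝒜 X x) •
    IsNilpotent.exp (moment b 𝒜 X x - algebraMap ℂ _ (momentBody b 𝒜 X x))

/-- The function `∫_{V₁} exp(μ(X, v))` of the even coordinates `x`. -/
def spfIntegrand (X : SuperMat p n (ℂ ⊗[ℝ] P)) (x : Fin p ⊕ Fin p → ℝ) : ℂ ⊗[ℝ] P :=
  berezin b 𝒜 (expMoment b 𝒜 X x)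

end Integral

/-! ### Integrals with values in a finite dimensional space, without a choice of a norm -/

/-- Every component of `F` is integrable. -/
def VecIntegrable {α E : Type*} [MeasurableSpace α] [AddCommGroup E] [Module ℂ E]
    (m : MeasureTheory.Measure α) (F : α → E) : Prop :=
  ∀ φ : E →ₗ[ℂ] ℂ, MeasureTheory.Integrable (fun x => φ (F x)) m

/-- The componentwise integral of `F`. -/
def vecIntegral {α E : Type*} [MeasurableSpace α] [AddCommGroup E] [Module ℂ E]
    [Module.Finite ℂ E] (m : MeasureTheory.Measure α) (F : α → E) : E :=
  ∑ k, (∫ x, (Module.finBasis ℂ E).repr (F x) k ∂m) • Module.finBasis ℂ E k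

/-- The componentwise integral does not depend on the choice of a basis. -/
theorem apply_vecIntegral {α E : Type*} [MeasurableSpace α] [AddCommGroup E] [Module ℂ E]
    [Module.Finite ℂ E] {m : MeasureTheory.Measure α} {F : α → E} (hF : VecIntegrable m F)
    (φ : E →ₗ[ℂ] ℂ) : φ (vecIntegral m F) = ∫ x, φ (F x) ∂m := by
  have h : ∀ x, φ (F x) = ∑ k, (Module.finBasis ℂ E).repr (F x) k * φ (Module.finBasis ℂ E k) := by
    intro x
    conv_lhs => rw [← (Module.finBasis ℂ E).sum_repr (F x)]
    simp only [map_sum, map_smul, smul_eq_mul]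
  simp_rw [h, vecIntegral, map_sum, map_smul, smul_eq_mul]
  rw [MeasureTheory.integral_finsetSum]
  · simp_rw [MeasureTheory.integral_mul_const]
  · intro k _
    exact (hF ((Module.finBasis ℂ E).coord k)).mul_const _

section Spf

variable {P : Type*} [Ring P] [Algebra ℝ P] (𝒜 : ZMod 2 → Submodule ℝ P) [GradedAlgebra 𝒜]
  [NearSuperalgebra 𝒜]

theorem finite_complexification {P : Type*} [Ring P] [Algebra ℝ P] (𝒜 : ZMod 2 → Submodule ℝ P)
    [GradedAlgebra 𝒜] [NearSuperalgebra 𝒜] : Module.Finite ℂ (ℂ ⊗[ℝ] P) :=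
  haveI := NearSuperalgebra.finite (𝒜 := 𝒜)
  inferInstance

/-- The points of `𝔰𝔭𝔬(V ⊗ ℂ)` with values in `P ⊗ ℂ` whose body lies in `𝒱⁺ × i 𝔰𝔭𝔬(V)₀`: the real
part `X₀` of the body satisfies `B(v, X₀ v) > 0` for all nonzero `v ∈ V₀`. -/
def spoDomain : Set (SuperMat p n (ℂ ⊗[ℝ] P)) :=
  {X | IsPointGl (gradingC 𝒜) X ∧ adjoint b X = -X ∧
    ∀ x : Fin p ⊕ Fin p → ℝ, x ≠ 0 →
      0 < ∑ i, ∑ j, B.even (b.e i) (b.e j) * x i *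
        ∑ k, (bodyC 𝒜 (X.toBlocks₁₁ j k)).re * x k}

/-- Convergence of the integral that defines `Spf(X)`. -/
def SpfConverges (X : SuperMat p n (ℂ ⊗[ℝ] P)) : Prop :=
  VecIntegrable MeasureTheory.volume (spfIntegrand b 𝒜 X)

/-- The superPfaffian `Spf(X) = ∫_V d_V(v) exp(-1/2 B(v, X v))`. -/
def Spf (X : SuperMat p n (ℂ ⊗[ℝ] P)) : ℂ ⊗[ℝ] P :=
  haveI := finite_complexification 𝒜
  (((2 * Real.pi) ^ p)⁻¹ : ℝ) •
    vecIntegral MeasureTheory.volume (spfIntegrand b 𝒜 X)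

end Spf

end Symplectic

end SuperPfaffian

end

open scoped TensorProduct

noncomputable section

namespace SuperPfaffian

/-! ### Supermatrices over a supercommutative algebra -/

/-! Since B(v, g^*Xg v) = B(gv, X gv), the proposition is the change of variables v ↦ gv in a
Gaussian superintegral. It is derived by factoring g into pieces for which the Jacobian can be
computed. Block elimination writes g as an upper unipotent factor, a block diagonal factor with
blocks S = A - B'D⁻¹C and D, and a lower unipotent factor (`eq_mul_evenDiag_mul`); each diagonal
block is then its body times 1 plus a matrix with body zero (`exists_eq_map_mul_one_add`).

For a real factor, Lebesgue measure contributes |det A|⁻¹ and the Berezin integral contributes det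
D. The latter holds because the iterated odd derivative is an alternating n-form in the directions
of differentiation (`berezinReal_map`). Together they give `Spf_conjAdjoint_realPoint`.

A factor 1 + N with body 1 is joined to 1 by the path 1 + tN. With N = (1 + tN)Y, the t-derivative
of the exponent is its derivative along the even linear vector field v ↦ Yv, and the divergence
theorem (`SuperCalculus.integral_vecField`) trades that for the supertrace of Y. Hence the integral
times β(t) is constant when β' = str(Y)β (`SuperCalculus.integral_exp_quad_eq`). For the triangular
factors N² = 0 and str N = 0, so β = 1; for the diagonal ones β = det(1 + tS)/det(1 + tD) by
Jacobi's formula.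

The analysis is confined to Gaussian integrals of polynomials. The body of the exponent is a
quadratic polynomial q with negative definite real part, and the exponent minus q is central and
nilpotent, so the integrand is a polynomial superfunction times e^q. Convergence and integration by
parts follow from `GaussianBound.integrable` and `gaussian_pderiv`. A factor with body 1 leaves q
unchanged, so a single functional f ↦ ∫ f e^q serves the whole path.

For g in SpO(V) multiplicativity of the Berezinian is not needed. Its invariance under the adjoint
(`ber10_adjoint`) and the law for both g and g⁻¹ show that β = Ber(g) satisfies Spf(X)β² = Spf(X).
The body of β is ε = det(b(g)|V₁) = ±1, so β + ε is invertible and Spf(X)β = ε Spf(X). -/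

/-- The family of submodules `𝒜` makes `R` a supercommutative superalgebra. -/
structure IsSupercomm {S R : Type*} [CommRing S] [Ring R] [Algebra S R]
    (𝒜 : ZMod 2 → Submodule S R) : Prop where
  one_mem : (1 : R) ∈ 𝒜 0
  mul_mem : ∀ {i j : ZMod 2} {a b : R}, a ∈ 𝒜 i → b ∈ 𝒜 j → a * b ∈ 𝒜 (i + j)
  mul_comm : ∀ {i j : ZMod 2} {a b : R}, a ∈ 𝒜 i → b ∈ 𝒜 j →
    a * b = (-1) ^ (i * j).val * (b * a)

@[simp] theorem parity_inl {p n : ℕ} (i : Fin p ⊕ Fin p) :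
    parity (Sum.inl i : Idx p n) = 0 := rfl

@[simp] theorem parity_inr {p n : ℕ} (j : Fin n) : parity (Sum.inr j : Idx p n) = 1 := rfl

theorem zmod_two_add_self (i : ZMod 2) : i + i = 0 := CharTwo.add_self_eq_zero i

@[simp] theorem zmod_two_val_one : (1 : ZMod 2).val = 1 := rfl

@[simp] theorem zmod_two_one_add_one : (1 : ZMod 2) + 1 = 0 := rfl

theorem zmod_two_cases (i : ZMod 2) : i = 0 ∨ i = 1 := by
  revert i; decide

section Super

variable {S R : Type*} [CommRing S] [Ring R] [Algebra S R] {𝒜 : ZMod 2 → Submodule S R}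
  {p n : ℕ}

@[simp] theorem superTranspose_inl_inl (M : SuperMat p n R) (i j : Fin p ⊕ Fin p) :
    superTranspose M (Sum.inl i) (Sum.inl j) = M (Sum.inl j) (Sum.inl i) := rfl

@[simp] theorem superTranspose_inl_inr (M : SuperMat p n R) (i : Fin p ⊕ Fin p) (j : Fin n) :
    superTranspose M (Sum.inl i) (Sum.inr j) = -M (Sum.inr j) (Sum.inl i) := rfl

@[simp] theorem superTranspose_inr_inl (M : SuperMat p n R) (i : Fin n) (j : Fin p ⊕ Fin p) :
    superTranspose M (Sum.inr i) (Sum.inl j) = M (Sum.inl j) (Sum.inr i) := rfl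

@[simp] theorem superTranspose_inr_inr (M : SuperMat p n R) (i j : Fin n) :
    superTranspose M (Sum.inr i) (Sum.inr j) = M (Sum.inr j) (Sum.inr i) := rfl

namespace IsPointGl

theorem one (h : IsSupercomm 𝒜) : IsPointGl 𝒜 (1 : SuperMat p n R) := by
  intro i j
  by_cases hij : i = j
  · subst hij; simpa [zmod_two_add_self] using h.one_mem
  · simp [hij]

theorem add {M N : SuperMat p n R} (hM : IsPointGl 𝒜 M) (hN : IsPointGl 𝒜 N) :
    IsPointGl 𝒜 (M + N) := fun i j => (𝒜 _).add_mem (hM i j) (hN i j)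

theorem sub {M N : SuperMat p n R} (hM : IsPointGl 𝒜 M) (hN : IsPointGl 𝒜 N) :
    IsPointGl 𝒜 (M - N) := fun i j => (𝒜 _).sub_mem (hM i j) (hN i j)

theorem smul (c : S) {M : SuperMat p n R} (hM : IsPointGl 𝒜 M) : IsPointGl 𝒜 (c • M) :=
  fun i j => (𝒜 _).smul_mem c (hM i j)

theorem mul (h : IsSupercomm 𝒜) {M N : SuperMat p n R} (hM : IsPointGl 𝒜 M)
    (hN : IsPointGl 𝒜 N) : IsPointGl 𝒜 (M * N) := by
  intro i j
  rw [Matrix.mul_apply]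
  refine (𝒜 _).sum_mem fun k _ => ?_
  have := h.mul_mem (hM i k) (hN k j)
  rwa [show parity i + parity k + (parity k + parity j) = parity i + parity j by
    linear_combination zmod_two_add_self (parity k)] at this

theorem even_even {M : SuperMat p n R} (hM : IsPointGl 𝒜 M) (i j : Fin p ⊕ Fin p) :
    M (Sum.inl i) (Sum.inl j) ∈ 𝒜 0 := by
  simpa only [parity_inl, add_zero] using hM (Sum.inl i) (Sum.inl j)

theorem odd_odd {M : SuperMat p n R} (hM : IsPointGl 𝒜 M) (i j : Fin n) :
    M (Sum.inr i) (Sum.inr j) ∈ 𝒜 0 := by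
  simpa only [parity_inr, zmod_two_one_add_one] using hM (Sum.inr i) (Sum.inr j)

theorem even_odd {M : SuperMat p n R} (hM : IsPointGl 𝒜 M) (i : Fin p ⊕ Fin p) (j : Fin n) :
    M (Sum.inl i) (Sum.inr j) ∈ 𝒜 1 := by
  simpa only [parity_inr, parity_inl, zero_add] using hM (Sum.inl i) (Sum.inr j)

theorem odd_even {M : SuperMat p n R} (hM : IsPointGl 𝒜 M) (i : Fin n) (j : Fin p ⊕ Fin p) :
    M (Sum.inr i) (Sum.inl j) ∈ 𝒜 1 := by
  simpa only [parity_inr, parity_inl, add_zero] using hM (Sum.inr i) (Sum.inl j)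

theorem superTranspose {M : SuperMat p n R} (hM : IsPointGl 𝒜 M) :
    IsPointGl 𝒜 (SuperPfaffian.superTranspose M) := by
  rintro (i | i) (j | j)
  · simpa using hM (Sum.inl j) (Sum.inl i)
  · simpa using (𝒜 _).neg_mem (hM (Sum.inr j) (Sum.inl i))
  · simpa using hM (Sum.inl j) (Sum.inr i)
  · simpa using hM (Sum.inr j) (Sum.inr i)

end IsPointGl

theorem superTranspose_add (M N : SuperMat p n R) :
    superTranspose (M + N) = superTranspose M + superTranspose N := by
  ext (i | i) (j | j) <;> simp [add_comm]

theorem superTranspose_one : superTranspose (1 : SuperMat p n R) = 1 := by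
  ext (i | i) (j | j) <;> simp [Matrix.one_apply, eq_comm]

/-- Exchanging the factors in each product of entries costs a sign by supercommutativity; this is
exactly the discrepancy between the signs in the supertranspose of the product and those in the
product of the supertransposes. -/
theorem superTranspose_mul (h : IsSupercomm 𝒜) {M N : SuperMat p n R} (hM : IsPointGl 𝒜 M)
    (hN : IsPointGl 𝒜 N) :
    superTranspose (M * N) = superTranspose N * superTranspose M := by
  have key : ∀ i j k, M j k * N k i
      = (-1) ^ ((parity j + parity k) * (parity k + parity i)).val * (N k i * M j k) :=
    fun i j k => h.mul_comm (hM j k) (hN k i)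
  have key' : ∀ i j, (M * N) j i = ∑ k,
      (-1) ^ ((parity j + parity k) * (parity k + parity i)).val * (N k i * M j k) :=
    fun i j => by rw [Matrix.mul_apply]; exact Finset.sum_congr rfl fun k _ => key i j k
  ext (i | i) (j | j)
  all_goals
    simp only [superTranspose_inl_inl, superTranspose_inl_inr, superTranspose_inr_inl,
      superTranspose_inr_inr, key']
    rw [Matrix.mul_apply]
    simp [Fintype.sum_sum_type (α₁ := Fin p ⊕ Fin p), add_comm]

end Super

/-! ### The adjoint for B: functoriality, block form, involutivity -/

section Adjoint

variable {V₀ V₁ : Type*} [AddCommGroup V₀] [Module ℝ V₀] [AddCommGroup V₁] [Module ℝ V₁]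
  {B : SymplecticForm V₀ V₁} {p n : ℕ} (b : SymplecticBasis B p n)
  {R : Type*} [Ring R] [Algebra ℝ R]

theorem map_gram_mul_inv :
    (gram b).map (algebraMap ℝ R) * (gram b)⁻¹.map (algebraMap ℝ R) = 1 := by
  rw [← Matrix.map_mul, Matrix.mul_nonsing_inv _ (isUnit_det_gram b)]
  simp

theorem map_gram_inv_mul :
    (gram b)⁻¹.map (algebraMap ℝ R) * (gram b).map (algebraMap ℝ R) = 1 := by
  rw [← Matrix.map_mul, Matrix.nonsing_inv_mul _ (isUnit_det_gram b)]
  simp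

theorem adjoint_add (M N : SuperMat p n R) : adjoint b (M + N) = adjoint b M + adjoint b N := by
  rw [adjoint, superTranspose_add, mul_add, add_mul]; rfl

theorem adjoint_smul (t : ℝ) (M : SuperMat p n R) : adjoint b (t • M) = t • adjoint b M := by
  have : superTranspose (t • M) = t • superTranspose M := by
    ext (i | i) (j | j) <;> simp
  rw [adjoint, this, Matrix.mul_smul, Matrix.smul_mul]; rfl

theorem adjoint_one : adjoint b (1 : SuperMat p n R) = 1 := by
  rw [adjoint, superTranspose_one, mul_one, map_gram_inv_mul]

/-- `B(M v, w) = B(v, M^* w)` for coefficients that supercommute with the coordinates of `v`. -/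
theorem superForm_mulVec_left {M : SuperMat p n R} {v : Idx p n → R}
    (hMv : ∀ i j, M i j * v j = (-1) ^ ((parity i + parity j) * parity j).val * (v j * M i j))
    (w : Idx p n → R) :
    superForm b (M.mulVec v) w = superForm b v ((adjoint b M).mulVec w) := by
  rw [superForm_eq, superForm_eq, adjoint, Matrix.mulVec_mulVec, Matrix.mul_assoc,
    ← Matrix.mul_assoc, map_gram_mul_inv, one_mul, ← Matrix.mulVec_mulVec]
  generalize ((gram b).map (algebraMap ℝ R)).mulVec w = u
  simp only [Matrix.mulVec, dotProduct, Finset.sum_mul, Finset.mul_sum, Finset.smul_sum]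
  rw [Finset.sum_comm]
  refine Finset.sum_congr rfl fun j _ => Finset.sum_congr rfl fun i _ => ?_
  -- The only point where entries of M move past coordinates of v. The sign produced here, combined
  -- with the factor (-1)^{p(i)} of `superForm_eq`, is the sign in the supertranspose.
  rw [hMv]
  rcases i with i | i <;> rcases j with j | j <;> simp [mul_assoc]

/-- The adjoint uses only real Gram matrices, signs and transposition, all preserved by algebra
morphisms. This transports it between P, its complexification, the body and the function algebras.
-/
theorem map_adjoint {R' : Type*} [Ring R'] [Algebra ℝ R'] (f : R →ₐ[ℝ] R')
    (M : SuperMat p n R) : (adjoint b M).map f = adjoint b (M.map f) := by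
  have hs : (superTranspose M).map f = superTranspose (M.map f) := by
    ext (i | i) (j | j) <;> simp
  have hg : ∀ G : SuperMat p n ℝ, (G.map (algebraMap ℝ R)).map f = G.map (algebraMap ℝ R') := by
    intro G; ext i j; simp
  rw [adjoint, adjoint, ← hs, ← hg, ← hg, Matrix.map_mul, Matrix.map_mul]

variable {S : Type*} [CommRing S] [Algebra S R] {𝒜 : ZMod 2 → Submodule S R}

theorem adjoint_mul (h : IsSupercomm 𝒜) {M N : SuperMat p n R} (hM : IsPointGl 𝒜 M)
    (hN : IsPointGl 𝒜 N) : adjoint b (M * N) = adjoint b N * adjoint b M := by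
  have := map_gram_mul_inv (R := R) b
  simp only [adjoint]
  rw [superTranspose_mul h hM hN]
  calc _ = (gram b)⁻¹.map (algebraMap ℝ R) * (superTranspose N *
        ((gram b).map (algebraMap ℝ R) * (gram b)⁻¹.map (algebraMap ℝ R)) * superTranspose M) *
          (gram b).map (algebraMap ℝ R) := by rw [this, mul_one]
    _ = _ := by simp only [mul_assoc]

/-- The matrix of `B` on `V₀`. -/
def gramEven : Matrix (Fin p ⊕ Fin p) (Fin p ⊕ Fin p) ℝ :=
  Matrix.of fun i j => B.even (b.e i) (b.e j)

/-- The matrix of `B` on `V₁`. -/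
def gramOdd : Matrix (Fin n) (Fin n) ℝ := Matrix.of fun i j => B.odd (b.h i) (b.h j)

theorem gram_eq : gram b = Matrix.fromBlocks (gramEven b) 0 0 (gramOdd b) := rfl

theorem transpose_gramEven : (gramEven b).transpose = -gramEven b := by
  ext i j
  simpa [gramEven] using (LinearMap.IsAlt.neg B.even_isAlt (b.e i) (b.e j)).symm

theorem transpose_gramOdd : (gramOdd b).transpose = gramOdd b := by
  ext i j
  simpa [gramOdd] using (B.odd_isSymm.eq (b.h j) (b.h i))

theorem isUnit_det_gramEven : IsUnit (gramEven b).det := by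
  have := isUnit_det_gram b
  rw [gram_eq, Matrix.det_fromBlocks_zero₂₁] at this
  exact isUnit_of_mul_isUnit_left this

theorem isUnit_det_gramOdd : IsUnit (gramOdd b).det := by
  have := isUnit_det_gram b
  rw [gram_eq, Matrix.det_fromBlocks_zero₂₁] at this
  exact isUnit_of_mul_isUnit_right this

theorem gram_inv : (gram b)⁻¹ = Matrix.fromBlocks (gramEven b)⁻¹ 0 0 (gramOdd b)⁻¹ := by
  refine Matrix.inv_eq_right_inv ?_
  rw [gram_eq, Matrix.fromBlocks_multiply]
  simp [Matrix.mul_nonsing_inv _ (isUnit_det_gramEven b),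
    Matrix.mul_nonsing_inv _ (isUnit_det_gramOdd b)]

/-- A real matrix with entries in `R`. -/
abbrev realMat (R : Type*) [Ring R] [Algebra ℝ R] {l m : Type*} (G : Matrix l m ℝ) :
    Matrix l m R := G.map (algebraMap ℝ R)

theorem realMat_mul {l m o : Type*} [Fintype m] (G : Matrix l m ℝ) (H : Matrix m o ℝ) :
    realMat R (G * H) = realMat R G * realMat R H := Matrix.map_mul

theorem realMat_one {l : Type*} [DecidableEq l] : realMat R (1 : Matrix l l ℝ) = 1 := by
  simp [realMat]

theorem transpose_realMat_mul {l m o : Type*} [Fintype m] (G : Matrix l m ℝ) (M : Matrix m o R) :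
    (realMat R G * M).transpose = M.transpose * realMat R G.transpose := by
  ext i j
  simp [Matrix.mul_apply, Algebra.commutes]

theorem transpose_mul_realMat {l m o : Type*} [Fintype m] (M : Matrix l m R) (G : Matrix m o ℝ) :
    (M * realMat R G).transpose = realMat R G.transpose * M.transpose := by
  ext i j
  simp [Matrix.mul_apply, Algebra.commutes]

theorem adjoint_eq_fromBlocks (M : SuperMat p n R) : adjoint b M = Matrix.fromBlocks
    (realMat R (gramEven b)⁻¹ * M.toBlocks₁₁.transpose * realMat R (gramEven b))
    (-(realMat R (gramEven b)⁻¹ * M.toBlocks₂₁.transpose * realMat R (gramOdd b)))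
    (realMat R (gramOdd b)⁻¹ * M.toBlocks₁₂.transpose * realMat R (gramEven b))
    (realMat R (gramOdd b)⁻¹ * M.toBlocks₂₂.transpose * realMat R (gramOdd b)) := by
  rw [adjoint, gram_inv, gram_eq, superTranspose, Matrix.fromBlocks_map, Matrix.fromBlocks_map,
    Matrix.fromBlocks_multiply, Matrix.fromBlocks_multiply]
  simp [Matrix.map_zero]

/-- The double supertranspose negates the off-diagonal blocks. The even Gram matrix is skew and the
odd one symmetric, so conjugation by them negates the same blocks once more, and the signs cancel.
-/
theorem adjoint_adjoint (M : SuperMat p n R) : adjoint b (adjoint b M) = M := by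
  have h₀ : realMat R (gramEven b)⁻¹ * realMat R (gramEven b) = 1 := by
    rw [← realMat_mul, Matrix.nonsing_inv_mul _ (isUnit_det_gramEven b), realMat_one]
  have h₁ : realMat R (gramOdd b)⁻¹ * realMat R (gramOdd b) = 1 := by
    rw [← realMat_mul, Matrix.nonsing_inv_mul _ (isUnit_det_gramOdd b), realMat_one]
  have t₀ : realMat R (gramEven b).transpose = -realMat R (gramEven b) := by
    rw [transpose_gramEven]; ext; simp
  have t₀' : realMat R (gramEven b)⁻¹.transpose = -realMat R (gramEven b)⁻¹ := by
    have : (-gramEven b)⁻¹ = -(gramEven b)⁻¹ := Matrix.inv_eq_right_inv (by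
      rw [neg_mul_neg, Matrix.mul_nonsing_inv _ (isUnit_det_gramEven b)])
    rw [Matrix.transpose_nonsing_inv, transpose_gramEven, this]; ext; simp
  have t₁ : realMat R (gramOdd b).transpose = realMat R (gramOdd b) := by
    rw [transpose_gramOdd]
  have t₁' : realMat R (gramOdd b)⁻¹.transpose = realMat R (gramOdd b)⁻¹ := by
    rw [Matrix.transpose_nonsing_inv, transpose_gramOdd]
  conv_rhs => rw [← Matrix.fromBlocks_toBlocks M]
  rw [adjoint_eq_fromBlocks b M, adjoint_eq_fromBlocks]
  simp only [Matrix.toBlocks_fromBlocks₁₁, Matrix.toBlocks_fromBlocks₁₂,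
    Matrix.toBlocks_fromBlocks₂₁, Matrix.toBlocks_fromBlocks₂₂, transpose_mul_realMat,
    transpose_realMat_mul, Matrix.transpose_neg, Matrix.transpose_transpose, t₀, t₀', t₁, t₁',
    Matrix.mul_neg, Matrix.neg_mul, neg_neg, ← Matrix.mul_assoc, h₀, h₁, Matrix.one_mul]
  simp only [Matrix.mul_assoc, h₀, h₁, Matrix.mul_one]

theorem IsPointGl.adjoint [Algebra ℝ S] [IsScalarTower ℝ S R] (h : IsSupercomm 𝒜)
    {M : SuperMat p n R} (hM : IsPointGl 𝒜 M) : IsPointGl 𝒜 (adjoint b M) := by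
  have hr : ∀ r : ℝ, algebraMap ℝ R r ∈ 𝒜 0 := fun r => by
    rw [IsScalarTower.algebraMap_apply ℝ S R, Algebra.algebraMap_eq_smul_one]
    exact (𝒜 0).smul_mem _ h.one_mem
  have hg : ∀ (G₀ : Matrix (Fin p ⊕ Fin p) (Fin p ⊕ Fin p) ℝ) (G₁ : Matrix (Fin n) (Fin n) ℝ),
      IsPointGl 𝒜 ((Matrix.fromBlocks G₀ 0 0 G₁).map (algebraMap ℝ R) : SuperMat p n R) := by
    rintro G₀ G₁ (i | i) (j | j)
    · simpa using hr _
    · simp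
    · simp
    · simpa using hr _
  rw [SuperPfaffian.adjoint, gram_inv, gram_eq]
  exact ((hg _ _).mul h hM.superTranspose).mul h (hg _ _)

end Adjoint

/-! ### The exterior algebra -/

section Exterior

variable {W V₁ : Type*} [AddCommGroup W] [Module ℝ W] [AddCommGroup V₁] [Module ℝ V₁]

local notation "Λ" => ExteriorAlgebra ℝ (Module.Dual ℝ V₁)

theorem exterior_ι_mul (m : W) (x : ExteriorAlgebra ℝ W) :
    ExteriorAlgebra.ι ℝ m * x = CliffordAlgebra.involute x * ExteriorAlgebra.ι ℝ m := by
  induction x using CliffordAlgebra.left_induction with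
  | algebraMap r => rw [AlgHom.commutes, Algebra.commutes]
  | add x y hx hy => rw [mul_add, map_add, add_mul, hx, hy]
  | ι_mul x m' hx =>
    rw [map_mul, mul_assoc, ← hx, CliffordAlgebra.involute_ι, ← mul_assoc, ← mul_assoc]
    congr 1
    rw [neg_mul, eq_neg_iff_add_eq_zero]
    exact ExteriorAlgebra.ι_add_mul_swap m m'

theorem oddDeriv_ι_mul (w : V₁) (m : Module.Dual ℝ V₁) (x : Λ) :
    oddDeriv w (ExteriorAlgebra.ι ℝ m * x)
      = m w • x - ExteriorAlgebra.ι ℝ m * oddDeriv w x :=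
  CliffordAlgebra.contractLeft_ι_mul _ _ _

theorem oddDeriv_algebraMap (w : V₁) (r : ℝ) : oddDeriv w (algebraMap ℝ Λ r) = 0 :=
  CliffordAlgebra.contractLeft_algebraMap _ _ _

theorem oddDeriv_ι (w : V₁) (m : Module.Dual ℝ V₁) :
    oddDeriv w (ExteriorAlgebra.ι ℝ m) = algebraMap ℝ Λ (m w) :=
  CliffordAlgebra.contractLeft_ι _ _ _

/-- Graded Leibniz rule, by induction on the first factor from the rule for a single generator. -/
theorem oddDeriv_mul (w : V₁) (x y : Λ) :
    oddDeriv w (x * y) = oddDeriv w x * y + CliffordAlgebra.involute x * oddDeriv w y := by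
  induction x using CliffordAlgebra.left_induction with
  | algebraMap r =>
    rw [AlgHom.commutes, oddDeriv_algebraMap, ← Algebra.smul_def, ← Algebra.smul_def, map_smul,
      zero_mul, zero_add]
  | add x x' hx hx' => simp only [map_add, add_mul, hx, hx']; abel
  | ι_mul x m hx =>
    have h1 := oddDeriv_ι_mul w m (x * y)
    have h2 := oddDeriv_ι_mul w m x
    rw [← mul_assoc] at h1
    refine h1.trans ?_
    refine Eq.trans ?_ (congrArg₂ (· + ·) (congrArg (· * y) h2.symm) rfl)
    rw [hx, map_mul, CliffordAlgebra.involute_ι]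
    simp only [mul_add, sub_mul, neg_mul, mul_assoc, smul_mul_assoc]
    abel_nf

/-- Contraction lowers the exterior degree by one, hence anticommutes with the parity involution. -/
theorem involute_oddDeriv (w : V₁) (x : Λ) :
    CliffordAlgebra.involute (oddDeriv w x) = -oddDeriv w (CliffordAlgebra.involute x) := by
  induction x using CliffordAlgebra.left_induction with
  | algebraMap r => rw [AlgHom.commutes, oddDeriv_algebraMap, map_zero, neg_zero]
  | add x y hx hy => simp only [map_add, hx, hy, neg_add]
  | ι_mul x m hx =>
    have h1 : CliffordAlgebra.involute (CliffordAlgebra.ι _ m * x)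
        = -(ExteriorAlgebra.ι ℝ m * CliffordAlgebra.involute x) := by
      rw [map_mul, CliffordAlgebra.involute_ι, neg_mul]
    rw [h1, map_neg, neg_neg, oddDeriv_ι_mul, oddDeriv_ι_mul]
    rw [map_sub, map_smul, map_mul, hx, mul_neg]
    congr 1
    have h2 : CliffordAlgebra.involute (ExteriorAlgebra.ι ℝ m) = -ExteriorAlgebra.ι ℝ m :=
      CliffordAlgebra.involute_ι m
    rw [h2, neg_mul, neg_neg]

/-- Chain rule for a linear substitution: pulling back forms pushes the direction of differentiation
forward. -/
theorem oddDeriv_map (φ : V₁ →ₗ[ℝ] V₁) (w : V₁) (x : Λ) :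
    oddDeriv w (ExteriorAlgebra.map φ.dualMap x)
      = ExteriorAlgebra.map φ.dualMap (oddDeriv (φ w) x) := by
  induction x using CliffordAlgebra.left_induction with
  | algebraMap r =>
    rw [AlgHom.commutes, oddDeriv_algebraMap]
    erw [oddDeriv_algebraMap]
    rw [map_zero]
  | add x y hx hy => simp only [map_add, hx, hy]
  | ι_mul x m hx =>
    have h1 : ExteriorAlgebra.map φ.dualMap (ExteriorAlgebra.ι ℝ m * x)
      = ExteriorAlgebra.ι ℝ (φ.dualMap m) * ExteriorAlgebra.map φ.dualMap x := by
      rw [map_mul, ExteriorAlgebra.map_apply_ι]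
    refine (congrArg _ h1).trans ?_
    rw [oddDeriv_ι_mul, hx]
    refine Eq.trans ?_ (congrArg _ (oddDeriv_ι_mul (φ w) m x).symm)
    rw [map_sub, map_smul, map_mul, ExteriorAlgebra.map_apply_ι]
    rfl

theorem oddDeriv_mul_self (w : V₁) : oddDeriv w * oddDeriv w = 0 :=
  LinearMap.ext fun _ => CliffordAlgebra.contractLeft_contractLeft _ _

theorem oddDeriv_mul_comm (w w' : V₁) :
    oddDeriv w * oddDeriv w' = (-1 : ℝ) • (oddDeriv w' * oddDeriv w) :=
  LinearMap.ext fun x => (CliffordAlgebra.contractLeft_comm _ _ x).trans (neg_one_smul ℝ _).symm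

/-- The scalar is a power of -1; its value is irrelevant, since it only serves to bring two equal
derivatives next to each other. -/
theorem exists_oddDeriv_mul_prod (w : V₁) (l : List V₁) :
    ∃ c : ℝ, oddDeriv w * (l.map oddDeriv).prod = c • ((l.map oddDeriv).prod * oddDeriv w) := by
  induction l with
  | nil => exact ⟨1, by simp⟩
  | cons w' l ih =>
    obtain ⟨c, hc⟩ := ih
    refine ⟨-1 * c, ?_⟩
    rw [List.map_cons, List.prod_cons, ← mul_assoc, oddDeriv_mul_comm, smul_mul_assoc, mul_assoc,
      hc, mul_smul_comm, smul_smul, mul_assoc]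

theorem prod_oddDeriv_mul (w : V₁) (l : List V₁) (h : w ∈ l) :
    (l.map oddDeriv).prod * oddDeriv w = 0 := by
  induction l with
  | nil => simp at h
  | cons w' l ih =>
    rw [List.map_cons, List.prod_cons]
    rcases List.mem_cons.1 h with rfl | h
    · obtain ⟨k, hk⟩ := exists_oddDeriv_mul_prod w l
      rw [hk, smul_mul_assoc, mul_assoc, oddDeriv_mul_self, mul_zero, smul_zero]
    · rw [mul_assoc, ih h, mul_zero]

/-- Odd derivatives anticommute and square to zero, so a repeated direction kills the product. This
is what makes `iteratedOddDeriv` alternating. -/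
theorem prod_oddDeriv_eq_zero (l : List V₁) (h : ¬ l.Nodup) : (l.map oddDeriv).prod = 0 := by
  induction l with
  | nil => simp at h
  | cons w l ih =>
    rw [List.map_cons, List.prod_cons]
    by_cases hw : w ∈ l
    · obtain ⟨k, hk⟩ := exists_oddDeriv_mul_prod w l
      rw [hk, prod_oddDeriv_mul w l hw, smul_zero]
    · rw [ih (fun hl => h (List.nodup_cons.2 ⟨hw, hl⟩)), mul_zero]

/-- The iterated derivative `∂_{w_1} ⋯ ∂_{w_n} x` at `0`, as an alternating form in `w`. -/
def iteratedOddDeriv (n : ℕ) (x : Λ) : V₁ [⋀^Fin n]→ₗ[ℝ] ℝ where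
  toMultilinearMap := ((ExteriorAlgebra.algebraMapInv.toLinearMap ∘ₗ LinearMap.applyₗ x).compMultilinearMap
    ((MultilinearMap.mkPiAlgebraFin ℝ n (Module.End ℝ Λ)).compLinearMap
      fun _ => (CliffordAlgebra.contractLeft ∘ₗ Module.Dual.eval ℝ V₁)))
  map_eq_zero_of_eq' w i j hw hij := by
    have : (List.ofFn fun k => oddDeriv (w k)).prod = 0 := by
      have := prod_oddDeriv_eq_zero (List.ofFn w) (fun h => hij (List.nodup_ofFn.1 h hw))
      rwa [List.map_ofFn] at this
    have h2 : ExteriorAlgebra.algebraMapInv ((List.ofFn fun k => oddDeriv (w k)).prod x) = (0 : ℝ) := by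
      rw [this]; simp
    exact h2

theorem iteratedOddDeriv_apply {n : ℕ} (x : Λ) (w : Fin n → V₁) : iteratedOddDeriv n x w
    = ExteriorAlgebra.algebraMapInv ((List.ofFn fun k => oddDeriv (w k)).prod x) := rfl

variable {V₀ : Type*} [AddCommGroup V₀] [Module ℝ V₀]
  {B : SymplecticForm V₀ V₁} {p n : ℕ} (b : SymplecticBasis B p n)

theorem berezinReal_apply (x : Λ) : berezinReal b x = iteratedOddDeriv n x b.h := rfl

/-- The direction h_j already occurs among the n derivatives of the Berezin integral. This is
integration by parts in the odd directions. -/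
theorem berezinReal_oddDeriv (j : Fin n) (x : Λ) : berezinReal b (oddDeriv (b.h j) x) = 0 := by
  have := prod_oddDeriv_mul (b.h j) (List.ofFn b.h) (by simp)
  rw [List.map_ofFn] at this
  have h2 : (List.ofFn fun k => oddDeriv (b.h k)).prod (oddDeriv (b.h j) x) = 0 :=
    DFunLike.congr_fun this x
  rw [berezinReal_apply, iteratedOddDeriv_apply, h2, map_zero]

theorem prod_oddDeriv_map (φ : V₁ →ₗ[ℝ] V₁) (l : List V₁) (x : Λ) :
    (l.map oddDeriv).prod (ExteriorAlgebra.map φ.dualMap x)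
      = ExteriorAlgebra.map φ.dualMap (((l.map φ).map oddDeriv).prod x) := by
  induction l with
  | nil => simp
  | cons w l ih =>
    simp only [List.map_cons, List.prod_cons, Module.End.mul_apply] at ih ⊢
    rw [ih, oddDeriv_map]

/-- By the chain rule the left side is the alternating n-form `iteratedOddDeriv` evaluated at φ ∘ h,
and an alternating n-form in dimension n is a multiple of the determinant. So the odd Jacobian
enters as det φ, not as its inverse or absolute value. -/
theorem berezinReal_map (φ : V₁ →ₗ[ℝ] V₁) (x : Λ) :
    berezinReal b (ExteriorAlgebra.map φ.dualMap x) = LinearMap.det φ * berezinReal b x := by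
  have hinv : ∀ y : Λ, ExteriorAlgebra.algebraMapInv (ExteriorAlgebra.map φ.dualMap y)
      = (ExteriorAlgebra.algebraMapInv y : ℝ) := fun y => by
    have : (ExteriorAlgebra.algebraMapInv (R := ℝ)).comp (ExteriorAlgebra.map φ.dualMap)
        = ExteriorAlgebra.algebraMapInv := by
      ext m; simp [ExteriorAlgebra.algebraMapInv]
    exact DFunLike.congr_fun this y
  have h := prod_oddDeriv_map φ (List.ofFn b.h) x
  rw [List.map_ofFn, List.map_ofFn, List.map_ofFn] at h
  have h2 : berezinReal b (ExteriorAlgebra.map φ.dualMap x) = iteratedOddDeriv n x (φ ∘ b.h) := by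
    rw [berezinReal_apply, iteratedOddDeriv_apply, iteratedOddDeriv_apply,
      ← hinv ((List.ofFn fun k => oddDeriv ((φ ∘ b.h) k)).prod x)]
    exact congrArg _ h
  rw [h2, berezinReal_apply, AlternatingMap.eq_smul_basis_det b.h (iteratedOddDeriv n x)]
  simp [Module.Basis.det_comp, mul_left_comm]

end Exterior

/-! ### Functions on the odd part -/

section Involution

variable {P : Type*} [Ring P] [Algebra ℝ P] (𝒜 : ZMod 2 → Submodule ℝ P) [GradedAlgebra 𝒜]

/-- The linear map `a ↦ (-1)^{p(a)} a`. -/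
def gradeInvLin : P →ₗ[ℝ] P := GradedAlgebra.proj 𝒜 0 - GradedAlgebra.proj 𝒜 1

theorem gradeInvLin_apply {i : ZMod 2} {a : P} (ha : a ∈ 𝒜 i) :
    gradeInvLin 𝒜 a = (-1 : ℝ) ^ i.val • a := by
  rcases zmod_two_cases i with rfl | rfl
  · simp [gradeInvLin, GradedAlgebra.proj_apply, DirectSum.decompose_of_mem_same 𝒜 ha,
      DirectSum.decompose_of_mem_ne 𝒜 ha (show (0 : ZMod 2) ≠ 1 by decide)]
  · simp [gradeInvLin, GradedAlgebra.proj_apply, DirectSum.decompose_of_mem_same 𝒜 ha,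
      DirectSum.decompose_of_mem_ne 𝒜 ha (show (1 : ZMod 2) ≠ 0 by decide)]

theorem gradeInvLin_mul (a a' : P) :
    gradeInvLin 𝒜 (a * a') = gradeInvLin 𝒜 a * gradeInvLin 𝒜 a' := by
  induction a using DirectSum.Decomposition.inductionOn 𝒜 with
  | zero => simp
  | add a₁ a₂ h₁ h₂ => rw [add_mul, map_add, map_add, add_mul, h₁, h₂]
  | @homogeneous i a =>
    induction a' using DirectSum.Decomposition.inductionOn 𝒜 with
    | zero => simp
    | add a₁ a₂ h₁ h₂ => rw [mul_add, map_add, map_add, mul_add, h₁, h₂]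
    | @homogeneous j a' =>
      rw [gradeInvLin_apply 𝒜 a.2, gradeInvLin_apply 𝒜 a'.2,
        gradeInvLin_apply 𝒜 (SetLike.mul_mem_graded a.2 a'.2)]
      rcases zmod_two_cases i with rfl | rfl <;> rcases zmod_two_cases j with rfl | rfl <;> simp

/-- The grading automorphism `a ↦ (-1)^{p(a)} a`. -/
def gradeInv : P →ₐ[ℝ] P :=
  AlgHom.ofLinearMap (gradeInvLin 𝒜)
    (by simpa using gradeInvLin_apply 𝒜 (SetLike.GradedOne.one_mem (A := 𝒜)))
    (gradeInvLin_mul 𝒜)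

theorem gradeInv_apply {i : ZMod 2} {a : P} (ha : a ∈ 𝒜 i) :
    gradeInv 𝒜 a = (-1 : ℝ) ^ i.val • a := gradeInvLin_apply 𝒜 ha

theorem gradeInv_gradeInv (a : P) : gradeInv 𝒜 (gradeInv 𝒜 a) = a := by
  induction a using DirectSum.Decomposition.inductionOn 𝒜 with
  | zero => simp
  | add a₁ a₂ h₁ h₂ => rw [map_add, map_add, h₁, h₂]
  | @homogeneous i a =>
    rw [gradeInv_apply 𝒜 a.2, map_smul, gradeInv_apply 𝒜 a.2, smul_smul, ← pow_add, ← two_mul]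
    simp

variable [NearSuperalgebra 𝒜]

theorem isSupercomm : IsSupercomm 𝒜 where
  one_mem := SetLike.GradedOne.one_mem
  mul_mem ha hb := SetLike.mul_mem_graded ha hb
  mul_comm ha hb := NearSuperalgebra.supercomm _ _ _ _ ha hb

/-- Supercommutativity with only one homogeneous factor: the sign is absorbed in the grading
automorphism applied to the other. -/
theorem mul_eq_gradeInv_mul {j : ZMod 2} {a : P} (ha : a ∈ 𝒜 j) (a' : P) :
    a * a' = (gradeInv 𝒜 ^ j.val) a' * a := by
  induction a' using DirectSum.Decomposition.inductionOn 𝒜 with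
  | zero => simp
  | add a₁ a₂ h₁ h₂ => rw [mul_add, map_add, add_mul, h₁, h₂]
  | @homogeneous i a' =>
    rw [NearSuperalgebra.supercomm (𝒜 := 𝒜) _ _ _ _ ha a'.2]
    rcases zmod_two_cases i with rfl | rfl <;> rcases zmod_two_cases j with rfl | rfl <;>
      simp [gradeInv_apply 𝒜 a'.2]

end Involution

/-! ### The superalgebra Λ(V₁^*) ⊗ P: signs, derivatives, substitutions, Berezin integral -/

section OddFun

variable {V₁ : Type*} [AddCommGroup V₁] [Module ℝ V₁]
  {P : Type*} [Ring P] [Algebra ℝ P] (𝒜 : ZMod 2 → Submodule ℝ P) [GradedAlgebra 𝒜]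

local notation "Λ" => ExteriorAlgebra ℝ (Module.Dual ℝ V₁)
local notation "ℒ" => CliffordAlgebra.evenOdd (0 : QuadraticForm ℝ (Module.Dual ℝ V₁))

namespace OddFun

/-- The function `l ⊗ a`. -/
def mk (l : Λ) (a : P) : OddFun V₁ 𝒜 := GradedTensorProduct.of ℝ ℒ 𝒜 (l ⊗ₜ[ℝ] a)

theorem induction {C : OddFun V₁ 𝒜 → Prop}
    (mk : ∀ (l : Λ) (j : ZMod 2) (a : P), a ∈ 𝒜 j → C (mk 𝒜 l a))
    (add : ∀ s t, C s → C t → C (s + t)) (s : OddFun V₁ 𝒜) : C s := by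
  have h0 : C 0 := by simpa [OddFun.mk] using mk 0 0 0 (𝒜 0).zero_mem
  obtain ⟨s, rfl⟩ := (GradedTensorProduct.of ℝ ℒ 𝒜).surjective s
  induction s using TensorProduct.induction_on with
  | zero => simpa using h0
  | add s t hs ht => rw [map_add]; exact add _ _ hs ht
  | tmul l a =>
    induction a using DirectSum.Decomposition.inductionOn 𝒜 with
    | zero => simpa using h0
    | add a₁ a₂ h₁ h₂ => rw [TensorProduct.tmul_add, map_add]; exact add _ _ h₁ h₂
    | homogeneous a => exact mk l _ a a.2

theorem mk_add_left (l₁ l₂ : Λ) (a : P) : mk 𝒜 (l₁ + l₂) a = mk 𝒜 l₁ a + mk 𝒜 l₂ a := by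
  simp only [mk, TensorProduct.add_tmul, map_add]

theorem mk_add_right (l : Λ) (a₁ a₂ : P) : mk 𝒜 l (a₁ + a₂) = mk 𝒜 l a₁ + mk 𝒜 l a₂ := by
  simp only [mk, TensorProduct.tmul_add, map_add]

theorem mk_smul_left (r : ℝ) (l : Λ) (a : P) : mk 𝒜 (r • l) a = r • mk 𝒜 l a := by
  simp only [mk, ← TensorProduct.smul_tmul', map_smul]

theorem mk_smul_right (r : ℝ) (l : Λ) (a : P) : mk 𝒜 l (r • a) = r • mk 𝒜 l a := by
  simp only [mk, TensorProduct.tmul_smul, map_smul]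

theorem mk_neg_left (l : Λ) (a : P) : mk 𝒜 (-l) a = -mk 𝒜 l a := by
  simp only [mk, TensorProduct.neg_tmul, map_neg]

theorem mk_neg_right (l : Λ) (a : P) : mk 𝒜 l (-a) = -mk 𝒜 l a := by
  simp only [mk, TensorProduct.tmul_neg, map_neg]

/-- The Koszul sign of the graded tensor product is rewritten as a power of the parity involution on
the second exterior factor, so that this factor need not be homogeneous in later computations. -/
theorem mk_mul_mk {j : ZMod 2} {a : P} (ha : a ∈ 𝒜 j) (l l' : Λ) (a' : P) :
    mk 𝒜 l a * mk 𝒜 l' a' = mk 𝒜 (l * (CliffordAlgebra.involute ^ j.val) l') (a * a') := by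
  induction l' using DirectSum.Decomposition.inductionOn ℒ with
  | zero => simp [mk]
  | add l₁ l₂ h₁ h₂ =>
    rw [map_add, mul_add, mk_add_left, mk_add_left, mul_add, h₁, h₂]
  | @homogeneous i l' =>
    refine (GradedTensorProduct.tmul_coe_mul_coe_tmul (R := ℝ) ℒ 𝒜 l ⟨a, ha⟩ l' a').trans ?_
    rcases zmod_two_cases j with rfl | rfl
    · simp [mk]
    · rcases zmod_two_cases i with rfl | rfl
      · have := CliffordAlgebra.involute_eq_of_mem_even l'.2
        simp [mk, this]
      · have := CliffordAlgebra.involute_eq_of_mem_odd l'.2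
        simp [mk, this, TensorProduct.neg_tmul]

theorem one_eq_mk : (1 : OddFun V₁ 𝒜) = mk 𝒜 1 1 := rfl

theorem mk_mul_mk_one {a : P} (l : Λ) (a' : P) : mk 𝒜 l a' * mk 𝒜 1 a = mk 𝒜 l (a' * a) := by
  induction a' using DirectSum.Decomposition.inductionOn 𝒜 with
  | zero => simp [mk]
  | add a₁ a₂ h₁ h₂ => rw [mk_add_right, add_mul, h₁, h₂, add_mul, mk_add_right]
  | homogeneous a' => rw [mk_mul_mk 𝒜 a'.2, map_one, mul_one]

/-- The grading automorphism of the functions. -/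
def α : OddFun V₁ 𝒜 →ₐ[ℝ] OddFun V₁ 𝒜 :=
  AlgHom.ofLinearMap ((GradedTensorProduct.of ℝ ℒ 𝒜).toLinearMap ∘ₗ
    TensorProduct.map CliffordAlgebra.involute.toLinearMap (gradeInv 𝒜).toLinearMap ∘ₗ
    (GradedTensorProduct.of ℝ ℒ 𝒜).symm.toLinearMap)
    (by
      change mk 𝒜 (CliffordAlgebra.involute 1) (gradeInv 𝒜 1) = mk 𝒜 1 1
      rw [map_one, map_one])
    (fun s t => by
      induction s using OddFun.induction with
      | add s₁ s₂ h₁ h₂ => rw [add_mul, map_add, map_add, add_mul, h₁, h₂]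
      | mk l j a ha =>
        induction t using OddFun.induction with
        | add t₁ t₂ h₁ h₂ => rw [mul_add, map_add, map_add, mul_add, h₁, h₂]
        | mk l' j' a' ha' =>
          have h : gradeInv 𝒜 a ∈ 𝒜 j := by
            rw [gradeInv_apply 𝒜 ha]; exact (𝒜 j).smul_mem _ ha
          refine Eq.trans ?_ (mk_mul_mk 𝒜 h (CliffordAlgebra.involute l)
            (CliffordAlgebra.involute l') (gradeInv 𝒜 a')).symm
          rw [mk_mul_mk 𝒜 ha, ← map_mul, ← AlgHom.mul_apply, ← pow_succ, pow_succ',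
            AlgHom.mul_apply, ← map_mul]
          rfl)

theorem α_mk (l : Λ) (a : P) :
    α 𝒜 (mk 𝒜 l a) = mk 𝒜 (CliffordAlgebra.involute l) (gradeInv 𝒜 a) := rfl

theorem α_α (s : OddFun V₁ 𝒜) : α 𝒜 (α 𝒜 s) = s := by
  induction s using OddFun.induction with
  | add s t hs ht => rw [map_add, map_add, hs, ht]
  | mk l j a ha => rw [α_mk, α_mk, gradeInv_gradeInv]; erw [CliffordAlgebra.involute_involute]

/-- The odd coordinate given by a linear form. -/
def coord (m : Module.Dual ℝ V₁) : OddFun V₁ 𝒜 := mk 𝒜 (ExteriorAlgebra.ι ℝ m) 1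

/-- The inclusion of the constants. -/
def const : P →ₐ[ℝ] OddFun V₁ 𝒜 := GradedTensorProduct.includeRight ℒ 𝒜

theorem const_apply (a : P) : (const 𝒜 a : OddFun V₁ 𝒜) = mk 𝒜 1 a := rfl

theorem α_coord (m : Module.Dual ℝ V₁) : α 𝒜 (coord 𝒜 m) = -coord 𝒜 m := by
  rw [coord, α_mk, map_one, ← mk_neg_left]
  congr 1
  exact CliffordAlgebra.involute_ι m

theorem α_const {j : ZMod 2} {a : P} (ha : a ∈ 𝒜 j) :
    α 𝒜 (const 𝒜 a : OddFun V₁ 𝒜) = (-1) ^ j.val * const 𝒜 a := by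
  rw [const_apply, α_mk, gradeInv_apply 𝒜 ha, map_one, mk_smul_right]
  rcases zmod_two_cases j with rfl | rfl <;> simp

theorem coord_mul (m : Module.Dual ℝ V₁) (s : OddFun V₁ 𝒜) :
    coord 𝒜 m * s = α 𝒜 s * coord 𝒜 m := by
  induction s using OddFun.induction with
  | add s t hs ht => rw [mul_add, map_add, add_mul, hs, ht]
  | mk l j a ha =>
    have h : gradeInv 𝒜 a ∈ 𝒜 j := by
      rw [gradeInv_apply 𝒜 ha]; exact (𝒜 j).smul_mem _ ha
    rw [coord, mk_mul_mk 𝒜 SetLike.GradedOne.one_mem, α_mk, mk_mul_mk 𝒜 h, gradeInv_apply 𝒜 ha]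
    have h1 := exterior_ι_mul m l
    have h2 : CliffordAlgebra.involute (ExteriorAlgebra.ι ℝ m) = -ExteriorAlgebra.ι ℝ m :=
      CliffordAlgebra.involute_ι m
    rcases zmod_two_cases j with rfl | rfl
    · simp [h1]
    · simp [h1, h2, mk_neg_left, mk_neg_right]

/-- The partial derivative in the direction of `w`. -/
def deriv (w : V₁) : OddFun V₁ 𝒜 →ₗ[ℝ] OddFun V₁ 𝒜 :=
  (GradedTensorProduct.of ℝ ℒ 𝒜).toLinearMap ∘ₗ LinearMap.rTensor P (oddDeriv w) ∘ₗ
    (GradedTensorProduct.of ℝ ℒ 𝒜).symm.toLinearMap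

theorem deriv_mk (w : V₁) (l : Λ) (a : P) : deriv 𝒜 w (mk 𝒜 l a) = mk 𝒜 (oddDeriv w l) a := rfl

theorem deriv_mul (w : V₁) (s t : OddFun V₁ 𝒜) :
    deriv 𝒜 w (s * t) = deriv 𝒜 w s * t + α 𝒜 s * deriv 𝒜 w t := by
  induction s using OddFun.induction with
  | add s₁ s₂ h₁ h₂ => simp only [add_mul, map_add, h₁, h₂]; abel
  | mk l j a ha =>
    induction t using OddFun.induction with
    | add t₁ t₂ h₁ h₂ => simp only [mul_add, map_add, h₁, h₂]; abel
    | mk l' j' a' ha' =>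
      have h : gradeInv 𝒜 a ∈ 𝒜 j := by
        rw [gradeInv_apply 𝒜 ha]; exact (𝒜 j).smul_mem _ ha
      rw [mk_mul_mk 𝒜 ha, deriv_mk, deriv_mk, deriv_mk, mk_mul_mk 𝒜 ha, α_mk, mk_mul_mk 𝒜 h,
        oddDeriv_mul, gradeInv_apply 𝒜 ha, mk_add_left]
      congr 1
      rcases zmod_two_cases j with rfl | rfl
      · simp
      · simp only [zmod_two_val_one, pow_one, neg_one_smul, neg_mul, involute_oddDeriv, mul_neg,
          mk_neg_left]
        rw [mk_neg_right, neg_neg]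

theorem deriv_coord (w : V₁) (m : Module.Dual ℝ V₁) :
    deriv 𝒜 w (coord 𝒜 m) = algebraMap ℝ _ (m w) := by
  rw [coord, deriv_mk, oddDeriv_ι, Algebra.algebraMap_eq_smul_one, mk_smul_left,
    Algebra.algebraMap_eq_smul_one, one_eq_mk]

theorem deriv_const (w : V₁) (a : P) : deriv 𝒜 w (const 𝒜 a) = 0 := by
  rw [const_apply, deriv_mk, ← map_one (algebraMap ℝ Λ), oddDeriv_algebraMap]
  simp [mk]

/-- The substitution given by a linear map. -/
def subst (φ : V₁ →ₗ[ℝ] V₁) : OddFun V₁ 𝒜 →ₐ[ℝ] OddFun V₁ 𝒜 :=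
  AlgHom.ofLinearMap ((GradedTensorProduct.of ℝ ℒ 𝒜).toLinearMap ∘ₗ
    LinearMap.rTensor P (ExteriorAlgebra.map φ.dualMap).toLinearMap ∘ₗ
    (GradedTensorProduct.of ℝ ℒ 𝒜).symm.toLinearMap)
    (by
      change mk 𝒜 (ExteriorAlgebra.map φ.dualMap 1) 1 = mk 𝒜 1 1
      rw [map_one])
    (fun s t => by
      have hinv : ∀ l : Λ, ExteriorAlgebra.map φ.dualMap (CliffordAlgebra.involute l)
          = CliffordAlgebra.involute (ExteriorAlgebra.map φ.dualMap l) := fun l => by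
        have : (ExteriorAlgebra.map φ.dualMap).comp CliffordAlgebra.involute
            = AlgHom.comp CliffordAlgebra.involute (ExteriorAlgebra.map φ.dualMap) := by
          ext m
          have h2 : ∀ m : Module.Dual ℝ V₁, CliffordAlgebra.involute (ExteriorAlgebra.ι ℝ m)
              = -ExteriorAlgebra.ι ℝ m := CliffordAlgebra.involute_ι
          simp [h2]
        exact DFunLike.congr_fun this l
      induction s using OddFun.induction with
      | add s₁ s₂ h₁ h₂ => rw [add_mul, map_add, map_add, add_mul, h₁, h₂]
      | mk l j a ha =>
        induction t using OddFun.induction with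
        | add t₁ t₂ h₁ h₂ => rw [mul_add, map_add, map_add, mul_add, h₁, h₂]
        | mk l' j' a' ha' =>
          refine Eq.trans ?_ (mk_mul_mk 𝒜 ha (ExteriorAlgebra.map φ.dualMap l)
            (ExteriorAlgebra.map φ.dualMap l') a').symm
          rw [mk_mul_mk 𝒜 ha]
          change mk 𝒜 (ExteriorAlgebra.map φ.dualMap _) _ = _
          rw [map_mul]
          rcases zmod_two_cases j with rfl | rfl
          · simp
          · simp [hinv])

theorem subst_mk (φ : V₁ →ₗ[ℝ] V₁) (l : Λ) (a : P) :
    subst 𝒜 φ (mk 𝒜 l a) = mk 𝒜 (ExteriorAlgebra.map φ.dualMap l) a := rfl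

theorem subst_const (φ : V₁ →ₗ[ℝ] V₁) (a : P) : subst 𝒜 φ (const 𝒜 a) = const 𝒜 a := by
  rw [const_apply, subst_mk, map_one]

theorem subst_coord (φ : V₁ →ₗ[ℝ] V₁) (m : Module.Dual ℝ V₁) :
    subst 𝒜 φ (coord 𝒜 m) = coord 𝒜 (φ.dualMap m) := by
  rw [coord, subst_mk, ExteriorAlgebra.map_apply_ι]; rfl

theorem coord_sum {ι : Type*} (t : Finset ι) (r : ι → ℝ) (m : ι → Module.Dual ℝ V₁) :
    coord 𝒜 (∑ i ∈ t, r i • m i) = ∑ i ∈ t, r i • coord 𝒜 (m i) := by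
  simp only [coord, mk, map_sum, map_smul, TensorProduct.sum_tmul, ← TensorProduct.smul_tmul']

section Berezin

variable {V₀ : Type*} [AddCommGroup V₀] [Module ℝ V₀]
  {B : SymplecticForm V₀ V₁} {p n : ℕ} (b : SymplecticBasis B p n)

/-- The Berezin integral `∂/∂η_1 ⋯ ∂/∂η_n`. -/
def ber : OddFun V₁ 𝒜 →ₗ[ℝ] P :=
  (TensorProduct.lid ℝ P).toLinearMap ∘ₗ LinearMap.rTensor P (berezinReal b) ∘ₗ
    (GradedTensorProduct.of ℝ ℒ 𝒜).symm.toLinearMap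

theorem ber_mk (l : Λ) (a : P) : ber 𝒜 b (mk 𝒜 l a) = berezinReal b l • a := rfl

theorem ber_deriv (j : Fin n) (s : OddFun V₁ 𝒜) : ber 𝒜 b (deriv 𝒜 (b.h j) s) = 0 := by
  induction s using OddFun.induction with
  | add s t hs ht => rw [map_add, map_add, hs, ht, add_zero]
  | mk l j a ha => rw [deriv_mk, ber_mk, berezinReal_oddDeriv, zero_smul]

/-- Coefficients stand to the right of the exterior factor, so constants leave the integral on the
right without a sign. -/
theorem ber_mul_const (s : OddFun V₁ 𝒜) (a : P) : ber 𝒜 b (s * const 𝒜 a) = ber 𝒜 b s * a := by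
  induction s using OddFun.induction with
  | add s t hs ht => rw [add_mul, map_add, map_add, add_mul, hs, ht]
  | mk l j a' ha => rw [const_apply, mk_mul_mk_one, ber_mk, ber_mk, smul_mul_assoc]

theorem ber_subst (φ : V₁ →ₗ[ℝ] V₁) (s : OddFun V₁ 𝒜) :
    ber 𝒜 b (subst 𝒜 φ s) = LinearMap.det φ • ber 𝒜 b s := by
  induction s using OddFun.induction with
  | add s t hs ht => rw [map_add, map_add, map_add, smul_add, hs, ht]
  | mk l j a ha => rw [subst_mk, ber_mk, ber_mk, berezinReal_map, smul_smul]

end Berezin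

variable [NearSuperalgebra 𝒜]

theorem const_mul {j : ZMod 2} {a : P} (ha : a ∈ 𝒜 j) (s : OddFun V₁ 𝒜) :
    const 𝒜 a * s = (α 𝒜 ^ j.val) s * const 𝒜 a := by
  induction s using OddFun.induction with
  | add s t hs ht => rw [mul_add, map_add, add_mul, hs, ht]
  | mk l i a' ha' =>
    rw [const_apply, mk_mul_mk 𝒜 ha, mul_eq_gradeInv_mul 𝒜 ha, one_mul, ← mk_mul_mk_one]
    rcases zmod_two_cases j with rfl | rfl
    · simp
    · simp [α_mk]

end OddFun

end OddFun

/-! ### Exponentials of nilpotent elements -/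

/-- The ring need not be commutative; it is enough that a commutes with its own derivative. -/
theorem map_pow_of_leibniz {T : Type*} [Ring T] (D : T →+ T)
    (hD : ∀ a b, D (a * b) = D a * b + a * D b) {a : T} (ha : Commute a (D a)) (k : ℕ) :
    D (a ^ (k + 1)) = (k + 1) • (D a * a ^ k) := by
  induction k with
  | zero => simp
  | succ k ih =>
    rw [pow_succ, hD, ih, (ha.pow_left (k + 1)).eq, succ_nsmul _ (k + 1), smul_mul_assoc,
      mul_assoc, ← pow_succ]

theorem map_exp_of_leibniz {T : Type*} [Ring T] [Module ℚ T] (D : T →+ T)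
    (hD : ∀ a b, D (a * b) = D a * b + a * D b) {a : T} (ha : Commute a (D a))
    (hn : IsNilpotent a) : D (IsNilpotent.exp a) = D a * IsNilpotent.exp a := by
  obtain ⟨k, hk⟩ := hn
  have h1 : D 1 = 0 := by simpa using hD 1 1
  -- Differentiation lowers exponents by one, so the sum on the left is taken with one more term
  -- than the sum on the right; the zeroth term drops out because D 1 = 0.
  have hk' : a ^ (k + 1) = 0 := by rw [pow_succ, hk, zero_mul]
  rw [IsNilpotent.exp_eq_sum hk']
  conv_rhs => rw [← IsNilpotent.exp_eq_sum hk', IsNilpotent.exp_eq_sum hk]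
  rw [Finset.sum_range_succ', map_add, map_sum]
  simp only [map_rat_smul D, map_pow_of_leibniz D hD ha, pow_zero, h1, smul_zero, add_zero,
    Finset.mul_sum]
  refine Finset.sum_congr rfl fun i _ => ?_
  rw [mul_smul_comm, ← Nat.cast_smul_eq_nsmul ℚ, smul_smul]
  congr 1
  rw [Nat.factorial_succ]
  push_cast
  field_simp

theorem commute_polynomial_C {T : Type*} [Ring T] {a : T} (ha : ∀ s, Commute a s)
    (F : Polynomial T) : Commute (Polynomial.C a) F := by
  induction F using Polynomial.induction_on' with
  | add F G hF hG => exact hF.add_right hG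
  | monomial k s =>
    rw [Commute, SemiconjBy, Polynomial.C_mul_monomial, Polynomial.monomial_mul_C, (ha s).eq]

/-- Evaluation of a polynomial at a real number. -/
def evalReal {T : Type*} [Ring T] [Algebra ℝ T] (t : ℝ) : Polynomial T →+* T :=
  Polynomial.eval₂RingHom' (RingHom.id T) (algebraMap ℝ T t)
    (fun a => (Algebra.commutes t a).symm)

/-! ### Polynomial paths evaluated at real times -/

section EvalReal

variable {T : Type*} [Ring T] [Algebra ℝ T]

@[simp] theorem evalReal_C (t : ℝ) (a : T) : evalReal t (Polynomial.C a) = a :=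
  Polynomial.eval₂_C _ _

@[simp] theorem evalReal_X (t : ℝ) : evalReal t (Polynomial.X : Polynomial T)
    = algebraMap ℝ T t :=
  Polynomial.eval₂_X _ _

theorem evalReal_map {R : Type*} [Ring R] [Algebra ℝ R] (f : R →ₐ[ℝ] T) (t : ℝ)
    (F : Polynomial R) : evalReal t (F.map (f : R →+* T)) = f (evalReal t F) := by
  induction F using Polynomial.induction_on' with
  | add F G hF hG => simp [hF, hG]
  | monomial k a => simp [← Polynomial.C_mul_X_pow_eq_monomial]

theorem hasDerivAt_evalReal (l : T →ₗ[ℝ] ℝ) (F : Polynomial T) (t : ℝ) :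
    HasDerivAt (fun t : ℝ => l (evalReal t F))
      (l (evalReal t (Polynomial.derivative F))) t := by
  induction F using Polynomial.induction_on' with
  | add F G hF hG => simp only [map_add]; exact hF.add hG
  | monomial k a =>
    have h : ∀ (j : ℕ) (c : T) (s : ℝ),
        l (evalReal s (Polynomial.monomial j c)) = s ^ j * l c := fun j c s => by
      rw [← Polynomial.C_mul_X_pow_eq_monomial, map_mul, map_pow, evalReal_C, evalReal_X,
        ← map_pow, ← Algebra.commutes, ← Algebra.smul_def, map_smul, smul_eq_mul]
    rw [Polynomial.derivative_monomial]
    simp only [h]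
    have := (hasDerivAt_pow k t).mul_const (l a)
    have e : t ^ (k - 1) * l (a * (k : T)) = k * t ^ (k - 1) * l a := by
      rw [← nsmul_eq_mul', map_nsmul, nsmul_eq_mul]
      ring
    rw [e]
    exact this

/-- Against each linear functional on E this is the real statement that a function with zero
derivative is constant; functionals separate the points of E, so no norm is needed. -/
theorem apply_evalReal_one_eq_zero {E : Type*} [AddCommGroup E] [Module ℝ E] (I : T →ₗ[ℝ] E)
    (F : Polynomial T) (hF : ∀ t, I (evalReal t (Polynomial.derivative F)) = 0) :
    I (evalReal 1 F) = I (evalReal 0 F) := by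
  rw [← sub_eq_zero, ← Module.forall_dual_apply_eq_zero_iff ℝ]
  intro l
  have hd := hasDerivAt_evalReal (l ∘ₗ I) F
  have := is_const_of_deriv_eq_zero (fun t => (hd t).differentiableAt)
    (fun t => by rw [(hd t).deriv]; simp [hF]) 1 0
  rw [map_sub, sub_eq_zero]
  exact this

end EvalReal

/-! ### Superderivations and divergence -/

/-- A superalgebra `T` of superfunctions with coordinates `v i`, constants `R`, grading
automorphism `α` and partial derivatives `d i`. -/
structure SuperCalculus (p n : ℕ) {S R : Type*} [CommRing S] [Ring R] [Algebra S R]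
    [Algebra ℝ R] (𝒜 : ZMod 2 → Submodule S R) (T : Type*) [Ring T] [Algebra ℝ T] where
  α : T →ₐ[ℝ] T
  α_α : ∀ s, α (α s) = s
  v : Idx p n → T
  c : R →ₐ[ℝ] T
  α_v : ∀ i, α (v i) = (-1) ^ (parity i).val * v i
  α_c : ∀ {e : ZMod 2} {r : R}, r ∈ 𝒜 e → α (c r) = (-1) ^ e.val * c r
  v_mul : ∀ i s, v i * s = (α ^ (parity i).val) s * v i
  c_mul : ∀ {e : ZMod 2} {r : R}, r ∈ 𝒜 e → ∀ s, c r * s = (α ^ e.val) s * c r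
  d : Idx p n → T →ₗ[ℝ] T
  d_mul : ∀ i a b, d i (a * b) = d i a * b + (α ^ (parity i).val) a * d i b
  d_v : ∀ i j, d i (v j) = if i = j then 1 else 0
  d_c : ∀ i r, d i (c r) = 0

/-- The supertrace. -/
def supertrace {p n : ℕ} {R : Type*} [Ring R] (Y : SuperMat p n R) : R :=
  ∑ i, (-1) ^ (parity i).val * Y i i

namespace SuperCalculus

variable {p n : ℕ} {S R : Type*} [CommRing S] [Ring R] [Algebra S R]
    [Algebra ℝ R] {𝒜 : ZMod 2 → Submodule S R} {T : Type*} [Ring T] [Algebra ℝ T]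
    (K : SuperCalculus p n 𝒜 T)

/-- The point `M v`. -/
def act (M : SuperMat p n R) : Idx p n → T := (M.map K.c).mulVec K.v

theorem act_apply (M : SuperMat p n R) (i : Idx p n) : K.act M i = ∑ j, K.c (M i j) * K.v j := rfl

theorem act_mul (M N : SuperMat p n R) : (M.map K.c).mulVec (K.act N) = K.act (M * N) := by
  rw [act, act, Matrix.mulVec_mulVec, Matrix.map_mul]

/-- The vector field `∑ i, (Y v)_i ∂_i`. -/
def vecField (Y : SuperMat p n R) : T →ₗ[ℝ] T :=
  ∑ i, LinearMap.mulLeft ℝ (K.act Y i) ∘ₗ K.d i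

theorem vecField_apply (Y : SuperMat p n R) (s : T) :
    K.vecField Y s = ∑ i, K.act Y i * K.d i s := by
  simp [vecField]

variable {Y : SuperMat p n R} (hY : IsPointGl 𝒜 Y)

include hY

/-- This is the hypothesis of `superForm_mulVec_left` for the generic point v. -/
theorem c_mul_v (i j : Idx p n) : K.c (Y i j) * K.v j
    = (-1) ^ ((parity i + parity j) * parity j).val * (K.v j * K.c (Y i j)) := by
  rw [K.c_mul (hY i j)]
  rcases i with i | i <;> rcases j with j | j <;> simp [K.α_v]

theorem act_mul_comm (i : Idx p n) (s : T) :
    K.act Y i * s = (K.α ^ (parity i).val) s * K.act Y i := by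
  rw [act_apply, Finset.sum_mul, Finset.mul_sum]
  refine Finset.sum_congr rfl fun j _ => ?_
  rw [mul_assoc, K.v_mul, ← mul_assoc, K.c_mul (hY i j), ← mul_assoc]
  rcases i with i | i <;> rcases j with j | j <;> simp [K.α_α]

theorem α_act (i : Idx p n) : K.α (K.act Y i) = (-1) ^ (parity i).val * K.act Y i := by
  rw [act_apply, map_sum, Finset.mul_sum]
  refine Finset.sum_congr rfl fun j _ => ?_
  rw [map_mul, K.α_v, K.α_c (hY i j)]
  rcases i with i | i <;> rcases j with j | j <;> simp

/-- The coefficient of ∂_i has the parity of i, so the vector field is even: the sign in the Leibniz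
rule of ∂_i cancels against the one from moving a past the coefficient. -/
theorem vecField_mul (a b : T) :
    K.vecField Y (a * b) = K.vecField Y a * b + a * K.vecField Y b := by
  simp only [vecField_apply, Finset.sum_mul, Finset.mul_sum, ← Finset.sum_add_distrib]
  refine Finset.sum_congr rfl fun i _ => ?_
  rw [K.d_mul, mul_add, ← mul_assoc, ← mul_assoc, ← mul_assoc, K.act_mul_comm hY i]
  rcases i with i | i <;> simp [K.α_α, K.act_mul_comm hY]

omit hY in
theorem vecField_v (Y : SuperMat p n R) (i : Idx p n) : K.vecField Y (K.v i) = K.act Y i := by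
  simp [vecField_apply, K.d_v]

omit hY in
theorem vecField_c (Y : SuperMat p n R) (r : R) : K.vecField Y (K.c r) = 0 := by
  simp [vecField_apply, K.d_c]

/-- Only the j = i term survives, and its entry is even, so it passes ∂_i without a sign. Up to the
sign of i, this is the contribution of i to the divergence. -/
theorem d_act (i : Idx p n) : K.d i (K.act Y i) = K.c (Y i i) := by
  rw [act_apply, map_sum, Finset.sum_eq_single i]
  · have := hY i i
    rw [zmod_two_add_self] at this
    have h := K.α_c this
    rcases i with i | i <;> simp_all [K.d_mul, K.d_c, K.d_v]
  · intro j _ hj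
    simp [K.d_mul, K.d_c, K.d_v, hj.symm]
  · simp

/-- The divergence theorem for linear vector fields. -/
theorem integral_vecField {E : Type*} [AddCommGroup E] [Module ℝ E] (I : T →ₗ[ℝ] E) {q : T}
    (hI : ∀ i f, I (K.d i f + K.d i q * f) = 0) (hq : ∀ j, K.d (Sum.inr j) q = 0) (f : T) :
    I (K.vecField Y f + K.vecField Y q * f + K.c (supertrace Y) * f) = 0 := by
  -- Each total derivative is weighted by (-1)^{p(i)}: for odd i the rule for ∂_i gives Y_ii f minus
  -- (Yv)_i ∂_i f, and the weight restores the vector field while turning the trace into the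
  -- supertrace. The terms with ∂_i q occur only for even i.
  have key : K.vecField Y f + K.vecField Y q * f + K.c (supertrace Y) * f
      = ∑ i, ((-1 : ℝ) ^ (parity i).val) •
        (K.d i (K.act Y i * f) + K.d i q * (K.act Y i * f)) := by
    rw [vecField_apply, vecField_apply, supertrace, map_sum, Finset.sum_mul, Finset.sum_mul,
      ← Finset.sum_add_distrib, ← Finset.sum_add_distrib]
    refine Finset.sum_congr rfl fun i _ => ?_
    rw [K.d_mul, K.d_act hY]
    rcases i with i | i
    · have h1 := K.act_mul_comm hY (Sum.inl i) (K.d (Sum.inl i) q)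
      simp only [parity_inl, ZMod.val_zero, pow_zero, AlgHom.one_apply, one_mul, one_smul] at h1 ⊢
      rw [← mul_assoc, h1]
      abel
    · have h1 := K.α_act hY (Sum.inr i)
      simp [hq, h1, add_comm]
  rw [key, map_sum]
  exact Finset.sum_eq_zero fun i _ => by rw [map_smul, hI, smul_zero]

section Moment

variable {V₀ V₁ : Type*} [AddCommGroup V₀] [Module ℝ V₀] [AddCommGroup V₁] [Module ℝ V₁]
  {B : SymplecticForm V₀ V₁} (b : SymplecticBasis B p n)

omit hY in
/-- The function `-1/2 B(v, M v)`. -/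
def quad (M : SuperMat p n R) : T := (-1 / 2 : ℝ) • superForm b K.v (K.act M)

omit hY in
theorem quad_add (M N : SuperMat p n R) : K.quad b (M + N) = K.quad b M + K.quad b N := by
  have : K.act (M + N) = K.act M + K.act N := by
    funext i; simp [act_apply, add_mul, Finset.sum_add_distrib]
  simp [quad, superForm, this, mul_add, Finset.sum_add_distrib]

omit hY in
theorem quad_smul (t : ℝ) (M : SuperMat p n R) : K.quad b (t • M) = t • K.quad b M := by
  have : K.act (t • M) = t • K.act M := by
    funext i; simp [act_apply, Finset.smul_sum]
  simp only [quad, superForm, this, Pi.smul_apply, mul_smul_comm, Finset.smul_sum,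
    smul_comm t]

/-- An even derivation that sends v to Yv turns B(v, Mv) into B(Yv, Mv) + B(v, MYv); the adjoint
moves Y to the right. -/
theorem vecField_quad (M : SuperMat p n R) :
    K.vecField Y (K.quad b M) = K.quad b (adjoint b Y * M + M * Y) := by
  have h1 : ∀ j, K.vecField Y (K.act M j) = K.act (M * Y) j := by
    intro j
    rw [← K.act_mul, act_apply, map_sum]
    refine Finset.sum_congr rfl fun k _ => ?_
    rw [K.vecField_mul hY, vecField_c, vecField_v, zero_mul, zero_add]; rfl
  have h2 : superForm b (K.act Y) (K.act M) = superForm b K.v (K.act (adjoint b Y * M)) := by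
    rw [← K.act_mul, map_adjoint]
    exact superForm_mulVec_left b (fun i j => K.c_mul_v hY i j) _
  rw [quad_add, quad, quad, quad, ← h2, map_smul, ← smul_add]
  congr 1
  simp only [superForm, map_sum, map_smul, K.vecField_mul hY, vecField_v, h1, smul_add,
    Finset.sum_add_distrib]

omit hY in
/-- If `N = (1 + t N) Y_t` and `β' = str(Y_t) β`, then `β(t) ∫ exp(-1/2 B(v, X_t v))` does not depend
on `t`, where `X_t = (1 + t N)^* X (1 + t N)`. -/
theorem integral_exp_quad_eq [Algebra ℝ S] [IsScalarTower ℝ S R] [Module ℚ T]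
    {E : Type*} [AddCommGroup E] [Module ℝ E]
    (h : IsSupercomm 𝒜) (I : T →ₗ[ℝ] E) {q : T}
    (hI : ∀ i f, I (K.d i f + K.d i q * f) = 0) (hq : ∀ j, K.d (Sum.inr j) q = 0)
    {X N : SuperMat p n R} (hN : IsPointGl 𝒜 N)
    (hc₀ : ∀ s, Commute (K.quad b X - q) s) (hn₀ : IsNilpotent (K.quad b X - q))
    (hc₁ : ∀ s, Commute (K.quad b (adjoint b N * X + X * N)) s)
    (hn₁ : IsNilpotent (K.quad b (adjoint b N * X + X * N)))
    (hc₂ : ∀ s, Commute (K.quad b (adjoint b N * X * N)) s)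
    (hn₂ : IsNilpotent (K.quad b (adjoint b N * X * N)))
    (β : Polynomial R)
    (hβ : ∀ t : ℝ, ∃ Y, IsPointGl 𝒜 Y ∧ N = (1 + t • N) * Y ∧
      (∀ s, Commute (K.c (supertrace Y)) s) ∧
      evalReal t (Polynomial.derivative β) = supertrace Y * evalReal t β) :
    I (IsNilpotent.exp (K.quad b (adjoint b (1 + N) * X * (1 + N)) - q) * K.c (evalReal 1 β))
      = I (IsNilpotent.exp (K.quad b X - q) * K.c (evalReal 0 β)) := by
  set a₀ := K.quad b X - q with ha₀
  set X₁ := adjoint b N * X + X * N with hX₁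
  set X₂ := adjoint b N * X * N with hX₂
  -- The matrix X_t = (1 + tN)^* X (1 + tN) is quadratic in t, so the exponent is the value at t of
  -- a polynomial with central nilpotent coefficients. Its exponential is then a polynomial in t
  -- too.
  set ν : Polynomial T := Polynomial.C a₀ + Polynomial.C (K.quad b X₁) * Polynomial.X +
    Polynomial.C (K.quad b X₂) * Polynomial.X ^ 2 with hν
  set Xt : ℝ → SuperMat p n R := fun t => adjoint b (1 + t • N) * X * (1 + t • N) with hXt
  have hC : ∀ {a : T}, IsNilpotent a → IsNilpotent (Polynomial.C a) :=
    fun ha => ha.map Polynomial.C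
  have hcom : ∀ F, Commute ν F := fun F =>
    ((commute_polynomial_C hc₀ F).add_left
      ((commute_polynomial_C hc₁ F).mul_left (Polynomial.commute_X F))).add_left
      ((commute_polynomial_C hc₂ F).mul_left ((Polynomial.commute_X F).pow_left 2))
  have hnil : IsNilpotent ν := by
    refine Commute.isNilpotent_add ?_ (Commute.isNilpotent_add ?_ (hC hn₀) ?_) ?_
    · exact ((commute_polynomial_C hc₀ _).add_left
        ((commute_polynomial_C hc₁ _).mul_left (Polynomial.commute_X _)))
    · exact commute_polynomial_C hc₀ _
    · exact Commute.isNilpotent_mul_right (commute_polynomial_C hc₁ _) (hC hn₁)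
    · exact Commute.isNilpotent_mul_right (commute_polynomial_C hc₂ _) (hC hn₂)
  have hXt' : ∀ t : ℝ, Xt t = X + t • X₁ + t ^ 2 • X₂ := fun t => by
    simp only [hXt, hX₁, hX₂, adjoint_add, adjoint_smul, adjoint_one, add_mul, mul_add, one_mul,
      mul_one, smul_mul_assoc, mul_smul_comm, smul_smul, smul_add, pow_two]
    abel
  have hνt : ∀ t : ℝ, evalReal t ν = K.quad b (Xt t) - q := fun t => by
    rw [hXt', quad_add, quad_add, quad_smul, quad_smul]
    simp only [hν, ha₀, map_add, map_mul, map_pow, evalReal_C, evalReal_X]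
    rw [← map_pow, ← Algebra.commutes, ← Algebra.smul_def, ← Algebra.commutes,
      ← Algebra.smul_def]
    abel
  have hν't : ∀ t : ℝ, evalReal t (Polynomial.derivative ν)
      = K.quad b (X₁ + (2 * t) • X₂) := fun t => by
    rw [quad_add, quad_smul]
    simp only [hν, map_add, Polynomial.derivative_C_mul, Polynomial.derivative_C,
      Polynomial.derivative_X, Polynomial.derivative_X_pow, map_mul, map_pow, evalReal_C,
      evalReal_X, mul_one, zero_add]
    rw [mul_smul, two_smul ℝ, ← smul_add, Algebra.smul_def, Algebra.commutes]
    simp [two_mul, mul_add, add_mul]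
  have hexp : ∀ t, evalReal t (IsNilpotent.exp ν) = IsNilpotent.exp (K.quad b (Xt t) - q) :=
    fun t => by rw [IsNilpotent.map_exp hnil, hνt]
  have main := apply_evalReal_one_eq_zero I
    (IsNilpotent.exp ν * β.map (K.c : R →+* T)) (fun t => ?_)
  · rw [map_mul (evalReal 1), map_mul (evalReal 0), hexp, hexp, evalReal_map, evalReal_map, hXt' 0] at main
    simpa [hXt] using main
  · obtain ⟨Y, hY, hNY, hsc, hβt⟩ := hβ t
    have hpt : IsPointGl 𝒜 (1 + t • N) := (IsPointGl.one h).add (by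
      rw [← algebraMap_smul S t N]; exact hN.smul _)
    -- The right side is dX_t/dt. Thus the t-derivative of the exponent is the derivative of the
    -- quadratic form along the vector field of Y.
    have hX' : adjoint b Y * Xt t + Xt t * Y = X₁ + (2 * t) • X₂ := by
      have e1 : adjoint b N = adjoint b Y * adjoint b (1 + t • N) := by
        conv_lhs => rw [hNY]
        exact adjoint_mul b h hpt hY
      have e2 : adjoint b Y * Xt t = adjoint b N * X * (1 + t • N) := by
        rw [e1]; simp only [hXt, mul_assoc]
      have e3 : Xt t * Y = adjoint b (1 + t • N) * X * N := by
        calc _ = adjoint b (1 + t • N) * X * ((1 + t • N) * Y) := by simp only [hXt, mul_assoc]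
          _ = _ := by rw [← hNY]
      rw [e2, e3]
      simp only [hX₁, hX₂, adjoint_add, adjoint_smul, adjoint_one, add_mul, mul_add, one_mul,
        mul_one, smul_mul_assoc, mul_smul_comm, two_mul, add_smul]
      abel
    set ε := IsNilpotent.exp (K.quad b (Xt t) - q) with hε
    have hνcom : ∀ s, Commute (K.quad b (Xt t) - q) s := fun s => by
      have := (hcom (Polynomial.C s)).map (evalReal t)
      rwa [hνt, evalReal_C] at this
    have hDε : K.vecField Y ε = K.vecField Y (K.quad b (Xt t) - q) * ε :=
      map_exp_of_leibniz (K.vecField Y).toAddMonoidHom (K.vecField_mul hY) (hνcom _)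
        (by rw [← hνt]; exact hnil.map _)
    have hD : evalReal t (Polynomial.derivative (IsNilpotent.exp ν * β.map (K.c : R →+* T)))
        = K.quad b (X₁ + (2 * t) • X₂) * ε * K.c (evalReal t β)
          + ε * (K.c (supertrace Y) * K.c (evalReal t β)) := by
      have h1 : Polynomial.derivative (IsNilpotent.exp ν)
          = Polynomial.derivative ν * IsNilpotent.exp ν :=
        map_exp_of_leibniz (Polynomial.derivative (R := T)).toAddMonoidHom
          (fun _ _ => Polynomial.derivative_mul) (hcom _) hnil
      rw [Polynomial.derivative_mul, h1, map_add, map_mul, map_mul, map_mul, hν't, hexp,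
        Polynomial.derivative_map, evalReal_map, evalReal_map, hβt, map_mul]
    -- In the divergence identity for the exponential times β(t), the terms with the derivative of q
    -- cancel, and what is left is the t-derivative computed in `hD`.
    have := K.integral_vecField hY I hI hq (ε * K.c (evalReal t β))
    rw [K.vecField_mul hY, vecField_c, mul_zero, add_zero, hDε, map_sub,
      K.vecField_quad hY, hX', sub_mul, sub_mul] at this
    rw [hD, ← this, ← mul_assoc ε, ← (hsc ε).eq]
    congr 1
    simp only [mul_assoc]
    abel

end Moment

end SuperCalculus

/-! ### Polynomial superfunctions -/

theorem neg_one_pow_mul_tmul {A O : Type*} [Ring A] [Algebra ℝ A] [Ring O] [Algebra ℝ O]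
    (k : ℕ) (a : A) (s : O) :
    (-1 : A ⊗[ℝ] O) ^ k * a ⊗ₜ[ℝ] s = a ⊗ₜ ((-1) ^ k * s) := by
  have h : (-1 : A ⊗[ℝ] O) = 1 ⊗ₜ (-1) := by rw [TensorProduct.tmul_neg]; rfl
  rw [h, Algebra.TensorProduct.tmul_pow, Algebra.TensorProduct.tmul_mul_tmul, one_pow, one_mul]

section GradingC

variable {P : Type*} [Ring P] [Algebra ℝ P] (𝒜 : ZMod 2 → Submodule ℝ P)

theorem gradingC_induction {i : ZMod 2} {C : ℂ ⊗[ℝ] P → Prop}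
    (tmul : ∀ (z : ℂ) (a : P), a ∈ 𝒜 i → C (z ⊗ₜ a)) (add : ∀ r s, C r → C s → C (r + s))
    {r : ℂ ⊗[ℝ] P} (hr : r ∈ gradingC 𝒜 i) : C r := by
  rw [gradingC, Submodule.baseChange_eq_span] at hr
  induction hr using Submodule.span_induction with
  | mem x hx =>
    obtain ⟨a, ha, rfl⟩ := hx
    exact tmul 1 a ha
  | zero => simpa using tmul 0 0 (𝒜 i).zero_mem
  | add x y _ _ hx hy => exact add x y hx hy
  | smul z x hx' hx =>
    -- The predicate C is not assumed stable under scalars, so the induction is strengthened to all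
    -- complex multiples of an element of the span.
    have : ∀ y ∈ Submodule.span ℂ (((𝒜 i).map ((TensorProduct.mk ℝ ℂ P) 1) : Submodule ℝ _) : Set (ℂ ⊗[ℝ] P)),
        ∀ z : ℂ, C (z • y) := by
      intro y hy
      induction hy using Submodule.span_induction with
      | mem y hy =>
        obtain ⟨a, ha, rfl⟩ := hy
        intro z
        simpa [TensorProduct.smul_tmul'] using tmul z a ha
      | zero => intro z; simpa using tmul 0 0 (𝒜 i).zero_mem
      | add x y _ _ hx hy => intro z; rw [smul_add]; exact add _ _ (hx z) (hy z)
      | smul w y _ hy => intro z; rw [smul_smul]; exact hy _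
    exact this x hx' z

theorem tmul_mem_gradingC {i : ZMod 2} (z : ℂ) {a : P} (ha : a ∈ 𝒜 i) :
    z ⊗ₜ[ℝ] a ∈ gradingC 𝒜 i := Submodule.tmul_mem_baseChange_of_mem z ha

theorem isSupercomm_gradingC [GradedAlgebra 𝒜] [NearSuperalgebra 𝒜] :
    IsSupercomm (gradingC 𝒜) where
  one_mem := tmul_mem_gradingC 𝒜 1 SetLike.GradedOne.one_mem
  mul_mem {i j a b} ha hb := by
    refine gradingC_induction 𝒜 (C := fun a => a * b ∈ gradingC 𝒜 (i + j))
      (fun z x hx => ?_) (fun r s hr hs => ?_) ha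
    · refine gradingC_induction 𝒜 (C := fun b => z ⊗ₜ x * b ∈ gradingC 𝒜 (i + j))
        (fun w y hy => ?_) (fun r s hr hs => ?_) hb
      · rw [Algebra.TensorProduct.tmul_mul_tmul]
        exact tmul_mem_gradingC 𝒜 _ (SetLike.mul_mem_graded hx hy)
      · rw [mul_add]; exact Submodule.add_mem _ hr hs
    · rw [add_mul]; exact Submodule.add_mem _ hr hs
  mul_comm {i j a b} ha hb := by
    refine gradingC_induction 𝒜 (C := fun a => a * b = (-1) ^ (i * j).val * (b * a))
      (fun z x hx => ?_) (fun r s hr hs => ?_) ha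
    · refine gradingC_induction 𝒜
        (C := fun b => z ⊗ₜ x * b = (-1) ^ (i * j).val * (b * z ⊗ₜ x))
        (fun w y hy => ?_) (fun r s hr hs => ?_) hb
      · rw [Algebra.TensorProduct.tmul_mul_tmul, Algebra.TensorProduct.tmul_mul_tmul,
          NearSuperalgebra.supercomm (𝒜 := 𝒜) _ _ _ _ hx hy, mul_comm z w, neg_one_pow_mul_tmul]
      · rw [mul_add, add_mul, mul_add, hr, hs]
    · rw [add_mul, mul_add, mul_add, hr, hs]

end GradingC

section Polynomial

variable {V₀ V₁ : Type*} [AddCommGroup V₀] [Module ℝ V₀] [AddCommGroup V₁] [Module ℝ V₁]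
  {B : SymplecticForm V₀ V₁} {p n : ℕ} (b : SymplecticBasis B p n)
  {P : Type*} [Ring P] [Algebra ℝ P] (𝒜 : ZMod 2 → Submodule ℝ P) [GradedAlgebra 𝒜]

/-- Polynomials in the even coordinates. -/
abbrev EvenPoly (p : ℕ) : Type := MvPolynomial (Fin p ⊕ Fin p) ℂ

/-- Polynomial superfunctions on `V` with values in `P ⊗ ℂ`. -/
abbrev SuperPoly (p : ℕ) (V₁ : Type*) [AddCommGroup V₁] [Module ℝ V₁]
    {P : Type*} [Ring P] [Algebra ℝ P] (𝒜 : ZMod 2 → Submodule ℝ P) [GradedAlgebra 𝒜] : Type _ :=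
  EvenPoly p ⊗[ℝ] OddFun V₁ 𝒜

theorem tensor_map_pow_tmul {A O : Type*} [Ring A] [Algebra ℝ A] [Ring O] [Algebra ℝ O]
    (f : O →ₐ[ℝ] O) (k : ℕ) (a : A) (s : O) :
    ((Algebra.TensorProduct.map (AlgHom.id ℝ A) f) ^ k) (a ⊗ₜ[ℝ] s) = a ⊗ₜ (f ^ k) s := by
  induction k with
  | zero => rfl
  | succ k ih => rw [pow_succ', AlgHom.mul_apply, ih, pow_succ', AlgHom.mul_apply]; simp

/-- The calculus of polynomial superfunctions. -/
def polyCalculus [NearSuperalgebra 𝒜] : SuperCalculus p n (gradingC 𝒜) (SuperPoly p V₁ 𝒜) where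
  α := Algebra.TensorProduct.map (AlgHom.id ℝ _) (OddFun.α 𝒜)
  α_α s := by
    induction s using TensorProduct.induction_on with
    | zero => simp
    | add s t hs ht => rw [map_add, map_add, hs, ht]
    | tmul a s => simp [OddFun.α_α]
  v := Sum.elim (fun i => MvPolynomial.X i ⊗ₜ 1) (fun j => 1 ⊗ₜ OddFun.coord 𝒜 (b.h.coord j))
  c := Algebra.TensorProduct.map (IsScalarTower.toAlgHom ℝ ℂ (EvenPoly p)) (OddFun.const 𝒜)
  α_v i := by
    rcases i with i | i
    · simp
    · rw [Sum.elim_inr, Algebra.TensorProduct.map_tmul, OddFun.α_coord, neg_one_pow_mul_tmul]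
      simp
  α_c {e r} hr := by
    refine gradingC_induction 𝒜 (C := fun r => Algebra.TensorProduct.map (AlgHom.id ℝ (EvenPoly p))
      (OddFun.α 𝒜) (Algebra.TensorProduct.map (IsScalarTower.toAlgHom ℝ ℂ (EvenPoly p))
        (OddFun.const 𝒜) r) = (-1) ^ e.val * Algebra.TensorProduct.map
          (IsScalarTower.toAlgHom ℝ ℂ (EvenPoly p)) (OddFun.const 𝒜) r)
      (fun z x hx => ?_) (fun r s hr hs => ?_) hr
    · rw [Algebra.TensorProduct.map_tmul, Algebra.TensorProduct.map_tmul, OddFun.α_const 𝒜 hx,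
        neg_one_pow_mul_tmul]
      rfl
    · rw [map_add, map_add, hr, hs, mul_add]
  v_mul i s := by
    induction s using TensorProduct.induction_on with
    | zero => simp
    | add s t hs ht => rw [mul_add, map_add, add_mul, hs, ht]
    | tmul a s =>
      rw [tensor_map_pow_tmul]
      rcases i with i | i
      · simp [mul_comm]
      · simp [OddFun.coord_mul]
  c_mul {e r} hr s := by
    refine gradingC_induction 𝒜 (C := fun r =>
      Algebra.TensorProduct.map (IsScalarTower.toAlgHom ℝ ℂ (EvenPoly p)) (OddFun.const 𝒜) r * s
        = (Algebra.TensorProduct.map (AlgHom.id ℝ (EvenPoly p)) (OddFun.α 𝒜) ^ e.val) s *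
          Algebra.TensorProduct.map (IsScalarTower.toAlgHom ℝ ℂ (EvenPoly p)) (OddFun.const 𝒜) r)
      (fun z x hx => ?_) (fun r s hr hs => ?_) hr
    · induction s using TensorProduct.induction_on with
      | zero => simp
      | add s t hs ht => rw [mul_add, map_add, add_mul, hs, ht]
      | tmul a s =>
        rw [tensor_map_pow_tmul, Algebra.TensorProduct.map_tmul,
          Algebra.TensorProduct.tmul_mul_tmul, Algebra.TensorProduct.tmul_mul_tmul,
          OddFun.const_mul 𝒜 hx, mul_comm]
    · rw [map_add, add_mul, mul_add, hr, hs]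
  d := Sum.elim
    (fun i => LinearMap.rTensor _ ((MvPolynomial.pderiv i).toLinearMap.restrictScalars ℝ))
    (fun j => LinearMap.lTensor _ (OddFun.deriv 𝒜 (b.h j)))
  d_mul i s t := by
    induction s using TensorProduct.induction_on with
    | zero => simp
    | add s₁ s₂ h₁ h₂ => simp only [add_mul, map_add, h₁, h₂]; abel
    | tmul a s =>
      induction t using TensorProduct.induction_on with
      | zero => simp
      | add s₁ s₂ h₁ h₂ => simp only [mul_add, map_add, h₁, h₂]; abel
      | tmul a' s' =>
        rw [tensor_map_pow_tmul]
        rcases i with i | i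
        · simp [TensorProduct.add_tmul, mul_comm, add_comm]
        · simp [TensorProduct.tmul_add, OddFun.deriv_mul]
  d_v i j := by
    have h1 : ∀ w : V₁, OddFun.deriv 𝒜 w 1 = 0 := fun w => by
      rw [← map_one (OddFun.const 𝒜), OddFun.deriv_const]
    rcases i with i | i <;> rcases j with j | j
    · by_cases h : i = j
      · subst h; simp [MvPolynomial.pderiv_X, Algebra.TensorProduct.one_def]
      · simp [MvPolynomial.pderiv_X, h, Ne.symm h]
    · simp
    · simp [h1]
    · by_cases h : i = j
      · subst h; simp [OddFun.deriv_coord, Algebra.TensorProduct.one_def]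
      · simp [OddFun.deriv_coord, h]
  d_c i r := by
    induction r using TensorProduct.induction_on with
    | zero => simp
    | add s t hs ht => rw [map_add, map_add, hs, ht, add_zero]
    | tmul z a =>
      rcases i with i | i
      · simp [MvPolynomial.algebraMap_eq]
      · simp [OddFun.deriv_const]

end Polynomial

/-! ### Body and nilpotent elements -/

section Body

variable {P : Type*} [Ring P] [Algebra ℝ P] (𝒜 : ZMod 2 → Submodule ℝ P) [GradedAlgebra 𝒜]
  [NearSuperalgebra 𝒜]

/-- Supercommutativity gives a² = -a², hence a² = 0, and ℝ is reduced. -/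
theorem body_of_odd {a : P} (ha : a ∈ 𝒜 1) : body 𝒜 a = 0 := by
  have h := NearSuperalgebra.supercomm (𝒜 := 𝒜) _ _ _ _ ha ha
  have h2 : (2 : ℝ) • (a * a) = 0 := by
    rw [two_smul]
    conv_lhs => lhs; rw [h]
    simp
  have h3 := congrArg (body 𝒜) ((smul_eq_zero_iff_right (two_ne_zero)).1 h2)
  simpa using h3

/-- After scaling to body 1, either a or 1 - a is a unit by locality, and 1 - a is excluded because
its body is 0. -/
theorem isUnit_of_body_ne_zero {a : P} (ha : body 𝒜 a ≠ 0) : IsUnit a := by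
  have := NearSuperalgebra.isLocal (𝒜 := 𝒜)
  have h1 : (body 𝒜 a)⁻¹ • a + (1 - (body 𝒜 a)⁻¹ • a) = 1 := by abel
  rcases IsLocalRing.isUnit_or_isUnit_of_add_one h1 with h | h
  · exact (isUnit_smul_iff (Units.mk0 _ (inv_ne_zero ha)) a).1 h
  · have h2 := h.map (body 𝒜)
    simp [ha] at h2

/-- The minimal polynomial of a is X^k q with q(0) ≠ 0; then q(a) has nonzero body and is a unit, so
a^k = 0. -/
theorem isNilpotent_of_body_eq_zero {a : P} (ha : body 𝒜 a = 0) : IsNilpotent a := by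
  have := NearSuperalgebra.finite (𝒜 := 𝒜)
  have hint : IsIntegral ℝ a := Algebra.IsIntegral.isIntegral a
  obtain ⟨q, hq, hdvd⟩ := Polynomial.exists_eq_pow_rootMultiplicity_mul_and_not_dvd
    (minpoly ℝ a) (minpoly.ne_zero hint) 0
  rw [map_zero, sub_zero] at hq hdvd
  have h0 : Polynomial.aeval a (minpoly ℝ a) = 0 := minpoly.aeval ℝ a
  rw [hq, map_mul, map_pow, Polynomial.aeval_X] at h0
  have hu : IsUnit (Polynomial.aeval a q) := by
    apply isUnit_of_body_ne_zero 𝒜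
    rw [← Polynomial.aeval_algHom_apply, ha, Polynomial.coe_aeval_eq_eval,
      ← Polynomial.coeff_zero_eq_eval_zero]
    rwa [Polynomial.X_dvd_iff] at hdvd
  exact ⟨_, (hu.mul_left_eq_zero).1 h0⟩

theorem bodyC_tmul (z : ℂ) (a : P) : bodyC 𝒜 (z ⊗ₜ a) = z * body 𝒜 a := by
  simp [bodyC]

theorem bodyC_toC (a : P) : bodyC 𝒜 (toC a) = body 𝒜 a := by
  rw [toC, Algebra.TensorProduct.includeRight_apply, bodyC_tmul, one_mul]

omit [GradedAlgebra 𝒜] [NearSuperalgebra 𝒜] in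
theorem toC_mem_gradingC {i : ZMod 2} {a : P} (ha : a ∈ 𝒜 i) : toC a ∈ gradingC 𝒜 i :=
  tmul_mem_gradingC 𝒜 1 ha

theorem isNilpotent_of_bodyC_eq_zero {r : ℂ ⊗[ℝ] P} (hr : r ∈ gradingC 𝒜 0)
    (h : bodyC 𝒜 r = 0) : IsNilpotent r := by
  -- Vanishing of the body is not inherited by the summands of r, so the induction is on r minus its
  -- body. Evenness is carried along to make the summands commute.
  have key : r ∈ gradingC 𝒜 0 ∧ IsNilpotent (r - algebraMap ℂ _ (bodyC 𝒜 r)) := by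
    refine gradingC_induction 𝒜 (C := fun r => r ∈ gradingC 𝒜 0 ∧
      IsNilpotent (r - algebraMap ℂ _ (bodyC 𝒜 r))) (fun z a ha => ?_) (fun r s hr hs => ?_) hr
    · refine ⟨tmul_mem_gradingC 𝒜 z ha, ?_⟩
      have h1 : z ⊗ₜ[ℝ] a - algebraMap ℂ (ℂ ⊗[ℝ] P) (bodyC 𝒜 (z ⊗ₜ a))
          = z ⊗ₜ[ℝ] (a - algebraMap ℝ P (body 𝒜 a)) := by
        rw [bodyC_tmul, TensorProduct.tmul_sub, Algebra.algebraMap_eq_smul_one (body 𝒜 a),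
          TensorProduct.tmul_smul, Algebra.TensorProduct.algebraMap_apply,
          TensorProduct.smul_tmul', mul_comm]
        simp
      obtain ⟨k, hk⟩ := isNilpotent_of_body_eq_zero 𝒜 (a := a - algebraMap ℝ P (body 𝒜 a))
        (by simp)
      exact ⟨k, by rw [h1, Algebra.TensorProduct.tmul_pow, hk, TensorProduct.tmul_zero]⟩
    · refine ⟨Submodule.add_mem _ hr.1 hs.1, ?_⟩
      have h1 : r + s - algebraMap ℂ (ℂ ⊗[ℝ] P) (bodyC 𝒜 (r + s))
          = (r - algebraMap ℂ _ (bodyC 𝒜 r)) + (s - algebraMap ℂ _ (bodyC 𝒜 s)) := by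
        rw [map_add, map_add]; abel
      rw [h1]
      refine Commute.isNilpotent_add ?_ hr.2 hs.2
      have h2 : Commute r s := by
        rw [Commute, SemiconjBy]
        simpa using (isSupercomm_gradingC 𝒜).mul_comm hr.1 hs.1
      exact ((h2.sub_right (Algebra.commutes _ _).symm).sub_left
        (Algebra.commutes _ _))
  simpa [h] using key.2

end Body

/-! ### Nilpotency of the moment map -/

theorem mul_self_eq_zero_of_left {T : Type*} [Ring T] {a w : T} (ha : a * a = 0)
    (hc : ∀ s, Commute (a * w) s) : a * w * (a * w) = 0 := by
  rw [(hc _).eq, mul_assoc, ← (hc w).eq, ← mul_assoc, ← mul_assoc, ha, zero_mul, zero_mul]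

theorem mul_self_eq_zero_of_right {T : Type*} [Ring T] {a w : T} (ha : a * a = 0)
    (hc : ∀ s, Commute (w * a) s) : w * a * (w * a) = 0 := by
  rw [← mul_assoc, (hc w).eq, mul_assoc, mul_assoc, ha, mul_zero, mul_zero]

/-- Central nilpotent elements. -/
def IsCentralNilpotent {T : Type*} [Ring T] (z : T) : Prop := (∀ s, Commute z s) ∧ IsNilpotent z

namespace IsCentralNilpotent

variable {T : Type*} [Ring T]

theorem zero : IsCentralNilpotent (0 : T) := ⟨fun s => Commute.zero_left s, IsNilpotent.zero⟩

theorem add {z w : T} (hz : IsCentralNilpotent z) (hw : IsCentralNilpotent w) :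
    IsCentralNilpotent (z + w) :=
  ⟨fun s => (hz.1 s).add_left (hw.1 s), Commute.isNilpotent_add (hz.1 w) hz.2 hw.2⟩

theorem sum {ι : Type*} (t : Finset ι) {z : ι → T} (hz : ∀ i ∈ t, IsCentralNilpotent (z i)) :
    IsCentralNilpotent (∑ i ∈ t, z i) :=
  Finset.sum_induction z IsCentralNilpotent (fun _ _ => add) zero hz

theorem smul [Algebra ℝ T] (r : ℝ) {z : T} (hz : IsCentralNilpotent z) :
    IsCentralNilpotent (r • z) :=
  ⟨fun s => (hz.1 s).smul_left r, hz.2.smul r⟩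

end IsCentralNilpotent

namespace SuperCalculus

variable {p n : ℕ} {S R : Type*} [CommRing S] [Ring R] [Algebra S R]
    [Algebra ℝ R] {𝒜 : ZMod 2 → Submodule S R} {T : Type*} [Ring T] [Algebra ℝ T]
    (K : SuperCalculus p n 𝒜 T)

theorem v_mul_self (j : Fin n) : K.v (Sum.inr j) * K.v (Sum.inr j) = 0 := by
  have h := K.v_mul (Sum.inr j) (K.v (Sum.inr j))
  have h2 : (2 : ℝ) • (K.v (Sum.inr j) * K.v (Sum.inr j)) = 0 := by
    rw [two_smul]
    conv_lhs => lhs; rw [h]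
    simp [K.α_v]
  exact (smul_eq_zero_iff_right two_ne_zero).1 h2

/-- The monomial has even total parity, hence is central. It is nilpotent because it contains an odd
coordinate at one end, which squares to zero, or else an entry of the even block, nilpotent by
hypothesis. Nothing is asked of the odd-odd block. -/
theorem isCentralNilpotent_monomial {M : SuperMat p n R} (hM : IsPointGl 𝒜 M)
    (hn : ∀ i j, IsNilpotent (M (Sum.inl i) (Sum.inl j))) {i j : Idx p n}
    (hij : parity i = parity j) (k : Idx p n) :
    IsCentralNilpotent (K.v i * (K.c (M j k) * K.v k)) := by
  have hc : ∀ s, Commute (K.v i * (K.c (M j k) * K.v k)) s := by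
    intro s
    rw [Commute, SemiconjBy, mul_assoc, mul_assoc, K.v_mul k, ← mul_assoc (K.c _),
      K.c_mul (hM j k), ← mul_assoc, ← mul_assoc, K.v_mul i, ← hij]
    rcases i with i | i <;> rcases k with k | k <;> simp [K.α_α, mul_assoc]
  refine ⟨hc, ?_⟩
  rcases k with k | k
  · rcases i with i | i
    · rcases j with j | j
      · have h1 : ∀ l s, Commute (K.v (Sum.inl l)) s := fun l s =>
          show K.v (Sum.inl l) * s = s * K.v (Sum.inl l) by simpa using K.v_mul (Sum.inl l) s
        refine Commute.isNilpotent_mul_left (h1 _ _) ?_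
        exact Commute.isNilpotent_mul_right (h1 _ _).symm ((hn j k).map K.c)
      · simp at hij
    · exact ⟨2, (pow_two _).trans (mul_self_eq_zero_of_left (K.v_mul_self i) hc)⟩
  · rw [← mul_assoc] at hc ⊢
    exact ⟨2, (pow_two _).trans (mul_self_eq_zero_of_right (K.v_mul_self k) hc)⟩

section Moment

variable {V₀ V₁ : Type*} [AddCommGroup V₀] [Module ℝ V₀] [AddCommGroup V₁] [Module ℝ V₁]
  {B : SymplecticForm V₀ V₁} (b : SymplecticBasis B p n)

theorem isCentralNilpotent_quad {M : SuperMat p n R} (hM : IsPointGl 𝒜 M)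
    (hn : ∀ i j, IsNilpotent (M (Sum.inl i) (Sum.inl j))) :
    IsCentralNilpotent (K.quad b M) := by
  refine IsCentralNilpotent.smul _ (IsCentralNilpotent.sum _ fun i _ =>
    IsCentralNilpotent.sum _ fun j _ => ?_)
  by_cases hij : parity i = parity j
  · refine IsCentralNilpotent.smul _ ?_
    rw [act_apply, Finset.mul_sum]
    exact IsCentralNilpotent.sum _ fun k _ => K.isCentralNilpotent_monomial hM hn hij k
  · have : gram b i j = 0 := by
      rcases i with i | i <;> rcases j with j | j <;> simp_all [gram]
    rw [this, mul_zero, zero_smul]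
    exact IsCentralNilpotent.zero

end Moment

end SuperCalculus

/-! ### The integral of polynomial superfunctions -/

section Functional

variable {V₀ V₁ : Type*} [AddCommGroup V₀] [Module ℝ V₀] [AddCommGroup V₁] [Module ℝ V₁]
  {B : SymplecticForm V₀ V₁} {p n : ℕ} (b : SymplecticBasis B p n)
  {P : Type*} [Ring P] [Algebra ℝ P] (𝒜 : ZMod 2 → Submodule ℝ P) [GradedAlgebra 𝒜]

/-- The integral `E ⊗ ∫_{V₁}` of polynomial superfunctions. -/
def superIntegral (E : EvenPoly p →ₗ[ℂ] ℂ) : SuperPoly p V₁ 𝒜 →ₗ[ℝ] ℂ ⊗[ℝ] P :=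
  (∏ j, b.c j) • TensorProduct.map (E.restrictScalars ℝ) (OddFun.ber 𝒜 b)

theorem superIntegral_tmul (E : EvenPoly p →ₗ[ℂ] ℂ) (f : EvenPoly p) (s : OddFun V₁ 𝒜) :
    superIntegral b 𝒜 E (f ⊗ₜ s) = (∏ j, b.c j) • (E f ⊗ₜ OddFun.ber 𝒜 b s) := rfl

variable [NearSuperalgebra 𝒜]

theorem superIntegral_mul_c (E : EvenPoly p →ₗ[ℂ] ℂ) (F : SuperPoly p V₁ 𝒜) (r : ℂ ⊗[ℝ] P) :
    superIntegral b 𝒜 E (F * (polyCalculus b 𝒜).c r) = superIntegral b 𝒜 E F * r := by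
  induction F using TensorProduct.induction_on with
  | zero => simp
  | add F G hF hG => rw [add_mul, map_add, map_add, add_mul, hF, hG]
  | tmul f s =>
    induction r using TensorProduct.induction_on with
    | zero => simp
    | add r r' h h' => rw [map_add, mul_add, map_add, mul_add, h, h']
    | tmul z a =>
      have h1 : (polyCalculus b 𝒜).c (z ⊗ₜ a) = algebraMap ℂ (EvenPoly p) z ⊗ₜ OddFun.const 𝒜 a :=
        rfl
      have h2 : E (f * algebraMap ℂ (EvenPoly p) z) = E f * z := by
        rw [mul_comm, ← Algebra.smul_def, map_smul, smul_eq_mul, mul_comm]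
      rw [h1, Algebra.TensorProduct.tmul_mul_tmul, superIntegral_tmul, superIntegral_tmul,
        OddFun.ber_mul_const, h2, smul_mul_assoc, Algebra.TensorProduct.tmul_mul_tmul]

/-- Integration by parts against e^q: the even directions are the hypothesis on E, and in the odd
directions q is constant and the Berezin integral kills derivatives. -/
theorem superIntegral_d (E : EvenPoly p →ₗ[ℂ] ℂ) (q : EvenPoly p)
    (hE : ∀ i f, E (MvPolynomial.pderiv i f + MvPolynomial.pderiv i q * f) = 0)
    (i : Idx p n) (F : SuperPoly p V₁ 𝒜) :
    superIntegral b 𝒜 E ((polyCalculus b 𝒜).d i F + (polyCalculus b 𝒜).d i (q ⊗ₜ 1) * F) = 0 := by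
  induction F using TensorProduct.induction_on with
  | zero => simp
  | add F G hF hG =>
    rw [map_add ((polyCalculus b 𝒜).d i), mul_add, add_add_add_comm, map_add, hF, hG, add_zero]
  | tmul f s =>
    rcases i with i | i
    · have h1 : ∀ (f : EvenPoly p) (s : OddFun V₁ 𝒜), (polyCalculus b 𝒜).d (Sum.inl i) (f ⊗ₜ s)
        = MvPolynomial.pderiv i f ⊗ₜ s := fun _ _ => rfl
      rw [h1, h1, Algebra.TensorProduct.tmul_mul_tmul, one_mul, ← TensorProduct.add_tmul,
        superIntegral_tmul, hE, TensorProduct.zero_tmul, smul_zero]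
    · have h1 : ∀ (f : EvenPoly p) (s : OddFun V₁ 𝒜), (polyCalculus b 𝒜).d (Sum.inr i) (f ⊗ₜ s)
        = f ⊗ₜ OddFun.deriv 𝒜 (b.h i) s := fun _ _ => rfl
      rw [h1, h1, ← map_one (OddFun.const 𝒜), OddFun.deriv_const, TensorProduct.tmul_zero,
        zero_mul, add_zero, superIntegral_tmul, OddFun.ber_deriv, TensorProduct.tmul_zero,
        smul_zero]

/-- The polynomial `-1/2 B(x, Y x)` of the even coordinates. -/
def evenQuad (Y : Matrix (Fin p ⊕ Fin p) (Fin p ⊕ Fin p) ℂ) : EvenPoly p :=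
  (-1 / 2 : ℝ) • ∑ i, ∑ j, (gramEven b i j) •
    (MvPolynomial.X i * ∑ k, algebraMap ℂ _ (Y j k) * MvPolynomial.X k)

/-- The body of the block on `V₀`. -/
def bodyEven (X : SuperMat p n (ℂ ⊗[ℝ] P)) : Matrix (Fin p ⊕ Fin p) (Fin p ⊕ Fin p) ℂ :=
  X.toBlocks₁₁.map (bodyC 𝒜)

/-- The extension by zero of a complex matrix on `V₀`. -/
def evenMat (Y : Matrix (Fin p ⊕ Fin p) (Fin p ⊕ Fin p) ℂ) : SuperMat p n (ℂ ⊗[ℝ] P) :=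
  Matrix.fromBlocks (Y.map (algebraMap ℂ _)) 0 0 0

theorem quad_evenMat (Y : Matrix (Fin p ⊕ Fin p) (Fin p ⊕ Fin p) ℂ) :
    (polyCalculus b 𝒜).quad b (evenMat Y) = evenQuad b Y ⊗ₜ 1 := by
  have hact : ∀ j, (polyCalculus b 𝒜).act (evenMat Y : SuperMat p n (ℂ ⊗[ℝ] P)) (Sum.inl j)
      = (∑ k, algebraMap ℂ (EvenPoly p) (Y j k) * MvPolynomial.X k) ⊗ₜ 1 := by
    intro j
    rw [SuperCalculus.act_apply, Fintype.sum_sum_type, TensorProduct.sum_tmul]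
    have h2 : ∀ k, (polyCalculus b 𝒜).c ((evenMat Y : SuperMat p n (ℂ ⊗[ℝ] P)) (Sum.inl j) (Sum.inr k)) = 0 :=
      fun k => by simp [evenMat]
    simp only [h2, zero_mul, Finset.sum_const_zero, add_zero]
    refine Finset.sum_congr rfl fun k _ => ?_
    have h1 : (polyCalculus b 𝒜).c ((evenMat Y : SuperMat p n (ℂ ⊗[ℝ] P)) (Sum.inl j) (Sum.inl k))
        = algebraMap ℂ (EvenPoly p) (Y j k) ⊗ₜ 1 := by
      change algebraMap ℂ (EvenPoly p) (Y j k) ⊗ₜ (OddFun.const 𝒜 1) = _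
      rw [map_one]
    have h3 : (polyCalculus b 𝒜).v (Sum.inl k) = MvPolynomial.X k ⊗ₜ 1 := rfl
    rw [h1, h3, Algebra.TensorProduct.tmul_mul_tmul, mul_one]
  have hact' : ∀ j, (polyCalculus b 𝒜).act (evenMat Y : SuperMat p n (ℂ ⊗[ℝ] P)) (Sum.inr j)
      = 0 := by
    intro j
    have h2 : ∀ k, (evenMat Y : SuperMat p n (ℂ ⊗[ℝ] P)) (Sum.inr j) k = 0 := by
      rintro (k | k) <;> simp [evenMat]
    simp [SuperCalculus.act_apply, h2]
  have h3 : ∀ k, (polyCalculus b 𝒜).v (Sum.inl k) = MvPolynomial.X k ⊗ₜ 1 := fun _ => rfl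
  rw [SuperCalculus.quad, evenQuad, superForm, Fintype.sum_sum_type, ← TensorProduct.smul_tmul']
  congr 1
  have h4 : ∀ (i : Fin n) (j : Idx p n), ((-1) ^ (parity (Sum.inr i : Idx p n)).val * gram b (Sum.inr i) j) •
    ((polyCalculus b 𝒜).v (Sum.inr i) * (polyCalculus b 𝒜).act (evenMat Y : SuperMat p n (ℂ ⊗[ℝ] P)) j) = 0 := by
    rintro i (j | j)
    · simp [gram]
    · rw [hact', mul_zero, smul_zero]
  simp only [h4, Finset.sum_const_zero, add_zero, TensorProduct.sum_tmul]
  refine Finset.sum_congr rfl fun i _ => ?_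
  rw [Fintype.sum_sum_type]
  simp only [hact, hact', mul_zero, smul_zero, Finset.sum_const_zero, add_zero, h3,
    Algebra.TensorProduct.tmul_mul_tmul, mul_one]
  refine Finset.sum_congr rfl fun j _ => ?_
  rw [TensorProduct.smul_tmul']
  simp [gram, gramEven]

/-- Only the body of the even-even block has to be removed: every other contribution contains a
nilpotent coefficient or an odd coordinate. -/
theorem isCentralNilpotent_quad_sub {X : SuperMat p n (ℂ ⊗[ℝ] P)}
    (hX : IsPointGl (gradingC 𝒜) X) :
    IsCentralNilpotent ((polyCalculus b 𝒜).quad b X - evenQuad b (bodyEven 𝒜 X) ⊗ₜ 1) := by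
  have h1 : (polyCalculus b 𝒜).quad b X - evenQuad b (bodyEven 𝒜 X) ⊗ₜ 1
      = (polyCalculus b 𝒜).quad b (X - evenMat (bodyEven 𝒜 X)) := by
    rw [sub_eq_iff_eq_add, ← quad_evenMat, ← SuperCalculus.quad_add, sub_add_cancel]
  have hr : ∀ z : ℂ, algebraMap ℂ (ℂ ⊗[ℝ] P) z ∈ gradingC 𝒜 0 := fun z => by
    rw [Algebra.algebraMap_eq_smul_one]
    exact (gradingC 𝒜 0).smul_mem _ (isSupercomm_gradingC 𝒜).one_mem
  have hp : IsPointGl (gradingC 𝒜) (X - evenMat (bodyEven 𝒜 X)) := by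
    refine hX.sub ?_
    rintro (i | i) (j | j)
    · exact hr _
    all_goals simp [evenMat]
  rw [h1]
  refine (polyCalculus b 𝒜).isCentralNilpotent_quad b hp fun i j => ?_
  refine isNilpotent_of_bodyC_eq_zero 𝒜 (hp.even_even i j) ?_
  simp [evenMat, bodyEven, Matrix.toBlocks₁₁, bodyC_tmul]

/-- The superintegral `∫ exp(-1/2 B(v, X v))`, for a functional `E` that represents the integral of
polynomials against the exponential of the body. -/
def expIntegral (E : EvenPoly p →ₗ[ℂ] ℂ) (X : SuperMat p n (ℂ ⊗[ℝ] P)) : ℂ ⊗[ℝ] P :=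
  superIntegral b 𝒜 E (IsNilpotent.exp
    ((polyCalculus b 𝒜).quad b X - evenQuad b (bodyEven 𝒜 X) ⊗ₜ 1))

omit [GradedAlgebra 𝒜] [NearSuperalgebra 𝒜] in
theorem toC_mem_isPointGl {M : SuperMat p n P} (hM : IsPointGl 𝒜 M) :
    IsPointGl (gradingC 𝒜) (M.map toC) := fun i j => toC_mem_gradingC 𝒜 (hM i j)

omit [GradedAlgebra 𝒜] [NearSuperalgebra 𝒜] in
theorem supertrace_mem {M : SuperMat p n P} (hM : IsPointGl 𝒜 M) : supertrace M ∈ 𝒜 0 := by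
  refine (𝒜 0).sum_mem fun i _ => ?_
  have := hM i i
  rw [zmod_two_add_self] at this
  rcases i with i | i <;> simpa using this

/-- Both 1 + N and its adjoint have body 1. So the Gaussian weight does not change, and the same
functional E can be used on both sides of `expIntegral_unipotent`. -/
theorem bodyEven_unipotent (X : SuperMat p n (ℂ ⊗[ℝ] P)) {N : SuperMat p n P}
    (hN0 : ∀ i j, body 𝒜 (N i j) = 0) :
    bodyEven 𝒜 ((adjoint b (1 + N)).map toC * X * (1 + N).map toC) = bodyEven 𝒜 X := by
  have h1 : ((1 + N).map toC).map (bodyC 𝒜) = 1 := by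
    ext i j
    simp [bodyC_toC, hN0, Matrix.one_apply, apply_ite (bodyC 𝒜)]
  have h2 : ((adjoint b (1 + N)).map toC * X * (1 + N).map toC).map (bodyC 𝒜)
      = X.map (bodyC 𝒜) := by
    have h3 : (((adjoint b (1 + N)).map toC).map (bodyC 𝒜) : SuperMat p n ℂ) = 1 := by
      rw [map_adjoint b toC]
      refine (map_adjoint b ((bodyC 𝒜).restrictScalars ℝ) _).trans ?_
      exact (congrArg (adjoint b) h1).trans (adjoint_one b)
    rw [Matrix.map_mul, Matrix.map_mul, h1, h3, one_mul, mul_one]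
  ext i j
  exact congrFun (congrFun h2 (Sum.inl i)) (Sum.inl j)

/-- Invariance under a point of `GL(V)` with body `1`. -/
theorem expIntegral_unipotent (E : EvenPoly p →ₗ[ℂ] ℂ) {X : SuperMat p n (ℂ ⊗[ℝ] P)}
    (hX : IsPointGl (gradingC 𝒜) X)
    (hE : ∀ i f, E (MvPolynomial.pderiv i f +
      MvPolynomial.pderiv i (evenQuad b (bodyEven 𝒜 X)) * f) = 0)
    {N : SuperMat p n P} (hN : IsPointGl 𝒜 N) (hN0 : ∀ i j, body 𝒜 (N i j) = 0)
    (β : Polynomial P)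
    (hβ : ∀ t : ℝ, ∃ Y, IsPointGl 𝒜 Y ∧ N = (1 + t • N) * Y ∧
      evalReal t (Polynomial.derivative β) = supertrace Y * evalReal t β) :
    expIntegral b 𝒜 E ((adjoint b (1 + N)).map toC * X * (1 + N).map toC) * toC (evalReal 1 β)
      = expIntegral b 𝒜 E X * toC (evalReal 0 β) := by
  set N' : SuperMat p n (ℂ ⊗[ℝ] P) := N.map toC with hN'
  have hN'p : IsPointGl (gradingC 𝒜) N' := toC_mem_isPointGl 𝒜 hN
  have hN'0 : N'.map (bodyC 𝒜) = 0 := by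
    ext i j
    simp [hN', bodyC_toC, hN0]
  have hadj : ∀ M : SuperMat p n (ℂ ⊗[ℝ] P), (adjoint b M).map (bodyC 𝒜)
      = adjoint b (M.map (bodyC 𝒜)) := fun M =>
    map_adjoint b ((bodyC 𝒜).restrictScalars ℝ) M
  have hadj0 : adjoint b (0 : SuperMat p n ℂ) = 0 := by
    simpa using adjoint_smul b (0 : ℝ) (0 : SuperMat p n ℂ)
  have h1N : (1 + N).map toC = 1 + N' := by
    rw [Matrix.map_add _ (map_add _), Matrix.map_one _ (map_zero _) (map_one _)]
  have hA : IsPointGl (gradingC 𝒜) (adjoint b N') := hN'p.adjoint b (isSupercomm_gradingC 𝒜)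
  have hc := isSupercomm_gradingC 𝒜
  have hnil : ∀ {M : SuperMat p n (ℂ ⊗[ℝ] P)}, IsPointGl (gradingC 𝒜) M →
      M.map (bodyC 𝒜) = 0 → IsCentralNilpotent ((polyCalculus b 𝒜).quad b M) :=
    fun {M} hM h0 => (polyCalculus b 𝒜).isCentralNilpotent_quad b hM fun i j =>
      isNilpotent_of_bodyC_eq_zero 𝒜 (hM.even_even i j)
        (congrFun (congrFun h0 (Sum.inl i)) (Sum.inl j))
  have hn₁ := hnil ((hA.mul hc hX).add (hX.mul hc hN'p)) (by
    rw [Matrix.map_add _ (map_add _), Matrix.map_mul, Matrix.map_mul, hadj, hN'0, hadj0]; simp)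
  have hn₂ := hnil ((hA.mul hc hX).mul hc hN'p) (by
    rw [Matrix.map_mul, hN'0]; simp)
  have hn₀ := isCentralNilpotent_quad_sub b 𝒜 hX
  have main := (polyCalculus b 𝒜).integral_exp_quad_eq b hc (superIntegral b 𝒜 E)
    (superIntegral_d b 𝒜 E _ hE) (q := evenQuad b (bodyEven 𝒜 X) ⊗ₜ 1) (fun j => by
      change _ ⊗ₜ OddFun.deriv 𝒜 (b.h j) 1 = _
      rw [← map_one (OddFun.const 𝒜), OddFun.deriv_const, TensorProduct.tmul_zero])
    hN'p hn₀.1 hn₀.2 hn₁.1 hn₁.2 hn₂.1 hn₂.2 (β.map (toC : P →ₐ[ℝ] _).toRingHom) (fun t => by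
      obtain ⟨Y, hY, hNY, hβY⟩ := hβ t
      have hst : supertrace (Y.map toC) = toC (supertrace Y) := by
        rw [supertrace, supertrace, map_sum]
        refine Finset.sum_congr rfl fun i _ => ?_
        rw [map_mul, map_pow, map_neg, map_one, Matrix.map_apply]
      refine ⟨Y.map toC, toC_mem_isPointGl 𝒜 hY, ?_, ?_, ?_⟩
      · conv_lhs => rw [hN', hNY]
        rw [Matrix.map_mul, Matrix.map_add _ (map_add _),
          Matrix.map_one _ (map_zero _) (map_one _)]
        congr 2
        ext i j
        simp [hN']
      · intro s
        rw [hst, Commute, SemiconjBy]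
        simpa using (polyCalculus b 𝒜).c_mul (toC_mem_gradingC 𝒜 (supertrace_mem 𝒜 hY)) s
      · rw [Polynomial.derivative_map]
        refine (evalReal_map toC t _).trans ?_
        rw [hβY, map_mul, hst]
        exact congrArg _ (evalReal_map toC t β).symm)
  have e : ∀ t, evalReal t (β.map (toC : P →ₐ[ℝ] ℂ ⊗[ℝ] P).toRingHom) = toC (evalReal t β) :=
    fun t => evalReal_map toC t β
  rw [superIntegral_mul_c, superIntegral_mul_c, e, e] at main
  rw [expIntegral, expIntegral, bodyEven_unipotent b 𝒜 X hN0, map_adjoint, h1N]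
  exact main

end Functional

/-! ### Gaussian integrals of polynomials -/

section Gaussian

open MeasureTheory

variable {ι : Type*}

/-- Evaluation of a complex polynomial at a real point. -/
def evalAt (x : ι → ℝ) : MvPolynomial ι ℂ →ₐ[ℂ] ℂ := MvPolynomial.aeval fun i => (x i : ℂ)

@[simp] theorem evalAt_X (x : ι → ℝ) (i : ι) : evalAt x (MvPolynomial.X i) = x i :=
  MvPolynomial.aeval_X _ _

@[simp] theorem evalAt_C (x : ι → ℝ) (z : ℂ) : evalAt x (MvPolynomial.C z) = z :=
  MvPolynomial.aeval_C _ _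

theorem continuous_evalAt (f : MvPolynomial ι ℂ) : Continuous fun x : ι → ℝ => evalAt x f := by
  have : Continuous fun x : ι → ℝ => fun i => (x i : ℂ) := by fun_prop
  exact (MvPolynomial.continuous_eval f).comp this

theorem hasLineDerivAt_evalAt [DecidableEq ι] (f : MvPolynomial ι ℂ) (x : ι → ℝ) (i : ι) :
    HasLineDerivAt ℝ (fun x => evalAt x f) (evalAt x (MvPolynomial.pderiv i f)) x
      (Pi.single i 1) := by
  induction f using MvPolynomial.induction_on with
  | C z => simpa [HasLineDerivAt] using hasDerivAt_const (0 : ℝ) z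
  | add f g hf hg => simp only [map_add]; exact hf.add hg
  | mul_X f j hf =>
    have hX : HasDerivAt (fun t : ℝ => (((x + t • Pi.single i 1 : ι → ℝ) j : ℝ) : ℂ))
        ((Pi.single i 1 : ι → ℝ) j : ℂ) 0 := by
      refine HasDerivAt.ofReal_comp ?_
      simpa using ((hasDerivAt_id (0 : ℝ)).mul_const ((Pi.single i 1 : ι → ℝ) j)).const_add (x j)
    have h := HasDerivAt.mul (hf : HasDerivAt _ _ _) hX
    simp only [zero_smul, add_zero] at h
    have e : evalAt x (MvPolynomial.pderiv i (f * MvPolynomial.X j))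
        = evalAt x (MvPolynomial.pderiv i f) * x j
          + evalAt x f * ((Pi.single i 1 : ι → ℝ) j : ℂ) := by
      by_cases hij : i = j
      · subst hij; simp [MvPolynomial.pderiv_X]; ring
      · simp [MvPolynomial.pderiv_X, Ne.symm hij]; ring
    rw [e]
    simp only [map_mul, evalAt_X]
    exact h

variable [Fintype ι]

/-- The real part of `q` is bounded above by a negative definite quadratic form. -/
def GaussianBound (q : MvPolynomial ι ℂ) : Prop :=
  ∃ c : ℝ, 0 < c ∧ ∀ x : ι → ℝ, (evalAt x q).re ≤ -c * ∑ i, x i ^ 2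

theorem integrable_pow_mul_exp_neg_mul_sq {c : ℝ} (hc : 0 < c) (k : ℕ) :
    Integrable fun x : ℝ => x ^ k * Real.exp (-c * x ^ 2) := by
  simpa using integrable_rpow_mul_exp_neg_mul_sq hc
    (s := k) (lt_of_lt_of_le neg_one_lt_zero k.cast_nonneg)

/-- A monomial times e^q is dominated by a product of one-variable functions y^k exp(-c y²), each of
which is integrable. -/
theorem GaussianBound.integrable {q : MvPolynomial ι ℂ} (hq : GaussianBound q)
    (f : MvPolynomial ι ℂ) :
    Integrable fun x : ι → ℝ => evalAt x f * Complex.exp (evalAt x q) := by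
  obtain ⟨c, hc, hq⟩ := hq
  induction f using MvPolynomial.induction_on' with
  | add f g hf hg => simp only [map_add, add_mul]; exact hf.add hg
  | monomial k z =>
    have h1 : Integrable fun x : ι → ℝ => z * ((∏ i, x i ^ k i * Real.exp (-c * x i ^ 2) : ℝ) : ℂ) :=
      ((Integrable.fintype_prod (f := fun i (y : ℝ) => y ^ k i * Real.exp (-c * y ^ 2))
        fun i => integrable_pow_mul_exp_neg_mul_sq hc (k i)).ofReal).const_mul z
    refine h1.mono ?_ (Filter.Eventually.of_forall fun x => ?_)
    · exact ((continuous_evalAt _).mul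
        (Complex.continuous_exp.comp (continuous_evalAt q))).aestronglyMeasurable
    · have h2 : ‖evalAt x (MvPolynomial.monomial k z)‖ = ‖z‖ * ∏ i, |x i| ^ k i := by
        rw [evalAt, MvPolynomial.aeval_monomial, Finsupp.prod_fintype _ _ (by simp)]
        simp [norm_prod]
      rw [norm_mul, h2, norm_mul, Complex.norm_exp, Complex.norm_real, Finset.prod_mul_distrib,
        ← Real.exp_sum, ← Finset.mul_sum, norm_mul, norm_prod, mul_assoc]
      simp only [norm_pow, Real.norm_eq_abs, Real.abs_exp]
      gcongr
      exact hq x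

/-- The functional `f ↦ ∫ f e^q`. -/
def gaussian {q : MvPolynomial ι ℂ} (hq : GaussianBound q) : MvPolynomial ι ℂ →ₗ[ℂ] ℂ where
  toFun f := ∫ x : ι → ℝ, evalAt x f * Complex.exp (evalAt x q)
  map_add' f g := by
    simp only [map_add, add_mul]
    exact integral_add (hq.integrable f) (hq.integrable g)
  map_smul' z f := by
    simp only [map_smul, smul_eq_mul, mul_assoc, RingHom.id_apply]
    exact integral_const_mul _ _

theorem gaussian_apply {q : MvPolynomial ι ℂ} (hq : GaussianBound q) (f : MvPolynomial ι ℂ) :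
    gaussian hq f = ∫ x : ι → ℝ, evalAt x f * Complex.exp (evalAt x q) := rfl

theorem gaussian_pderiv {q : MvPolynomial ι ℂ} (hq : GaussianBound q) (i : ι)
    (f : MvPolynomial ι ℂ) :
    gaussian hq (MvPolynomial.pderiv i f + MvPolynomial.pderiv i q * f) = 0 := by
  classical
  have hd : ∀ x : ι → ℝ, HasLineDerivAt ℝ (fun x => evalAt x f * Complex.exp (evalAt x q))
      (evalAt x (MvPolynomial.pderiv i f + MvPolynomial.pderiv i q * f) *
        Complex.exp (evalAt x q)) x (Pi.single i 1) := by
    intro x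
    have hf : HasDerivAt _ _ _ := hasLineDerivAt_evalAt f x i
    have hq : HasDerivAt _ _ _ := hasLineDerivAt_evalAt q x i
    have h := hf.mul hq.cexp
    simp only [zero_smul, add_zero] at h
    have e : evalAt x (MvPolynomial.pderiv i f + MvPolynomial.pderiv i q * f) *
        Complex.exp (evalAt x q) = evalAt x (MvPolynomial.pderiv i f) * Complex.exp (evalAt x q)
        + evalAt x f * (Complex.exp (evalAt x q) * evalAt x (MvPolynomial.pderiv i q)) := by
      rw [map_add, map_mul]; ring
    rw [e]
    exact h
  -- Integration by parts against the constant function 1: the integral of a partial derivative of f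
  -- e^q vanishes.
  have h := integral_bilinear_hasLineDerivAt_right_eq_neg_left_of_integrable
    (μ := (volume : Measure (ι → ℝ))) (B := ContinuousLinearMap.mul ℝ ℂ)
    (f := fun _ => (1 : ℂ)) (f' := fun _ => 0)
    (by simp) (by simpa only [ContinuousLinearMap.mul_apply', one_mul] using hq.integrable _) (by simpa using hq.integrable f)
    (fun x _ => by simpa [HasLineDerivAt] using hasDerivAt_const (0 : ℝ) (1 : ℂ))
    (fun x _ => hd x)
  simpa [gaussian_apply] using h

/-- S attains a positive minimum on the compact unit sphere of the sup norm, and homogeneity extends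
the bound to all x. Dividing by the number of coordinates compares the sup norm with the sum of
squares. -/
theorem exists_pos_mul_sum_sq_le (S : (ι → ℝ) → ℝ) (hS : Continuous S)
    (hom : ∀ (t : ℝ) x, S (t • x) = t ^ 2 * S x) (pos : ∀ x, x ≠ 0 → 0 < S x) :
    ∃ c : ℝ, 0 < c ∧ ∀ x, c * ∑ i, x i ^ 2 ≤ S x := by
  have h0 : S 0 = 0 := by simpa using hom 0 0
  rcases isEmpty_or_nonempty ι with hι | hι
  · exact ⟨1, one_pos, fun x => by simp [Subsingleton.elim x 0, h0]⟩
  obtain ⟨y, hy, hmin⟩ := (isCompact_sphere (0 : ι → ℝ) 1).exists_isMinOn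
    (NormedSpace.sphere_nonempty.2 zero_le_one) hS.continuousOn
  have hy0 : 0 < S y := pos y fun h => by simp [h] at hy
  refine ⟨S y / Fintype.card ι, by positivity, fun x => ?_⟩
  have hsum : ∑ i, x i ^ 2 ≤ Fintype.card ι * ‖x‖ ^ 2 := by
    have : ∀ i ∈ Finset.univ, x i ^ 2 ≤ ‖x‖ ^ 2 := fun i _ => by
      rw [← sq_abs]
      exact pow_le_pow_left₀ (abs_nonneg _) (norm_le_pi_norm x i) 2
    simpa using Finset.sum_le_card_nsmul _ _ _ this
  have hcard : (0 : ℝ) < Fintype.card ι := by positivity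
  by_cases hx : x = 0
  · simp [hx, h0]
  have hmem : ‖x‖⁻¹ • x ∈ Metric.sphere (0 : ι → ℝ) 1 := by
    simp [norm_smul, inv_mul_cancel₀ (norm_ne_zero_iff.2 hx)]
  have h1 := hmin hmem
  simp only [Set.mem_ofPred_eq, hom] at h1
  have hx' : 0 < ‖x‖ := norm_pos_iff.2 hx
  calc S y / Fintype.card ι * ∑ i, x i ^ 2 ≤ S y / Fintype.card ι * (Fintype.card ι * ‖x‖ ^ 2) := by
        gcongr
    _ = S y * ‖x‖ ^ 2 := by field_simp
    _ ≤ (‖x‖⁻¹ ^ 2 * S x) * ‖x‖ ^ 2 := by gcongr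
    _ = S x := by field_simp

/-- A linear change of variables. -/
theorem integral_comp_mulVec [DecidableEq ι] {A : Matrix ι ι ℝ} (hA : A.det ≠ 0)
    (F : (ι → ℝ) → ℂ) : ∫ x, F (A.mulVec x) = ((|A.det|)⁻¹ : ℝ) * ∫ x, F x := by
  have h := Real.map_matrix_volume_pi_eq_smul_volume_pi hA
  have he : MeasurableEmbedding (Matrix.toLin' A) := by
    have : Function.Injective (Matrix.toLin' A) := by
      intro x y hxy
      exact Matrix.mulVec_injective_of_isUnit ((Matrix.isUnit_iff_isUnit_det A).2 hA.isUnit) hxy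
    exact (LinearMap.continuous_of_finiteDimensional _).measurableEmbedding this
  have := he.integral_map (μ := volume) F
  rw [h, integral_smul_measure] at this
  rw [ENNReal.toReal_ofReal (abs_nonneg _), abs_inv] at this
  rw [← Complex.real_smul, this]
  rfl

end Gaussian

/-! ### The superPfaffian as an integral of a polynomial superfunction -/

section Link

open MeasureTheory

variable {V₀ V₁ : Type*} [AddCommGroup V₀] [Module ℝ V₀] [AddCommGroup V₁] [Module ℝ V₁]
  {B : SymplecticForm V₀ V₁} {p n : ℕ} (b : SymplecticBasis B p n)
  {P : Type*} [Ring P] [Algebra ℝ P] (𝒜 : ZMod 2 → Submodule ℝ P) [GradedAlgebra 𝒜]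

/-- Evaluation at the even coordinates `x`. -/
def evalSuper (x : Fin p ⊕ Fin p → ℝ) : SuperPoly p V₁ 𝒜 →ₐ[ℝ] ℂ ⊗[ℝ] OddFun V₁ 𝒜 :=
  Algebra.TensorProduct.map ((evalAt x).restrictScalars ℝ) (AlgHom.id ℝ _)

theorem evalSuper_tmul (x : Fin p ⊕ Fin p → ℝ) (f : EvenPoly p) (s : OddFun V₁ 𝒜) :
    evalSuper 𝒜 x (f ⊗ₜ s) = evalAt x f ⊗ₜ s := rfl

variable [NearSuperalgebra 𝒜]

theorem evalSuper_v (x : Fin p ⊕ Fin p → ℝ) (i : Idx p n) :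
    evalSuper 𝒜 x ((polyCalculus b 𝒜).v i) = genericPoint b 𝒜 x i := by
  rcases i with i | i
  · change evalSuper 𝒜 x (MvPolynomial.X i ⊗ₜ 1) = algebraMap ℝ _ (x i)
    rw [evalSuper_tmul, evalAt_X, Algebra.TensorProduct.algebraMap_apply]
    rfl
  · change evalSuper 𝒜 x (1 ⊗ₜ OddFun.coord 𝒜 (b.h.coord i)) = _
    rw [evalSuper_tmul, map_one]
    rfl

theorem evalSuper_c (x : Fin p ⊕ Fin p → ℝ) (r : ℂ ⊗[ℝ] P) :
    evalSuper 𝒜 x ((polyCalculus b 𝒜).c r) = constFun 𝒜 V₁ r := by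
  induction r using TensorProduct.induction_on with
  | zero => simp
  | add r s hr hs => rw [map_add, map_add, map_add, hr, hs]
  | tmul z a =>
    change evalSuper 𝒜 x (MvPolynomial.C z ⊗ₜ OddFun.const 𝒜 a) = _
    rw [evalSuper_tmul, evalAt_C]
    rfl

theorem evalSuper_quad (X : SuperMat p n (ℂ ⊗[ℝ] P)) (x : Fin p ⊕ Fin p → ℝ) :
    evalSuper 𝒜 x ((polyCalculus b 𝒜).quad b X) = moment b 𝒜 X x := by
  rw [SuperCalculus.quad, moment, map_smul]
  congr 1
  simp only [superForm, map_sum, map_smul, map_mul, SuperCalculus.act_apply, evalSuper_v,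
    evalSuper_c]
  rfl

theorem evalAt_evenQuad (X : SuperMat p n (ℂ ⊗[ℝ] P)) (x : Fin p ⊕ Fin p → ℝ) :
    evalAt x (evenQuad b (bodyEven 𝒜 X)) = momentBody b 𝒜 X x := by
  have h1 : ∀ (r : ℝ) (f : EvenPoly p), evalAt x (r • f) = (r : ℂ) * evalAt x f := fun r f => by
    rw [← Complex.real_smul]
    exact map_smul ((evalAt x).restrictScalars ℝ) r f
  have h2 : ∀ z : ℂ, evalAt x (algebraMap ℂ (EvenPoly p) z) = z := evalAt_C x
  rw [evenQuad, momentBody, h1, map_sum]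
  congr 1
  · push_cast; rfl
  refine Finset.sum_congr rfl fun i _ => ?_
  rw [map_sum]
  refine Finset.sum_congr rfl fun j _ => ?_
  rw [h1, map_mul, evalAt_X, map_sum, ← mul_assoc, ← Complex.ofReal_mul]
  simp only [map_mul, h2, evalAt_X]
  rfl

theorem expMoment_eq {X : SuperMat p n (ℂ ⊗[ℝ] P)} (hX : IsPointGl (gradingC 𝒜) X)
    (x : Fin p ⊕ Fin p → ℝ) :
    expMoment b 𝒜 X x = Complex.exp (evalAt x (evenQuad b (bodyEven 𝒜 X))) •
      evalSuper 𝒜 x (IsNilpotent.exp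
        ((polyCalculus b 𝒜).quad b X - evenQuad b (bodyEven 𝒜 X) ⊗ₜ 1)) := by
  have h : evalSuper 𝒜 x (IsNilpotent.exp
      ((polyCalculus b 𝒜).quad b X - evenQuad b (bodyEven 𝒜 X) ⊗ₜ 1))
      = IsNilpotent.exp (evalSuper 𝒜 x
        ((polyCalculus b 𝒜).quad b X - evenQuad b (bodyEven 𝒜 X) ⊗ₜ 1)) :=
    IsNilpotent.map_exp (isCentralNilpotent_quad_sub b 𝒜 hX).2 (evalSuper 𝒜 x).toRingHom
  rw [h, map_sub, evalSuper_quad, evalSuper_tmul, evalAt_evenQuad, expMoment]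
  rfl

omit [NearSuperalgebra 𝒜] in
theorem berezin_tmul (z : ℂ) (s : OddFun V₁ 𝒜) :
    berezin b 𝒜 (z ⊗ₜ s) = (∏ j, b.c j) • (z ⊗ₜ OddFun.ber 𝒜 b s) := rfl

omit [NearSuperalgebra 𝒜] in
-- Both assertions are additive in F, and on f ⊗ s the integrand is a fixed scalar times f e^q. This
-- identifies the analytic superintegral with the algebraic functional.
theorem integral_berezin_evalSuper {q : EvenPoly p} (hq : GaussianBound q)
    (F : SuperPoly p V₁ 𝒜) (φ : ℂ ⊗[ℝ] P →ₗ[ℂ] ℂ) :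
    Integrable (fun x => φ (berezin b 𝒜 (Complex.exp (evalAt x q) • evalSuper 𝒜 x F))) ∧
    ∫ x, φ (berezin b 𝒜 (Complex.exp (evalAt x q) • evalSuper 𝒜 x F))
      = φ (superIntegral b 𝒜 (gaussian hq) F) := by
  induction F using TensorProduct.induction_on with
  | zero => simp
  | add F G hF hG =>
    simp only [map_add, smul_add]
    exact ⟨hF.1.add hG.1, by rw [integral_add hF.1 hG.1, hF.2, hG.2]⟩
  | tmul f s =>
    have h1 : ∀ z : ℂ, z ⊗ₜ[ℝ] OddFun.ber 𝒜 b s = z • (1 ⊗ₜ OddFun.ber 𝒜 b s) := fun z => by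
      rw [TensorProduct.smul_tmul', smul_eq_mul, mul_one]
    have h2 : ∀ x, φ (berezin b 𝒜 (Complex.exp (evalAt x q) • evalSuper 𝒜 x (f ⊗ₜ s)))
        = evalAt x f * Complex.exp (evalAt x q) *
          φ ((∏ j, b.c j) • (1 ⊗ₜ OddFun.ber 𝒜 b s)) := fun x => by
      rw [map_smul, evalSuper_tmul, berezin_tmul, h1, smul_comm (∏ j, b.c j), map_smul, map_smul,
        smul_eq_mul, smul_eq_mul]
      ring
    simp only [h2]
    refine ⟨(hq.integrable f).mul_const _, ?_⟩
    rw [integral_mul_const, superIntegral_tmul, h1 (gaussian hq f), smul_comm (∏ j, b.c j)]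
    exact (map_smul φ _ _).symm

theorem re_momentBody (X : SuperMat p n (ℂ ⊗[ℝ] P)) (x : Fin p ⊕ Fin p → ℝ) :
    (momentBody b 𝒜 X x).re = -1 / 2 * ∑ i, ∑ j, B.even (b.e i) (b.e j) * x i *
      ∑ k, (bodyC 𝒜 (X.toBlocks₁₁ j k)).re * x k := by
  have : (-1 / 2 : ℂ) = ((-1 / 2 : ℝ) : ℂ) := by push_cast; rfl
  rw [momentBody, this, Complex.re_ofReal_mul, Complex.re_sum]
  simp only [Complex.re_sum, Complex.re_ofReal_mul, Complex.re_mul_ofReal]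

theorem gaussianBound_of_mem {X : SuperMat p n (ℂ ⊗[ℝ] P)} (hX : X ∈ spoDomain b 𝒜) :
    GaussianBound (evenQuad b (bodyEven 𝒜 X)) := by
  obtain ⟨c, hc, h⟩ := exists_pos_mul_sum_sq_le
    (fun x : Fin p ⊕ Fin p → ℝ => ∑ i, ∑ j, B.even (b.e i) (b.e j) * x i *
        ∑ k, (bodyC 𝒜 (X.toBlocks₁₁ j k)).re * x k) (by fun_prop)
    (fun t x => by
      simp only [Pi.smul_apply, smul_eq_mul, Finset.mul_sum]
      refine Finset.sum_congr rfl fun i _ => Finset.sum_congr rfl fun j _ =>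
        Finset.sum_congr rfl fun k _ => by ring) hX.2.2
  refine ⟨c / 2, half_pos hc, fun x => ?_⟩
  have h2 := h x
  rw [evalAt_evenQuad, re_momentBody]
  linarith

theorem vecIntegrable_and_apply {X : SuperMat p n (ℂ ⊗[ℝ] P)} (hX : X ∈ spoDomain b 𝒜)
    (φ : ℂ ⊗[ℝ] P →ₗ[ℂ] ℂ) :
    Integrable (fun x => φ (spfIntegrand b 𝒜 X x)) ∧ ∫ x, φ (spfIntegrand b 𝒜 X x)
      = φ (expIntegral b 𝒜 (gaussian (gaussianBound_of_mem b 𝒜 hX)) X) := by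
  simp only [spfIntegrand, expMoment_eq b 𝒜 hX.1]
  exact integral_berezin_evalSuper b 𝒜 _ _ φ

theorem spfConverges_of_mem {X : SuperMat p n (ℂ ⊗[ℝ] P)} (hX : X ∈ spoDomain b 𝒜) :
    SpfConverges b 𝒜 X := fun φ => (vecIntegrable_and_apply b 𝒜 hX φ).1

/-- Characterization of the superPfaffian by its components. -/
theorem apply_Spf {X : SuperMat p n (ℂ ⊗[ℝ] P)} (hX : SpfConverges b 𝒜 X)
    (φ : ℂ ⊗[ℝ] P →ₗ[ℂ] ℂ) :
    φ (Spf b 𝒜 X) = (((2 * Real.pi) ^ p)⁻¹ : ℝ) * ∫ x, φ (spfIntegrand b 𝒜 X x) := by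
  have := finite_complexification 𝒜
  rw [← apply_vecIntegral hX φ, Spf, ← Complex.real_smul]
  exact map_smul (φ.restrictScalars ℝ) _ _

theorem Spf_eq_expIntegral {X : SuperMat p n (ℂ ⊗[ℝ] P)} (hX : X ∈ spoDomain b 𝒜) :
    Spf b 𝒜 X = (((2 * Real.pi) ^ p)⁻¹ : ℝ) •
      expIntegral b 𝒜 (gaussian (gaussianBound_of_mem b 𝒜 hX)) X := by
  rw [← sub_eq_zero, ← Module.forall_dual_apply_eq_zero_iff ℂ]
  intro φ
  rw [map_sub, apply_Spf b 𝒜 (spfConverges_of_mem b 𝒜 hX), (vecIntegrable_and_apply b 𝒜 hX φ).2,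
    sub_eq_zero, ← Complex.real_smul]
  exact (map_smul (φ.restrictScalars ℝ) _ _).symm

end Link

/-! ### The action of `GL(V)` on the domain of the superPfaffian -/

section Action

open MeasureTheory

variable {V₀ V₁ : Type*} [AddCommGroup V₀] [Module ℝ V₀] [AddCommGroup V₁] [Module ℝ V₁]
  {B : SymplecticForm V₀ V₁} {p n : ℕ} (b : SymplecticBasis B p n)
  {P : Type*} [Ring P] [Algebra ℝ P] (𝒜 : ZMod 2 → Submodule ℝ P) [GradedAlgebra 𝒜]
  [NearSuperalgebra 𝒜]

/-- The block `A` of the body of a supermatrix. -/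
def bodyBlock (g : SuperMat p n P) : Matrix (Fin p ⊕ Fin p) (Fin p ⊕ Fin p) ℝ :=
  g.toBlocks₁₁.map (body 𝒜)

/-- The points of `𝔤𝔩(V ⊗ ℂ)` obtained from `X` by `X ↦ g^* X g`. -/
def conjAdjoint (g : SuperMat p n P) (X : SuperMat p n (ℂ ⊗[ℝ] P)) : SuperMat p n (ℂ ⊗[ℝ] P) :=
  (adjoint b g).map toC * X * g.map toC

omit [GradedAlgebra 𝒜] [NearSuperalgebra 𝒜] in
theorem adjoint_map_toC (g : SuperMat p n P) :
    (adjoint b g).map (toC : P →ₐ[ℝ] ℂ ⊗[ℝ] P) = adjoint b (g.map toC) :=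
  map_adjoint b toC g

theorem conjAdjoint_mul {g k : SuperMat p n P} (hg : IsPointGl 𝒜 g) (hk : IsPointGl 𝒜 k)
    (X : SuperMat p n (ℂ ⊗[ℝ] P)) :
    conjAdjoint b (g * k) X = conjAdjoint b k (conjAdjoint b g X) := by
  simp only [conjAdjoint]
  rw [adjoint_mul b (isSupercomm 𝒜) hg hk, Matrix.map_mul, Matrix.map_mul]
  simp only [Matrix.mul_assoc]

theorem momentBody_eq_superForm (X : SuperMat p n (ℂ ⊗[ℝ] P)) (x : Fin p ⊕ Fin p → ℝ) :
    momentBody b 𝒜 X x = (-1 / 2 : ℝ) • superForm b (Sum.elim (fun i => (x i : ℂ)) 0)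
      ((X.map (bodyC 𝒜)).mulVec (Sum.elim (fun i => (x i : ℂ)) 0)) := by
  rw [momentBody, superForm, Fintype.sum_sum_type, Complex.real_smul]
  congr 1
  · push_cast; rfl
  · simp [Fintype.sum_sum_type, gram, Matrix.mulVec, dotProduct, Matrix.toBlocks₁₁, mul_assoc]

theorem body_apply_of_parity_ne {g : SuperMat p n P} (hg : IsPointGl 𝒜 g) {i j : Idx p n}
    (hij : parity i ≠ parity j) : body 𝒜 (g i j) = 0 := by
  rcases i with i | i <;> rcases j with j | j
  · simp at hij
  · exact body_of_odd 𝒜 (hg.even_odd i j)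
  · exact body_of_odd 𝒜 (hg.odd_even i j)
  · simp at hij

/-- The odd blocks of g have body 0, so its body preserves V₀ and B(v, g^*Xg v) = B(gv, X gv)
reduces to the substitution x ↦ b(A)x. Positivity of the domain is transported this way. -/
theorem momentBody_conjAdjoint {g : SuperMat p n P} (hg : IsPointGl 𝒜 g)
    (X : SuperMat p n (ℂ ⊗[ℝ] P)) (x : Fin p ⊕ Fin p → ℝ) :
    momentBody b 𝒜 (conjAdjoint b g X) x
      = momentBody b 𝒜 X ((bodyBlock 𝒜 g).mulVec x) := by
  set M : SuperMat p n ℂ := (g.map toC).map (bodyC 𝒜) with hM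
  have hMij : ∀ i j, M i j = body 𝒜 (g i j) := fun i j => bodyC_toC 𝒜 _
  have h1 : (conjAdjoint b g X).map (bodyC 𝒜) = adjoint b M * X.map (bodyC 𝒜) * M := by
    rw [conjAdjoint, adjoint_map_toC, Matrix.map_mul, Matrix.map_mul]
    congr 2
    exact map_adjoint b ((bodyC 𝒜).restrictScalars ℝ) _
  set v : Idx p n → ℂ := Sum.elim (fun i => (x i : ℂ)) 0 with hv
  have h2 : M.mulVec v = Sum.elim (fun i => (((bodyBlock 𝒜 g).mulVec x i : ℝ) : ℂ)) 0 := by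
    funext i
    rcases i with i | i
    · simp [Matrix.mulVec, dotProduct, hv, hMij, bodyBlock, Matrix.toBlocks₁₁]
    · simp [Matrix.mulVec, dotProduct, hv, hMij, body_of_odd 𝒜 (hg.odd_even i _)]
  rw [momentBody_eq_superForm, momentBody_eq_superForm, ← h2, h1, ← Matrix.mulVec_mulVec,
    ← Matrix.mulVec_mulVec, ← superForm_mulVec_left b]
  intro i j
  by_cases hij : parity i = parity j
  · rw [hij, zmod_two_add_self]
    simp [mul_comm]
  · rw [hMij, body_apply_of_parity_ne 𝒜 hg hij]
    simp

theorem mem_spoDomain_iff (X : SuperMat p n (ℂ ⊗[ℝ] P)) : X ∈ spoDomain b 𝒜 ↔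
    IsPointGl (gradingC 𝒜) X ∧ adjoint b X = -X ∧
      ∀ x : Fin p ⊕ Fin p → ℝ, x ≠ 0 → (momentBody b 𝒜 X x).re < 0 := by
  refine and_congr_right fun _ => and_congr_right fun _ => forall_congr' fun x =>
    imp_congr_right fun _ => ?_
  rw [re_momentBody]
  constructor <;> intro h <;> linarith

theorem conjAdjoint_mem_spoDomain {X : SuperMat p n (ℂ ⊗[ℝ] P)} (hX : X ∈ spoDomain b 𝒜)
    {g : SuperMat p n P} (hg : IsPointGl 𝒜 g) (hA : (bodyBlock 𝒜 g).det ≠ 0) :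
    conjAdjoint b g X ∈ spoDomain b 𝒜 := by
  rw [mem_spoDomain_iff] at hX ⊢
  have hc := isSupercomm_gradingC 𝒜
  have hg' := toC_mem_isPointGl 𝒜 hg
  have ha := hg'.adjoint b hc
  refine ⟨?_, ?_, fun x hx => ?_⟩
  · rw [conjAdjoint, adjoint_map_toC]
    exact (ha.mul hc hX.1).mul hc hg'
  · rw [conjAdjoint, adjoint_map_toC, adjoint_mul b hc (ha.mul hc hX.1) hg',
      adjoint_mul b hc ha hX.1, adjoint_adjoint, hX.2.1]
    simp [Matrix.mul_assoc]
  · rw [momentBody_conjAdjoint b 𝒜 hg]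
    refine hX.2.2 _ fun h => hx ?_
    exact Matrix.eq_zero_of_mulVec_eq_zero hA h

theorem bodyBlock_mul {g k : SuperMat p n P} (hg : IsPointGl 𝒜 g) :
    bodyBlock 𝒜 (g * k) = bodyBlock 𝒜 g * bodyBlock 𝒜 k := by
  ext i j
  simp [bodyBlock, Matrix.toBlocks₁₁, Matrix.mul_apply, body_of_odd 𝒜 (hg.even_odd i _)]

theorem det_bodyBlock_ne_zero {g k : SuperMat p n P} (hg : IsPointGl 𝒜 g) (h : g * k = 1) :
    (bodyBlock 𝒜 g).det ≠ 0 := by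
  have h1 := bodyBlock_mul 𝒜 (k := k) hg
  have h2 : bodyBlock 𝒜 (1 : SuperMat p n P) = 1 := by
    ext i j
    simp [bodyBlock, Matrix.toBlocks₁₁, Matrix.one_apply, apply_ite (body 𝒜)]
  rw [h, h2] at h1
  have h3 := congrArg Matrix.det h1
  rw [Matrix.det_one, Matrix.det_mul] at h3
  exact left_ne_zero_of_mul (h3 ▸ one_ne_zero)

/-! ### Real linear changes of coordinates -/

omit [NearSuperalgebra 𝒜] in
theorem berezin_map_subst (φ : V₁ →ₗ[ℝ] V₁) (s : ℂ ⊗[ℝ] OddFun V₁ 𝒜) :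
    berezin b 𝒜 (Algebra.TensorProduct.map (AlgHom.id ℂ ℂ) (OddFun.subst 𝒜 φ) s)
      = LinearMap.det φ • berezin b 𝒜 s := by
  induction s using TensorProduct.induction_on with
  | zero => simp
  | add s t hs ht => rw [map_add, map_add, map_add, hs, ht, smul_add]
  | tmul z s =>
    rw [Algebra.TensorProduct.map_tmul, berezin_tmul, berezin_tmul, OddFun.ber_subst,
      TensorProduct.tmul_smul, smul_comm]
    rfl

variable (A : Matrix (Fin p ⊕ Fin p) (Fin p ⊕ Fin p) ℝ) (D : Matrix (Fin n) (Fin n) ℝ)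

/-- A real even endomorphism of `V`, as a point of `𝔤𝔩(V)`. -/
def realPoint (P : Type*) [Ring P] [Algebra ℝ P] : SuperMat p n P :=
  (Matrix.fromBlocks A 0 0 D).map (algebraMap ℝ P)

omit [NearSuperalgebra 𝒜] in
theorem realPoint_isPointGl : IsPointGl 𝒜 (realPoint A D P) := by
  have h : ∀ r : ℝ, algebraMap ℝ P r ∈ 𝒜 0 := fun r => SetLike.algebraMap_mem_graded 𝒜 r
  rintro (i | i) (j | j)
  · exact h _
  · simp [realPoint]
  · simp [realPoint]
  · exact h _

theorem bodyBlock_realPoint : bodyBlock 𝒜 (realPoint A D P) = A := by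
  ext i j
  simp [bodyBlock, realPoint, Matrix.toBlocks₁₁]

omit [NearSuperalgebra 𝒜] in
-- A real g sends the generic point at x to the image of the generic point at Ax under the
-- substitution of odd coordinates by D; this substitution fixes constants, so it passes through the
-- quadratic form.
theorem moment_conjAdjoint_realPoint (X : SuperMat p n (ℂ ⊗[ℝ] P)) (x : Fin p ⊕ Fin p → ℝ) :
    moment b 𝒜 (conjAdjoint b (realPoint A D P) X) x
      = Algebra.TensorProduct.map (AlgHom.id ℂ ℂ) (OddFun.subst 𝒜 (Matrix.toLin b.h b.h D))
          (moment b 𝒜 X (A.mulVec x)) := by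
  set Φ := Algebra.TensorProduct.map (AlgHom.id ℂ ℂ) (OddFun.subst 𝒜 (Matrix.toLin b.h b.h D))
    with hΦ
  have hΦr : ∀ (r : ℝ) y, Φ (r • y) = r • Φ y := map_smul (Φ.restrictScalars ℝ)
  set M : SuperMat p n (ℂ ⊗[ℝ] OddFun V₁ 𝒜) :=
    ((realPoint A D P).map toC).map (constFun 𝒜 V₁) with hM
  have hMij : ∀ i j, M i j = algebraMap ℝ _ (Matrix.fromBlocks A 0 0 D i j) := fun i j => by
    simp only [hM, realPoint, Matrix.map_apply, AlgHom.commutes]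
    exact ((constFun 𝒜 V₁).restrictScalars ℝ).commutes _
  have h1 : (conjAdjoint b (realPoint A D P) X).map (constFun 𝒜 V₁)
      = adjoint b M * X.map (constFun 𝒜 V₁) * M := by
    rw [conjAdjoint, adjoint_map_toC, Matrix.map_mul, Matrix.map_mul]
    congr 2
    exact map_adjoint b ((constFun 𝒜 V₁).restrictScalars ℝ) _
  have h2 : ∀ i, Φ (genericPoint b 𝒜 (A.mulVec x) i) = M.mulVec (genericPoint b 𝒜 x) i := by
    intro i
    rw [Matrix.mulVec, dotProduct, Fintype.sum_sum_type]
    simp only [hMij]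
    rcases i with i | i
    · have : Φ (genericPoint b 𝒜 (A.mulVec x) (Sum.inl i))
          = algebraMap ℝ _ (A.mulVec x i) := (Φ.restrictScalars ℝ).commutes _
      rw [this]
      simp only [genericPoint, Sum.elim_inl, Matrix.fromBlocks_apply₁₁, Matrix.fromBlocks_apply₁₂,
        Matrix.zero_apply, map_zero, zero_mul, Finset.sum_const_zero, add_zero, ← map_mul,
        ← map_sum]
      rfl
    · have : Φ (genericPoint b 𝒜 (A.mulVec x) (Sum.inr i))
          = 1 ⊗ₜ OddFun.subst 𝒜 (Matrix.toLin b.h b.h D) (OddFun.coord 𝒜 (b.h.coord i)) := rfl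
      have e : (Matrix.toLin b.h b.h D).dualMap (b.h.coord i) = ∑ j, D i j • b.h.coord j := by
        refine b.h.ext fun k => ?_
        simp [Matrix.toLin_self, Finsupp.single_apply]
      rw [this, OddFun.subst_coord, e, OddFun.coord_sum, TensorProduct.tmul_sum]
      simp only [Matrix.fromBlocks_apply₂₁, Matrix.fromBlocks_apply₂₂, Matrix.zero_apply, map_zero,
        zero_mul, Finset.sum_const_zero, zero_add]
      refine Finset.sum_congr rfl fun j _ => ?_
      rw [← Algebra.smul_def, TensorProduct.tmul_smul]
      rfl
  have h3 : ∀ r, Φ (constFun 𝒜 V₁ r) = constFun 𝒜 V₁ r := fun r => by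
    induction r using TensorProduct.induction_on with
    | zero => simp
    | add r s hr hs => rw [map_add, map_add, hr, hs]
    | tmul z a => exact congrArg (z ⊗ₜ ·) (OddFun.subst_const 𝒜 _ a)
  have h4 : Φ (moment b 𝒜 X (A.mulVec x)) = (-1 / 2 : ℝ) • superForm b
      (M.mulVec (genericPoint b 𝒜 x))
      ((X.map (constFun 𝒜 V₁)).mulVec (M.mulVec (genericPoint b 𝒜 x))) := by
    rw [moment, hΦr]
    congr 1
    simp only [superForm, map_sum, hΦr, map_mul, Matrix.mulVec, dotProduct, Matrix.map_apply, h3]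
    simp only [h2]
    rfl
  rw [h4, moment, h1, ← Matrix.mulVec_mulVec, ← Matrix.mulVec_mulVec, ← superForm_mulVec_left b]
  intro i j
  rw [hMij, Algebra.commutes]
  rcases i with i | i <;> rcases j with j | j <;> simp

theorem spfIntegrand_conjAdjoint_realPoint {X : SuperMat p n (ℂ ⊗[ℝ] P)}
    (hX : IsPointGl (gradingC 𝒜) X) (x : Fin p ⊕ Fin p → ℝ) :
    spfIntegrand b 𝒜 (conjAdjoint b (realPoint A D P) X) x
      = D.det • spfIntegrand b 𝒜 X (A.mulVec x) := by
  have hn : IsNilpotent (moment b 𝒜 X (A.mulVec x) -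
      algebraMap ℂ _ (momentBody b 𝒜 X (A.mulVec x))) := by
    have := (isCentralNilpotent_quad_sub b 𝒜 hX).2.map (evalSuper 𝒜 (A.mulVec x))
    rw [map_sub, evalSuper_quad, evalSuper_tmul, evalAt_evenQuad] at this
    exact this
  have he := IsNilpotent.map_exp hn (Algebra.TensorProduct.map (AlgHom.id ℂ ℂ)
    (OddFun.subst 𝒜 (Matrix.toLin b.h b.h D))).toRingHom
  rw [spfIntegrand, spfIntegrand, ← LinearMap.det_toLin b.h D, ← berezin_map_subst]
  congr 1
  rw [expMoment, expMoment, moment_conjAdjoint_realPoint,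
    momentBody_conjAdjoint b 𝒜 (realPoint_isPointGl 𝒜 A D), bodyBlock_realPoint, map_smul]
  congr 1
  refine Eq.trans ?_ he.symm
  congr 1
  simp [map_sub]

/-- The even change of variables contributes |det A|⁻¹, the odd one det D. This is where the
absolute value in `ber10` comes from. -/
theorem Spf_conjAdjoint_realPoint {X : SuperMat p n (ℂ ⊗[ℝ] P)} (hX : X ∈ spoDomain b 𝒜)
    (hA : A.det ≠ 0) :
    Spf b 𝒜 (conjAdjoint b (realPoint A D P) X) = (|A.det|⁻¹ * D.det) • Spf b 𝒜 X := by
  have hX' := conjAdjoint_mem_spoDomain b 𝒜 hX (realPoint_isPointGl 𝒜 A D)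
    (by rwa [bodyBlock_realPoint])
  rw [← sub_eq_zero, ← Module.forall_dual_apply_eq_zero_iff ℂ]
  intro φ
  have hφ : ∀ (r : ℝ) y, φ (r • y) = r * φ y := fun r y => by
    rw [← Complex.real_smul]; exact map_smul (φ.restrictScalars ℝ) r y
  rw [map_sub, hφ, apply_Spf b 𝒜 (spfConverges_of_mem b 𝒜 hX'),
    apply_Spf b 𝒜 (spfConverges_of_mem b 𝒜 hX), sub_eq_zero]
  simp only [spfIntegrand_conjAdjoint_realPoint b 𝒜 A D hX.1, hφ, integral_const_mul]
  rw [integral_comp_mulVec hA (fun y => φ (spfIntegrand b 𝒜 X y))]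
  push_cast
  ring

end Action

/-! ### Determinants of unipotent families -/

section Det

variable {ι R : Type*} [Fintype ι] [DecidableEq ι] [CommRing R]

/-- The polynomial `det(1 + X N)`. -/
def detOneAddX (N : Matrix ι ι R) : Polynomial R :=
  (1 + (Polynomial.X : Polynomial R) • N.map Polynomial.C).det

theorem eval_detOneAddX (N : Matrix ι ι R) (r : R) :
    (detOneAddX N).eval r = (1 + r • N).det := by
  rw [detOneAddX, ← Polynomial.coe_evalRingHom, RingHom.map_det]
  congr 1
  ext i j
  simp [Matrix.one_apply, apply_ite (Polynomial.eval r), mul_comm (N i j) r]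

/-- Jacobi's formula. -/
theorem eval_derivative_detOneAddX {N Y : Matrix ι ι R} {r : R} (h : N = (1 + r • N) * Y) :
    (Polynomial.derivative (detOneAddX N)).eval r = Y.trace * (detOneAddX N).eval r := by
  -- Since N = (1 + rN)Y, the shifted matrix 1 + (T + r)N equals (1 + rN)(1 + TY), with T the
  -- polynomial variable. The derivative at r thereby becomes a derivative at 0, where it is the
  -- trace of Y.
  have h1 : Polynomial.taylor r (detOneAddX N)
      = Polynomial.C (1 + r • N).det * detOneAddX Y := by
    have h2 : Polynomial.taylor r (detOneAddX N)
        = (1 + (Polynomial.X + Polynomial.C r) • N.map Polynomial.C).det := by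
      rw [detOneAddX, ← Polynomial.taylorAlgHom_apply, ← AlgHom.coe_toRingHom, RingHom.map_det]
      congr 1
      ext i j : 1
      simp only [RingHom.mapMatrix_apply, RingHom.coe_coe,
        Matrix.map_apply, Matrix.add_apply, Matrix.smul_apply, Matrix.one_apply, smul_eq_mul,
        Polynomial.taylorAlgHom_apply, Polynomial.taylor_mul, map_add, Polynomial.taylor_X,
        Polynomial.taylor_C, apply_ite (Polynomial.taylor r), Polynomial.taylor_one, map_zero,
        Polynomial.C_1]
    rw [h2, detOneAddX, RingHom.map_det, ← Matrix.det_mul]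
    congr 1
    have h3 : (Polynomial.C : R →+* _).mapMatrix (1 + r • N) * Y.map Polynomial.C
        = N.map Polynomial.C := by
      conv_rhs => rw [h]
      simp [Matrix.map_mul]
    rw [mul_add, mul_one, mul_smul_comm, h3, add_smul]
    have h4 : (Polynomial.C : R →+* _).mapMatrix (1 + r • N)
        = 1 + Polynomial.C r • N.map Polynomial.C := by
      ext i j : 2
      simp [Matrix.one_apply, apply_ite Polynomial.C]
    rw [h4]
    abel
  have h5 := congrArg (fun f => (Polynomial.derivative f).eval 0) h1
  have h6 : (Polynomial.derivative (Polynomial.taylor r (detOneAddX N))).eval 0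
      = (Polynomial.derivative (detOneAddX N)).eval r := by
    rw [Polynomial.taylor_apply, Polynomial.derivative_comp]
    simp
  have h7 : (Polynomial.derivative (detOneAddX Y)).eval 0 = Y.trace :=
    Matrix.derivative_det_one_add_X_smul Y
  simp only [h6, Polynomial.derivative_C_mul, Polynomial.eval_C_mul, h7] at h5
  rw [h5, eval_detOneAddX, mul_comm]

end Det

/-! ### Bodies, nilpotents and units in the even part -/

section EvenPart

variable {P : Type*} [Ring P] [Algebra ℝ P] (𝒜 : ZMod 2 → Submodule ℝ P) [GradedAlgebra 𝒜]
  [NearSuperalgebra 𝒜]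

/-- The inclusion of the even part. -/
def evenVal : 𝒜 0 →ₐ[ℝ] P where
  toFun a := a
  map_one' := rfl
  map_mul' _ _ := rfl
  map_zero' := rfl
  map_add' _ _ := rfl
  commutes' _ := rfl

/-- The body of an even element. -/
def evenBody : 𝒜 0 →ₐ[ℝ] ℝ := (body 𝒜).comp (evenVal 𝒜)

omit [NearSuperalgebra 𝒜] in
@[simp] theorem evenVal_apply (a : 𝒜 0) : evenVal 𝒜 a = a := rfl

omit [NearSuperalgebra 𝒜] in
theorem evenPart_coe (a : 𝒜 0) : evenPart 𝒜 (a : P) = a := by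
  simp [evenPart]

omit [NearSuperalgebra 𝒜] in
theorem coe_evenPart {a : P} (ha : a ∈ 𝒜 0) : (evenPart 𝒜 a : P) = a :=
  congrArg Subtype.val (evenPart_coe 𝒜 ⟨a, ha⟩)

theorem isNilpotent_of_evenBody_eq_zero {a : 𝒜 0} (ha : evenBody 𝒜 a = 0) : IsNilpotent a := by
  obtain ⟨k, hk⟩ := isNilpotent_of_body_eq_zero 𝒜 ha
  refine ⟨k, Subtype.ext ?_⟩
  exact (map_pow (evenVal 𝒜) a k).trans hk

theorem isUnit_of_evenBody_ne_zero {a : 𝒜 0} (ha : evenBody 𝒜 a ≠ 0) : IsUnit a := by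
  have h1 : IsNilpotent (a - algebraMap ℝ (𝒜 0) (evenBody 𝒜 a)) :=
    isNilpotent_of_evenBody_eq_zero 𝒜 (by simp)
  have h2 : IsUnit (algebraMap ℝ (𝒜 0) (evenBody 𝒜 a)) := (IsUnit.mk0 _ ha).map _
  have h3 := h1.isUnit_add_left_of_commute h2 (Commute.all _ _)
  simpa using h3

theorem evenBody_det {ι : Type*} [Fintype ι] [DecidableEq ι] (N : Matrix ι ι (𝒜 0)) :
    evenBody 𝒜 N.det = (N.map (evenBody 𝒜)).det :=
  (evenBody 𝒜).toRingHom.map_det N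

/-- The body of this polynomial is 1, so its constant coefficient is a unit and all others are
nilpotent; such a polynomial is invertible. Hence the ratio of determinants along the path is again
polynomial in t. -/
theorem isUnit_detOneAddX {ι : Type*} [Fintype ι] [DecidableEq ι] {N : Matrix ι ι (𝒜 0)}
    (hN : N.map (evenBody 𝒜) = 0) : IsUnit (detOneAddX N) := by
  have h1 : (detOneAddX N).map (evenBody 𝒜).toRingHom = 1 := by
    rw [detOneAddX, ← Polynomial.coe_mapRingHom, RingHom.map_det]
    refine Eq.trans (congrArg Matrix.det ?_) Matrix.det_one
    ext i j : 2
    have := congrFun (congrFun hN i) j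
    simp only [Matrix.map_apply, Matrix.zero_apply] at this
    simp [Matrix.one_apply, apply_ite (Polynomial.map (evenBody 𝒜 : 𝒜 0 →+* ℝ)), this]
  have h2 : ∀ k, evenBody 𝒜 ((detOneAddX N).coeff k) = (1 : Polynomial ℝ).coeff k := fun k => by
    rw [← h1, Polynomial.coeff_map]; rfl
  rw [Polynomial.isUnit_iff_coeff_isUnit_isNilpotent]
  refine ⟨isUnit_of_evenBody_ne_zero 𝒜 (by simp [h2]), fun k hk =>
    isNilpotent_of_evenBody_eq_zero 𝒜 ?_⟩
  rw [h2, Polynomial.coeff_one, if_neg hk]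

theorem evalReal_eq_eval {R : Type*} [CommRing R] [Algebra ℝ R] (t : ℝ) (F : Polynomial R) :
    evalReal t F = F.eval (algebraMap ℝ R t) := rfl

end EvenPart

/-! ### Invariance under unipotent elements -/

section Unipotent

variable {V₀ V₁ : Type*} [AddCommGroup V₀] [Module ℝ V₀] [AddCommGroup V₁] [Module ℝ V₁]
  {B : SymplecticForm V₀ V₁} {p n : ℕ} (b : SymplecticBasis B p n)
  {P : Type*} [Ring P] [Algebra ℝ P] (𝒜 : ZMod 2 → Submodule ℝ P) [GradedAlgebra 𝒜]
  [NearSuperalgebra 𝒜]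

/-- The functional `gaussian` carries a proof about q, so q is kept as a variable to let X and its
transform share one functional. -/
theorem Spf_eq_expIntegral_of_eq {X : SuperMat p n (ℂ ⊗[ℝ] P)} (hX : X ∈ spoDomain b 𝒜)
    {q : EvenPoly p} (hq : GaussianBound q) (h : evenQuad b (bodyEven 𝒜 X) = q) :
    Spf b 𝒜 X = (((2 * Real.pi) ^ p)⁻¹ : ℝ) • expIntegral b 𝒜 (gaussian hq) X := by
  subst h
  exact Spf_eq_expIntegral b 𝒜 hX

theorem bodyBlock_one_add {N : SuperMat p n P} (hN0 : ∀ i j, body 𝒜 (N i j) = 0) :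
    bodyBlock 𝒜 (1 + N) = 1 := by
  ext i j
  simp [bodyBlock, Matrix.toBlocks₁₁, Matrix.one_apply, apply_ite (body 𝒜), hN0]

theorem Spf_conjAdjoint_one_add {X : SuperMat p n (ℂ ⊗[ℝ] P)} (hX : X ∈ spoDomain b 𝒜)
    {N : SuperMat p n P} (hN : IsPointGl 𝒜 N) (hN0 : ∀ i j, body 𝒜 (N i j) = 0)
    (β : Polynomial P)
    (hβ : ∀ t : ℝ, ∃ Y, IsPointGl 𝒜 Y ∧ N = (1 + t • N) * Y ∧
      evalReal t (Polynomial.derivative β) = supertrace Y * evalReal t β) :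
    Spf b 𝒜 (conjAdjoint b (1 + N) X) * toC (evalReal 1 β) = Spf b 𝒜 X * toC (evalReal 0 β) := by
  have h1N : IsPointGl 𝒜 (1 + N) := (IsPointGl.one (isSupercomm 𝒜)).add hN
  have hX' : conjAdjoint b (1 + N) X ∈ spoDomain b 𝒜 :=
    conjAdjoint_mem_spoDomain b 𝒜 hX h1N (by rw [bodyBlock_one_add 𝒜 hN0]; simp)
  have hq := gaussianBound_of_mem b 𝒜 hX
  have key : expIntegral b 𝒜 (gaussian hq) (conjAdjoint b (1 + N) X) * toC (evalReal 1 β)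
      = expIntegral b 𝒜 (gaussian hq) X * toC (evalReal 0 β) :=
    expIntegral_unipotent b 𝒜 _ hX.1 (gaussian_pderiv hq) hN hN0 β hβ
  rw [Spf_eq_expIntegral_of_eq b 𝒜 hX hq rfl, Spf_eq_expIntegral_of_eq b 𝒜 hX' hq
    (congrArg _ (bodyEven_unipotent b 𝒜 X hN0)), smul_mul_assoc, smul_mul_assoc, key]

/-- When N² = 0 the choice Y = N works for every t, and zero supertrace allows β = 1. -/
theorem Spf_conjAdjoint_one_add_of_mul_self {X : SuperMat p n (ℂ ⊗[ℝ] P)}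
    (hX : X ∈ spoDomain b 𝒜) {N : SuperMat p n P} (hN : IsPointGl 𝒜 N)
    (hN0 : ∀ i j, body 𝒜 (N i j) = 0) (hNN : N * N = 0) (hs : supertrace N = 0) :
    Spf b 𝒜 (conjAdjoint b (1 + N) X) = Spf b 𝒜 X := by
  simpa using Spf_conjAdjoint_one_add b 𝒜 hX hN hN0 1 fun t =>
    ⟨N, hN, by rw [add_mul, one_mul, smul_mul_assoc, hNN, smul_zero, add_zero], by simp [hs]⟩

/-- An even block diagonal supermatrix. -/
def evenDiag (S : Matrix (Fin p ⊕ Fin p) (Fin p ⊕ Fin p) (𝒜 0)) (D : Matrix (Fin n) (Fin n) (𝒜 0)) :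
    SuperMat p n P :=
  Matrix.fromBlocks (S.map (evenVal 𝒜)) 0 0 (D.map (evenVal 𝒜))

omit [NearSuperalgebra 𝒜] in
theorem evenDiag_isPointGl (S : Matrix (Fin p ⊕ Fin p) (Fin p ⊕ Fin p) (𝒜 0))
    (D : Matrix (Fin n) (Fin n) (𝒜 0)) : IsPointGl 𝒜 (evenDiag 𝒜 S D) := by
  rintro (i | i) (j | j)
  · exact (S i j).2
  · simp [evenDiag]
  · simp [evenDiag]
  · exact (D i j).2

theorem evenDiag_mul (S S' : Matrix (Fin p ⊕ Fin p) (Fin p ⊕ Fin p) (𝒜 0))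
    (D D' : Matrix (Fin n) (Fin n) (𝒜 0)) :
    evenDiag 𝒜 S D * evenDiag 𝒜 S' D' = evenDiag 𝒜 (S * S') (D * D') := by
  simp [evenDiag, Matrix.fromBlocks_multiply, Matrix.map_mul]

theorem evenDiag_add (S S' : Matrix (Fin p ⊕ Fin p) (Fin p ⊕ Fin p) (𝒜 0))
    (D D' : Matrix (Fin n) (Fin n) (𝒜 0)) :
    evenDiag 𝒜 S D + evenDiag 𝒜 S' D' = evenDiag 𝒜 (S + S') (D + D') := by
  rw [evenDiag, evenDiag, evenDiag, Matrix.fromBlocks_add, Matrix.map_add _ (map_add _),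
    Matrix.map_add _ (map_add _), add_zero, add_zero]

omit [NearSuperalgebra 𝒜] in
theorem evenDiag_one : evenDiag 𝒜 (1 : Matrix (Fin p ⊕ Fin p) (Fin p ⊕ Fin p) (𝒜 0))
    (1 : Matrix (Fin n) (Fin n) (𝒜 0)) = 1 := by
  rw [evenDiag, Matrix.map_one _ (map_zero _) (map_one _),
    Matrix.map_one _ (map_zero _) (map_one _), Matrix.fromBlocks_one]

theorem evenDiag_smul (t : ℝ) (S : Matrix (Fin p ⊕ Fin p) (Fin p ⊕ Fin p) (𝒜 0))
    (D : Matrix (Fin n) (Fin n) (𝒜 0)) :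
    t • evenDiag 𝒜 S D = evenDiag 𝒜 (algebraMap ℝ (𝒜 0) t • S) (algebraMap ℝ (𝒜 0) t • D) := by
  ext (i | i) (j | j) <;> simp [evenDiag]

omit [NearSuperalgebra 𝒜] in
theorem supertrace_evenDiag (S : Matrix (Fin p ⊕ Fin p) (Fin p ⊕ Fin p) (𝒜 0))
    (D : Matrix (Fin n) (Fin n) (𝒜 0)) :
    supertrace (evenDiag 𝒜 S D) = evenVal 𝒜 (S.trace - D.trace) := by
  simp [supertrace, evenDiag, Matrix.trace, sub_eq_add_neg]

theorem det_one_add_smul_isUnit {ι : Type*} [Fintype ι] [DecidableEq ι] {N : Matrix ι ι (𝒜 0)}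
    (hN : N.map (evenBody 𝒜) = 0) (r : 𝒜 0) : IsUnit (1 + r • N).det := by
  rw [← eval_detOneAddX, ← Polynomial.coe_evalRingHom]
  exact (isUnit_detOneAddX 𝒜 hN).map _

theorem exists_eq_one_add_smul_mul {ι : Type*} [Fintype ι] [DecidableEq ι] {N : Matrix ι ι (𝒜 0)}
    (hN : N.map (evenBody 𝒜) = 0) (r : 𝒜 0) : ∃ Y, N = (1 + r • N) * Y :=
  ⟨(1 + r • N)⁻¹ * N, by
    rw [Matrix.mul_nonsing_inv_cancel_left _ _ (det_one_add_smul_isUnit 𝒜 hN r)]⟩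

theorem Spf_conjAdjoint_evenDiag_one_add {X : SuperMat p n (ℂ ⊗[ℝ] P)} (hX : X ∈ spoDomain b 𝒜)
    {S : Matrix (Fin p ⊕ Fin p) (Fin p ⊕ Fin p) (𝒜 0)} {D : Matrix (Fin n) (Fin n) (𝒜 0)}
    (hS : S.map (evenBody 𝒜) = 0) (hD : D.map (evenBody 𝒜) = 0) :
    Spf b 𝒜 (conjAdjoint b (evenDiag 𝒜 (1 + S) (1 + D)) X) *
      toC (evenVal 𝒜 ((1 + S).det * Ring.inverse (1 + D).det)) = Spf b 𝒜 X := by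
  obtain ⟨u, hu⟩ := isUnit_detOneAddX 𝒜 hD
  have hu' : detOneAddX D * (↑u⁻¹ : Polynomial (𝒜 0)) = 1 := by rw [← hu, Units.mul_inv]
  have huinv : ∀ r : 𝒜 0, (↑u⁻¹ : Polynomial (𝒜 0)).eval r = Ring.inverse (1 + r • D).det := by
    intro r
    have h1 := congrArg (Polynomial.eval r) hu'
    rw [Polynomial.eval_mul, eval_detOneAddX, Polynomial.eval_one] at h1
    have h2 : IsUnit (1 + r • D).det := .of_mul_eq_one _ h1
    rw [← one_mul (Ring.inverse _), ← h1, mul_comm (Matrix.det _), Ring.mul_inverse_cancel_right _ _ h2]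
  -- This is det(1 + tS)/det(1 + tD), the solution of β' = str(Y_t)β with β(0) = 1, where Y_t has
  -- diagonal blocks (1 + tS)⁻¹S and (1 + tD)⁻¹D.
  set β : Polynomial (𝒜 0) := detOneAddX S * (↑u⁻¹ : Polynomial (𝒜 0)) with hβ
  have hb : ∀ i j, body 𝒜 (evenDiag 𝒜 S D i j) = 0 := by
    rintro (i | i) (j | j)
    · exact congrFun (congrFun hS i) j
    · simp [evenDiag]
    · simp [evenDiag]
    · exact congrFun (congrFun hD i) j
  have main := Spf_conjAdjoint_one_add b 𝒜 hX (evenDiag_isPointGl 𝒜 S D) hb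
    (β.map (evenVal 𝒜).toRingHom) (fun t => by
      obtain ⟨Y₀, hY₀⟩ := exists_eq_one_add_smul_mul 𝒜 hS (algebraMap ℝ (𝒜 0) t)
      obtain ⟨Y₁, hY₁⟩ := exists_eq_one_add_smul_mul 𝒜 hD (algebraMap ℝ (𝒜 0) t)
      refine ⟨evenDiag 𝒜 Y₀ Y₁, evenDiag_isPointGl 𝒜 _ _, ?_, ?_⟩
      · rw [evenDiag_smul, ← evenDiag_one 𝒜, evenDiag_add, evenDiag_mul, ← hY₀, ← hY₁]
      · rw [Polynomial.derivative_map]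
        refine (evalReal_map (evenVal 𝒜) t _).trans ?_
        refine Eq.trans ?_ (congrArg _ (evalReal_map (evenVal 𝒜) t β).symm)
        rw [supertrace_evenDiag, ← map_mul]
        congr 1
        rw [evalReal_eq_eval, evalReal_eq_eval]
        set r := algebraMap ℝ (𝒜 0) t
        have h1 := congrArg (fun f => (Polynomial.derivative f).eval r) hu'
        simp only [Polynomial.derivative_mul, Polynomial.eval_add, Polynomial.eval_mul,
          Polynomial.derivative_one, Polynomial.eval_zero,
          eval_derivative_detOneAddX hY₁] at h1
        have h2 := congrArg (Polynomial.eval r) hu'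
        rw [Polynomial.eval_mul, Polynomial.eval_one] at h2
        rw [hβ, Polynomial.derivative_mul, Polynomial.eval_add, Polynomial.eval_mul,
          Polynomial.eval_mul, Polynomial.eval_mul, eval_derivative_detOneAddX hY₀]
        -- Quotient rule: `h1` differentiates det(1 + tD) times its inverse, and `h2` says that this
        -- product is 1 at r.
        linear_combination (Polynomial.eval r (detOneAddX S)) *
          (Polynomial.eval r (↑u⁻¹ : Polynomial (𝒜 0)) * h1
            - (Polynomial.eval r (Polynomial.derivative (↑u⁻¹ : Polynomial (𝒜 0)))
              + Y₁.trace * Polynomial.eval r (↑u⁻¹ : Polynomial (𝒜 0))) * h2))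
  have e : ∀ t, evalReal t (β.map (evenVal 𝒜).toRingHom) = evenVal 𝒜 (evalReal t β) :=
    fun t => evalReal_map (evenVal 𝒜) t β
  have e1 : ∀ t, evalReal t β = (1 + algebraMap ℝ (𝒜 0) t • S).det *
      Ring.inverse (1 + algebraMap ℝ (𝒜 0) t • D).det := fun t => by
    rw [evalReal_eq_eval, hβ, Polynomial.eval_mul, huinv, eval_detOneAddX]
  rw [e, e, e1, e1, map_one, map_zero, one_smul, one_smul, zero_smul, zero_smul, add_zero,
    add_zero, Matrix.det_one, Matrix.det_one, Ring.inverse_one, mul_one, map_one, map_one, mul_one,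
    ← evenDiag_one 𝒜, evenDiag_add] at main
  exact main

end Unipotent

/-! ### The block decomposition and the Berezinian -/

section Decomposition

variable {V₀ V₁ : Type*} [AddCommGroup V₀] [Module ℝ V₀] [AddCommGroup V₁] [Module ℝ V₁]
  {B : SymplecticForm V₀ V₁} {p n : ℕ} (b : SymplecticBasis B p n)
  {P : Type*} [Ring P] [Algebra ℝ P] (𝒜 : ZMod 2 → Submodule ℝ P) [GradedAlgebra 𝒜]
  [NearSuperalgebra 𝒜]

theorem even_mul_comm {a : P} (ha : a ∈ 𝒜 0) (x : P) : a * x = x * a := by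
  have h := mul_eq_gradeInv_mul 𝒜 ha x
  simpa using h

theorem toC_even_mul_comm (a : 𝒜 0) (r : ℂ ⊗[ℝ] P) :
    toC (evenVal 𝒜 a) * r = r * toC (evenVal 𝒜 a) := by
  induction r using TensorProduct.induction_on with
  | zero => simp
  | add r s hr hs => rw [mul_add, add_mul, hr, hs]
  | tmul z x =>
    rw [toC, Algebra.TensorProduct.includeRight_apply, Algebra.TensorProduct.tmul_mul_tmul,
      Algebra.TensorProduct.tmul_mul_tmul, one_mul, mul_one, evenVal_apply,
      even_mul_comm 𝒜 a.2]

theorem odd_mul_comm {a x : P} (ha : a ∈ 𝒜 1) (hx : x ∈ 𝒜 1) : a * x = -(x * a) := by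
  simpa using NearSuperalgebra.supercomm (𝒜 := 𝒜) _ _ _ _ ha hx

section Blocks

variable {g : SuperMat p n P} (hg : IsPointGl 𝒜 g)

include hg

omit [NearSuperalgebra 𝒜] in
theorem map_oddBlock : (oddBlock 𝒜 g).map (evenVal 𝒜) = g.toBlocks₂₂ := by
  ext i j
  exact coe_evenPart 𝒜 (hg.odd_odd i j)

theorem map_schur : (schur 𝒜 g).map (evenVal 𝒜) = g.toBlocks₁₁ -
    g.toBlocks₁₂ * (oddBlock 𝒜 g)⁻¹.map (evenVal 𝒜) * g.toBlocks₂₁ := by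
  ext i j
  refine coe_evenPart 𝒜 (Submodule.sub_mem _ (hg.even_even i j) ?_)
  rw [Matrix.mul_apply]
  refine Submodule.sum_mem _ fun k _ => ?_
  rw [Matrix.mul_apply, Finset.sum_mul]
  refine Submodule.sum_mem _ fun l _ => ?_
  have h1 := SetLike.mul_mem_graded (SetLike.mul_mem_graded (hg.even_odd i l)
    ((oddBlock 𝒜 g)⁻¹ l k).2) (hg.odd_even k j)
  simpa [Matrix.toBlocks₁₂, Matrix.toBlocks₂₁] using h1

theorem det_map_evenBody_oddBlock :
    ((oddBlock 𝒜 g).map (evenBody 𝒜)).det = detBodyOdd 𝒜 g := by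
  rw [detBodyOdd, ← map_oddBlock 𝒜 hg]
  rfl

theorem evenBody_det_oddBlock : evenBody 𝒜 (oddBlock 𝒜 g).det = detBodyOdd 𝒜 g := by
  rw [evenBody_det, det_map_evenBody_oddBlock 𝒜 hg]

theorem map_evenBody_schur : (schur 𝒜 g).map (evenBody 𝒜) = bodyBlock 𝒜 g := by
  have h1 : g.toBlocks₁₂.map (body 𝒜) = 0 := by
    ext i j
    exact body_of_odd 𝒜 (hg.even_odd i j)
  calc (schur 𝒜 g).map (evenBody 𝒜) = ((schur 𝒜 g).map (evenVal 𝒜)).map (body 𝒜) := rfl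
    _ = _ := by
      rw [map_schur 𝒜 hg, Matrix.map_sub _ (map_sub _), Matrix.map_mul, Matrix.map_mul, h1,
        Matrix.zero_mul, Matrix.zero_mul, sub_zero]
      rfl

theorem detBodyOdd_mul (k : SuperMat p n P) :
    detBodyOdd 𝒜 (g * k) = detBodyOdd 𝒜 g * detBodyOdd 𝒜 k := by
  rw [detBodyOdd, detBodyOdd, detBodyOdd, ← Matrix.det_mul]
  congr 1
  ext i j
  simp [Matrix.toBlocks₂₂, Matrix.mul_apply, body_of_odd 𝒜 (hg.odd_even i _)]

omit hg in
theorem detBodyOdd_one : detBodyOdd 𝒜 (1 : SuperMat p n P) = 1 := by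
  rw [detBodyOdd, ← Matrix.fromBlocks_one, Matrix.toBlocks_fromBlocks₂₂,
    Matrix.map_one _ (map_zero _) (map_one _), Matrix.det_one]

theorem detBodyOdd_ne_zero {k : SuperMat p n P} (h : g * k = 1) : detBodyOdd 𝒜 g ≠ 0 := by
  have h1 := detBodyOdd_mul 𝒜 hg k
  rw [h, detBodyOdd_one] at h1
  exact left_ne_zero_of_mul (h1 ▸ one_ne_zero)

/-- Block Gaussian elimination with pivot D, which is invertible because the body of its determinant
is nonzero; the Schur complement that appears is the one in the Berezinian. -/
theorem eq_mul_evenDiag_mul (hD : detBodyOdd 𝒜 g ≠ 0) :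
    g = (1 + Matrix.fromBlocks 0 (g.toBlocks₁₂ * (oddBlock 𝒜 g)⁻¹.map (evenVal 𝒜)) 0 0) *
      evenDiag 𝒜 (schur 𝒜 g) (oddBlock 𝒜 g) *
      (1 + Matrix.fromBlocks 0 0 ((oddBlock 𝒜 g)⁻¹.map (evenVal 𝒜) * g.toBlocks₂₁) 0) := by
  have hu : IsUnit (oddBlock 𝒜 g).det := isUnit_of_evenBody_ne_zero 𝒜 (by
    rwa [evenBody_det_oddBlock 𝒜 hg])
  have h1 : (oddBlock 𝒜 g)⁻¹.map (evenVal 𝒜) * g.toBlocks₂₂ = 1 := by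
    rw [← map_oddBlock 𝒜 hg, ← Matrix.map_mul, Matrix.nonsing_inv_mul _ hu,
      Matrix.map_one _ (map_zero _) (map_one _)]
  have h2 : g.toBlocks₂₂ * (oddBlock 𝒜 g)⁻¹.map (evenVal 𝒜) = 1 := by
    rw [← map_oddBlock 𝒜 hg, ← Matrix.map_mul, Matrix.mul_nonsing_inv _ hu,
      Matrix.map_one _ (map_zero _) (map_one _)]
  conv_lhs => rw [← Matrix.fromBlocks_toBlocks g]
  rw [evenDiag, map_schur 𝒜 hg, map_oddBlock 𝒜 hg, ← Matrix.fromBlocks_one,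
    Matrix.fromBlocks_add, Matrix.fromBlocks_add, Matrix.fromBlocks_multiply,
    Matrix.fromBlocks_multiply]
  simp only [add_zero, zero_add, Matrix.one_mul, Matrix.mul_one, Matrix.zero_mul, Matrix.mul_zero,
    Matrix.mul_assoc, h1, ← Matrix.mul_assoc g.toBlocks₂₂, h2]
  simp

end Blocks

theorem Spf_conjAdjoint_upper {X : SuperMat p n (ℂ ⊗[ℝ] P)} (hX : X ∈ spoDomain b 𝒜)
    {E : Matrix (Fin p ⊕ Fin p) (Fin n) P} (hE : ∀ i j, E i j ∈ 𝒜 1) :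
    Spf b 𝒜 (conjAdjoint b (1 + Matrix.fromBlocks 0 E 0 0) X) = Spf b 𝒜 X := by
  refine Spf_conjAdjoint_one_add_of_mul_self b 𝒜 hX ?_ ?_ ?_ ?_
  · rintro (i | i) (j | j)
    · simp
    · exact hE i j
    · simp
    · simp
  · rintro (i | i) (j | j)
    · simp
    · exact body_of_odd 𝒜 (hE i j)
    · simp
    · simp
  · simp [Matrix.fromBlocks_multiply]
  · simp [supertrace]

theorem Spf_conjAdjoint_lower {X : SuperMat p n (ℂ ⊗[ℝ] P)} (hX : X ∈ spoDomain b 𝒜)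
    {E : Matrix (Fin n) (Fin p ⊕ Fin p) P} (hE : ∀ i j, E i j ∈ 𝒜 1) :
    Spf b 𝒜 (conjAdjoint b (1 + Matrix.fromBlocks 0 0 E 0) X) = Spf b 𝒜 X := by
  refine Spf_conjAdjoint_one_add_of_mul_self b 𝒜 hX ?_ ?_ ?_ ?_
  · rintro (i | i) (j | j)
    · simp
    · simp
    · exact hE i j
    · simp
  · rintro (i | i) (j | j)
    · simp
    · simp
    · exact body_of_odd 𝒜 (hE i j)
    · simp
  · simp [Matrix.fromBlocks_multiply]
  · simp [supertrace]

/-- Separates the real part of the change of variables, treated by integration theory, from the part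
with body 1, treated by the path argument. -/
theorem exists_eq_map_mul_one_add {ι : Type*} [Fintype ι] [DecidableEq ι] {S : Matrix ι ι (𝒜 0)}
    (hS : (S.map (evenBody 𝒜)).det ≠ 0) : ∃ N : Matrix ι ι (𝒜 0), N.map (evenBody 𝒜) = 0 ∧
      S = (S.map (evenBody 𝒜)).map (algebraMap ℝ (𝒜 0)) * (1 + N) ∧
      S.det = algebraMap ℝ (𝒜 0) (S.map (evenBody 𝒜)).det * (1 + N).det := by
  set A := S.map (evenBody 𝒜) with hA
  have h1 : A.map (algebraMap ℝ (𝒜 0)) * (A⁻¹.map (algebraMap ℝ (𝒜 0)) * S) = S := by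
    rw [← Matrix.mul_assoc, ← Matrix.map_mul, Matrix.mul_nonsing_inv _ hS.isUnit,
      Matrix.map_one _ (map_zero _) (map_one _), Matrix.one_mul]
  refine ⟨A⁻¹.map (algebraMap ℝ (𝒜 0)) * S - 1, ?_, ?_, ?_⟩
  · have h2 : (A⁻¹.map (algebraMap ℝ (𝒜 0))).map (evenBody 𝒜) = A⁻¹ := by
      ext i j
      simp
    rw [Matrix.map_sub _ (map_sub _), Matrix.map_mul, h2, ← hA,
      Matrix.nonsing_inv_mul _ hS.isUnit, Matrix.map_one _ (map_zero _) (map_one _), sub_self]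
  · rw [add_sub_cancel, h1]
  · rw [add_sub_cancel]
    conv_lhs => rw [← h1]
    rw [Matrix.det_mul]
    congr 1
    exact ((algebraMap ℝ (𝒜 0)).map_det A).symm

omit [NearSuperalgebra 𝒜] in
theorem realPoint_eq_evenDiag (A : Matrix (Fin p ⊕ Fin p) (Fin p ⊕ Fin p) ℝ)
    (D : Matrix (Fin n) (Fin n) ℝ) : realPoint A D P =
      evenDiag 𝒜 (A.map (algebraMap ℝ (𝒜 0))) (D.map (algebraMap ℝ (𝒜 0))) := by
  ext (i | i) (j | j) <;> simp [realPoint, evenDiag]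

theorem absEven_eq (a : 𝒜 0) : absEven 𝒜 a = (|evenBody 𝒜 a| / evenBody 𝒜 a) • a := rfl

theorem Spf_conjAdjoint_evenDiag {X : SuperMat p n (ℂ ⊗[ℝ] P)} (hX : X ∈ spoDomain b 𝒜)
    {S : Matrix (Fin p ⊕ Fin p) (Fin p ⊕ Fin p) (𝒜 0)} {D : Matrix (Fin n) (Fin n) (𝒜 0)}
    (hS : (S.map (evenBody 𝒜)).det ≠ 0) (hD : (D.map (evenBody 𝒜)).det ≠ 0) :
    Spf b 𝒜 (conjAdjoint b (evenDiag 𝒜 S D) X) *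
      toC (evenVal 𝒜 (absEven 𝒜 S.det * Ring.inverse D.det)) = Spf b 𝒜 X := by
  obtain ⟨S', hS0, hS', hSdet⟩ := exists_eq_map_mul_one_add 𝒜 hS
  obtain ⟨D', hD0, hD', hDdet⟩ := exists_eq_map_mul_one_add 𝒜 hD
  have hbS := evenBody_det 𝒜 S
  set A := S.map (evenBody 𝒜) with hA
  set C := D.map (evenBody 𝒜) with hC
  have hdec : evenDiag 𝒜 S D = realPoint A C P * evenDiag 𝒜 (1 + S') (1 + D') := by
    rw [realPoint_eq_evenDiag 𝒜, evenDiag_mul, ← hS', ← hD']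
  have hreal := realPoint_isPointGl 𝒜 A C
  have hX' := conjAdjoint_mem_spoDomain b 𝒜 hX hreal (by rwa [bodyBlock_realPoint])
  have main := Spf_conjAdjoint_evenDiag_one_add b 𝒜 hX' hS0 hD0
  have hinv : Ring.inverse D.det = C.det⁻¹ • Ring.inverse (1 + D').det := by
    have hu : IsUnit (algebraMap ℝ (𝒜 0) C.det) := hD.isUnit.map _
    rw [hDdet, Ring.inverse_mul (.inl hu), mul_comm, Algebra.smul_def]
    congr 1
    rw [← mul_one (Ring.inverse _), Ring.inverse_mul_eq_iff_eq_mul _ _ _ hu, ← map_mul,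
      mul_inv_cancel₀ hD, map_one]
  have hber : absEven 𝒜 S.det * Ring.inverse D.det
      = (|A.det| * C.det⁻¹) • ((1 + S').det * Ring.inverse (1 + D').det) := by
    rw [absEven_eq, hbS, hinv, hSdet, ← Algebra.smul_def, smul_smul, div_mul_cancel₀ _ hS,
      smul_mul_smul_comm]
  rw [hber, map_smul, map_smul, mul_smul_comm, hdec,
    conjAdjoint_mul b 𝒜 hreal (evenDiag_isPointGl 𝒜 _ _), main,
    Spf_conjAdjoint_realPoint b 𝒜 A C hX hS, smul_smul]
  have : |A.det| ≠ 0 := abs_ne_zero.2 hS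
  -- The body of the Berezinian cancels the Jacobian of the real factor.
  rw [show |A.det| * C.det⁻¹ * (|A.det|⁻¹ * C.det) = 1 by field_simp, one_smul]

/-- The transformation law of the superPfaffian. -/
theorem Spf_conjAdjoint_mul_ber10 {X : SuperMat p n (ℂ ⊗[ℝ] P)} (hX : X ∈ spoDomain b 𝒜)
    {g k : SuperMat p n P} (hg : IsPointGl 𝒜 g) (hgk : g * k = 1) :
    Spf b 𝒜 (conjAdjoint b g X) * toC (ber10 𝒜 g : P) = Spf b 𝒜 X := by
  have hD := detBodyOdd_ne_zero 𝒜 hg hgk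
  have hA := det_bodyBlock_ne_zero 𝒜 hg hgk
  set E := g.toBlocks₁₂ * (oddBlock 𝒜 g)⁻¹.map (evenVal 𝒜) with hE
  set F := (oddBlock 𝒜 g)⁻¹.map (evenVal 𝒜) * g.toBlocks₂₁ with hF
  have hEodd : ∀ i j, E i j ∈ 𝒜 1 := fun i j => by
    rw [hE, Matrix.mul_apply]
    refine Submodule.sum_mem _ fun k _ => ?_
    simpa [Matrix.toBlocks₁₂, Matrix.toBlocks₂₁] using SetLike.mul_mem_graded (hg.even_odd i k) ((oddBlock 𝒜 g)⁻¹ k j).2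
  have hFodd : ∀ i j, F i j ∈ 𝒜 1 := fun i j => by
    rw [hF, Matrix.mul_apply]
    refine Submodule.sum_mem _ fun k _ => ?_
    simpa [Matrix.toBlocks₁₂, Matrix.toBlocks₂₁] using SetLike.mul_mem_graded ((oddBlock 𝒜 g)⁻¹ i k).2 (hg.odd_even k j)
  have h1 := IsPointGl.one (p := p) (n := n) (isSupercomm 𝒜)
  have hu : IsPointGl 𝒜 (1 + Matrix.fromBlocks 0 E 0 0 : SuperMat p n P) := h1.add (by
    rintro (i | i) (j | j)
    · simp
    · exact hEodd i j
    · simp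
    · simp)
  have hl : IsPointGl 𝒜 (1 + Matrix.fromBlocks 0 0 F 0 : SuperMat p n P) := h1.add (by
    rintro (i | i) (j | j)
    · simp
    · simp
    · exact hFodd i j
    · simp)
  have hd := evenDiag_isPointGl 𝒜 (schur 𝒜 g) (oddBlock 𝒜 g)
  have hXu : conjAdjoint b (1 + Matrix.fromBlocks 0 E 0 0) X ∈ spoDomain b 𝒜 := by
    refine conjAdjoint_mem_spoDomain b 𝒜 hX hu ?_
    rw [bodyBlock_one_add 𝒜]
    · simp
    · rintro (i | i) (j | j)
      · simp
      · exact body_of_odd 𝒜 (hEodd i j)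
      · simp
      · simp
  have hS : ((schur 𝒜 g).map (evenBody 𝒜)).det ≠ 0 := by rwa [map_evenBody_schur 𝒜 hg]
  have hXd : conjAdjoint b (evenDiag 𝒜 (schur 𝒜 g) (oddBlock 𝒜 g))
      (conjAdjoint b (1 + Matrix.fromBlocks 0 E 0 0) X) ∈ spoDomain b 𝒜 :=
    conjAdjoint_mem_spoDomain b 𝒜 hXu hd hS
  -- X ↦ g^*Xg is a right action, so the leftmost factor of g acts first on X.
  have hdec : conjAdjoint b g X = conjAdjoint b (1 + Matrix.fromBlocks 0 0 F 0)
      (conjAdjoint b (evenDiag 𝒜 (schur 𝒜 g) (oddBlock 𝒜 g))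
        (conjAdjoint b (1 + Matrix.fromBlocks 0 E 0 0) X)) := by
    rw [← conjAdjoint_mul b 𝒜 hu hd, ← conjAdjoint_mul b 𝒜 (hu.mul (isSupercomm 𝒜) hd) hl,
      ← eq_mul_evenDiag_mul 𝒜 hg hD]
  have main := Spf_conjAdjoint_evenDiag b 𝒜 hXu hS
    (by rwa [det_map_evenBody_oddBlock 𝒜 hg])
  rw [hdec, Spf_conjAdjoint_lower b 𝒜 hXd hFodd]
  exact main.trans (Spf_conjAdjoint_upper b 𝒜 hX hEodd)

theorem isUnit_ber10 {g k : SuperMat p n P} (hg : IsPointGl 𝒜 g) (hgk : g * k = 1) :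
    IsUnit (ber10 𝒜 g) := by
  refine IsUnit.mul (isUnit_of_evenBody_ne_zero 𝒜 ?_) (IsUnit.ringInverse ?_)
  · have h : evenBody 𝒜 (schur 𝒜 g).det ≠ 0 := by
      rw [evenBody_det, map_evenBody_schur 𝒜 hg]
      exact det_bodyBlock_ne_zero 𝒜 hg hgk
    rw [absEven_eq, map_smul, smul_eq_mul, div_mul_cancel₀ _ h]
    exact abs_ne_zero.2 h
  · refine isUnit_of_evenBody_ne_zero 𝒜 ?_
    rw [evenBody_det_oddBlock 𝒜 hg]
    exact detBodyOdd_ne_zero 𝒜 hg hgk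

theorem evenBody_ber10 {g k : SuperMat p n P} (hg : IsPointGl 𝒜 g) (hgk : g * k = 1) :
    evenBody 𝒜 (ber10 𝒜 g) = |(bodyBlock 𝒜 g).det| * (detBodyOdd 𝒜 g)⁻¹ := by
  have hD := detBodyOdd_ne_zero 𝒜 hg hgk
  have hA := det_bodyBlock_ne_zero 𝒜 hg hgk
  have h1 : evenBody 𝒜 (Ring.inverse (oddBlock 𝒜 g).det) = (detBodyOdd 𝒜 g)⁻¹ := by
    have h2 : IsUnit (oddBlock 𝒜 g).det :=
      isUnit_of_evenBody_ne_zero 𝒜 (by rwa [evenBody_det_oddBlock 𝒜 hg])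
    have h3 := congrArg (evenBody 𝒜) (Ring.mul_inverse_cancel _ h2)
    rw [map_mul, evenBody_det_oddBlock 𝒜 hg, map_one] at h3
    exact eq_inv_of_mul_eq_one_right h3
  rw [ber10, map_mul, h1, absEven_eq, map_smul, smul_eq_mul, evenBody_det,
    map_evenBody_schur 𝒜 hg, div_mul_cancel₀ _ hA]

end Decomposition

/-! ### The Berezinian of the adjoint -/

section AdjointBer

variable {V₀ V₁ : Type*} [AddCommGroup V₀] [Module ℝ V₀] [AddCommGroup V₁] [Module ℝ V₁]
  {B : SymplecticForm V₀ V₁} {p n : ℕ} (b : SymplecticBasis B p n)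
  {P : Type*} [Ring P] [Algebra ℝ P] (𝒜 : ZMod 2 → Submodule ℝ P) [GradedAlgebra 𝒜]
  [NearSuperalgebra 𝒜]

omit [NearSuperalgebra 𝒜] in
theorem map_evenVal_injective {l m : Type*} :
    Function.Injective fun M : Matrix l m (𝒜 0) => M.map (evenVal 𝒜) := by
  intro M N h
  ext i j
  exact congrFun (congrFun h i) j

theorem det_realMat_conj {ι R : Type*} [Fintype ι] [DecidableEq ι] [CommRing R] [Algebra ℝ R]
    {G : Matrix ι ι ℝ} (hG : IsUnit G.det) (M : Matrix ι ι R) :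
    (realMat R G⁻¹ * M.transpose * realMat R G).det = M.det := by
  rw [Matrix.det_mul, Matrix.det_mul, Matrix.det_transpose, mul_right_comm, ← Matrix.det_mul,
    ← realMat_mul, Matrix.nonsing_inv_mul _ hG, realMat_one, Matrix.det_one, one_mul]

variable {g : SuperMat p n P} (hg : IsPointGl 𝒜 g)

include hg

theorem oddBlock_adjoint : oddBlock 𝒜 (adjoint b g) =
    realMat (𝒜 0) (gramOdd b)⁻¹ * (oddBlock 𝒜 g).transpose * realMat (𝒜 0) (gramOdd b) := by
  refine map_evenVal_injective 𝒜 ?_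
  change (oddBlock 𝒜 (adjoint b g)).map (evenVal 𝒜) = Matrix.map _ (evenVal 𝒜)
  rw [map_oddBlock 𝒜 (hg.adjoint b (isSupercomm 𝒜)), adjoint_eq_fromBlocks,
    Matrix.toBlocks_fromBlocks₂₂, ← map_oddBlock 𝒜 hg, Matrix.map_mul, Matrix.map_mul]
  rfl

theorem inv_oddBlock_adjoint (hD : detBodyOdd 𝒜 g ≠ 0) : (oddBlock 𝒜 (adjoint b g))⁻¹ =
    realMat (𝒜 0) (gramOdd b)⁻¹ * ((oddBlock 𝒜 g)⁻¹).transpose * realMat (𝒜 0) (gramOdd b) := by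
  have hu : IsUnit (oddBlock 𝒜 g).det := isUnit_of_evenBody_ne_zero 𝒜 (by
    rwa [evenBody_det_oddBlock 𝒜 hg])
  have h1 : realMat (𝒜 0) (gramOdd b) * realMat (𝒜 0) (gramOdd b)⁻¹ = 1 := by
    rw [← realMat_mul, Matrix.mul_nonsing_inv _ (isUnit_det_gramOdd b), realMat_one]
  have h2 : realMat (𝒜 0) (gramOdd b)⁻¹ * realMat (𝒜 0) (gramOdd b) = 1 := by
    rw [← realMat_mul, Matrix.nonsing_inv_mul _ (isUnit_det_gramOdd b), realMat_one]
  have h3 : (oddBlock 𝒜 g).transpose * ((oddBlock 𝒜 g)⁻¹).transpose = 1 := by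
    rw [← Matrix.transpose_mul, Matrix.nonsing_inv_mul _ hu, Matrix.transpose_one]
  rw [oddBlock_adjoint b 𝒜 hg]
  refine Matrix.inv_eq_right_inv ?_
  calc _ = realMat (𝒜 0) (gramOdd b)⁻¹ * ((oddBlock 𝒜 g).transpose *
        (realMat (𝒜 0) (gramOdd b) * realMat (𝒜 0) (gramOdd b)⁻¹) *
        ((oddBlock 𝒜 g)⁻¹).transpose) * realMat (𝒜 0) (gramOdd b) := by
          simp only [Matrix.mul_assoc]
    _ = 1 := by rw [h1, Matrix.mul_one, h3, Matrix.mul_one, h2]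

/-- Reversing a product with two odd factors and one even factor produces a single minus sign, from
the exchange of the odd ones. -/
theorem transpose_odd_mul_even_mul_odd (M : Matrix (Fin n) (Fin n) (𝒜 0)) :
    g.toBlocks₂₁.transpose * (M.map (evenVal 𝒜)).transpose * g.toBlocks₁₂.transpose
      = -(g.toBlocks₁₂ * M.map (evenVal 𝒜) * g.toBlocks₂₁).transpose := by
  ext i j
  simp only [Matrix.mul_apply, Matrix.neg_apply, Matrix.transpose_apply, Finset.sum_mul,
    ← Finset.sum_neg_distrib]
  rw [Finset.sum_comm]
  refine Finset.sum_congr rfl fun k _ => Finset.sum_congr rfl fun l _ => ?_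
  have h1 : g.toBlocks₂₁ k i * g.toBlocks₁₂ j l = -(g.toBlocks₁₂ j l * g.toBlocks₂₁ k i) :=
    odd_mul_comm 𝒜 (hg.odd_even k i) (hg.even_odd j l)
  have h2 := even_mul_comm 𝒜 (M l k).2
  simp only [Matrix.map_apply, evenVal_apply]
  rw [← h2, mul_assoc, h1, mul_neg, ← mul_assoc, h2]

/-- The minus sign in the upper right block of the adjoint cancels the one from transposing a
product of odd entries, and the inner Gram matrices cancel. The Schur complement of the adjoint is
therefore conjugate to the transpose of that of g, with the same determinant. -/
theorem schur_adjoint (hD : detBodyOdd 𝒜 g ≠ 0) : schur 𝒜 (adjoint b g) =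
    realMat (𝒜 0) (gramEven b)⁻¹ * (schur 𝒜 g).transpose * realMat (𝒜 0) (gramEven b) := by
  refine map_evenVal_injective 𝒜 ?_
  change (schur 𝒜 (adjoint b g)).map (evenVal 𝒜) = Matrix.map _ (evenVal 𝒜)
  have h1 : realMat P (gramOdd b) * realMat P (gramOdd b)⁻¹ = 1 := by
    rw [← realMat_mul, Matrix.mul_nonsing_inv _ (isUnit_det_gramOdd b), realMat_one]
  have hr : ∀ {l m : Type} (G : Matrix l m ℝ), (realMat (𝒜 0) G).map (evenVal 𝒜) = realMat P G :=
    fun G => rfl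
  have ht := transpose_odd_mul_even_mul_odd 𝒜 hg (oddBlock 𝒜 g)⁻¹
  have hs : ((schur 𝒜 g).transpose).map (evenVal 𝒜) = ((schur 𝒜 g).map (evenVal 𝒜)).transpose :=
    rfl
  rw [map_schur 𝒜 (hg.adjoint b (isSupercomm 𝒜)), inv_oddBlock_adjoint b 𝒜 hg hD,
    adjoint_eq_fromBlocks, Matrix.toBlocks_fromBlocks₁₁, Matrix.toBlocks_fromBlocks₁₂,
    Matrix.toBlocks_fromBlocks₂₁, Matrix.map_mul, Matrix.map_mul, Matrix.map_mul, Matrix.map_mul,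
    hr, hr, hr, hr, hs, map_schur 𝒜 hg, Matrix.transpose_sub, Matrix.mul_sub, Matrix.sub_mul]
  congr 1
  rw [← neg_eq_iff_eq_neg] at ht
  rw [← ht]
  simp only [Matrix.neg_mul, Matrix.mul_neg]
  congr 1
  calc _ = realMat P (gramEven b)⁻¹ * (g.toBlocks₂₁.transpose *
        (realMat P (gramOdd b) * realMat P (gramOdd b)⁻¹) *
          ((oddBlock 𝒜 g)⁻¹.map (evenVal 𝒜)).transpose *
        (realMat P (gramOdd b) * realMat P (gramOdd b)⁻¹) * g.toBlocks₁₂.transpose) *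
          realMat P (gramEven b) := by
        simp only [Matrix.mul_assoc]
        rfl
    _ = _ := by rw [h1, Matrix.mul_one, Matrix.mul_one]

theorem det_schur_adjoint (hD : detBodyOdd 𝒜 g ≠ 0) :
    (schur 𝒜 (adjoint b g)).det = (schur 𝒜 g).det := by
  rw [schur_adjoint b 𝒜 hg hD, det_realMat_conj (isUnit_det_gramEven b)]

theorem det_oddBlock_adjoint : (oddBlock 𝒜 (adjoint b g)).det = (oddBlock 𝒜 g).det := by
  rw [oddBlock_adjoint b 𝒜 hg, det_realMat_conj (isUnit_det_gramOdd b)]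

theorem ber10_adjoint (hD : detBodyOdd 𝒜 g ≠ 0) : ber10 𝒜 (adjoint b g) = ber10 𝒜 g := by
  rw [ber10, ber10, det_schur_adjoint b 𝒜 hg hD, det_oddBlock_adjoint b 𝒜 hg]

/-- The body of each diagonal block has the same determinant as the corresponding block of the
adjoint, so both determinants square to 1. The absolute value removes the even one and the odd one
equals its inverse. -/
theorem evenBody_ber10_of_adjoint_mul (h : adjoint b g * g = 1) (h' : g * adjoint b g = 1) :
    evenBody 𝒜 (ber10 𝒜 g) = detBodyOdd 𝒜 g ∧ detBodyOdd 𝒜 g * detBodyOdd 𝒜 g = 1 := by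
  have hD := detBodyOdd_ne_zero 𝒜 hg h'
  have hga := hg.adjoint b (isSupercomm 𝒜)
  have h1 : detBodyOdd 𝒜 (adjoint b g) = detBodyOdd 𝒜 g := by
    rw [← evenBody_det_oddBlock 𝒜 hga, ← evenBody_det_oddBlock 𝒜 hg,
      det_oddBlock_adjoint b 𝒜 hg]
  have h2 : (bodyBlock 𝒜 (adjoint b g)).det = (bodyBlock 𝒜 g).det := by
    rw [← map_evenBody_schur 𝒜 hga, ← map_evenBody_schur 𝒜 hg, ← evenBody_det, ← evenBody_det,
      det_schur_adjoint b 𝒜 hg hD]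
  have h3 : detBodyOdd 𝒜 g * detBodyOdd 𝒜 g = 1 := by
    have := detBodyOdd_mul 𝒜 hga g
    rwa [h, detBodyOdd_one, h1, eq_comm] at this
  have h4 : (bodyBlock 𝒜 g).det * (bodyBlock 𝒜 g).det = 1 := by
    have h5 := congrArg Matrix.det (bodyBlock_mul 𝒜 (k := g) hga)
    have h6 : bodyBlock 𝒜 (1 : SuperMat p n P) = 1 := by
      simpa using bodyBlock_one_add 𝒜 (N := (0 : SuperMat p n P)) (by simp)
    rw [h, h6, Matrix.det_mul, h2, Matrix.det_one] at h5
    exact h5.symm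
  refine ⟨?_, h3⟩
  have h7 : |(bodyBlock 𝒜 g).det| = 1 := by
    rcases mul_self_eq_one_iff.1 h4 with h | h <;> simp [h]
  rw [evenBody_ber10 𝒜 hg h', h7, one_mul]
  exact inv_eq_of_mul_eq_one_right h3

end AdjointBer

end SuperPfaffian

end

/-! ### The proposition -/

open SuperPfaffian in
theorem mainTheorem5 {V₀ V₁ : Type*} [AddCommGroup V₀] [Module ℝ V₀] [AddCommGroup V₁]
    [Module ℝ V₁] (B : SymplecticForm V₀ V₁) {p n : ℕ} (b : SymplecticBasis B p n)
    {P : Type*} [Ring P] [Algebra ℝ P] (𝒜 : ZMod 2 → Submodule ℝ P) [GradedAlgebra 𝒜]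
    [NearSuperalgebra 𝒜]
    (X : SuperMat p n (ℂ ⊗[ℝ] P)) (hX : X ∈ spoDomain b 𝒜)
    (g : (SuperMat p n P)ˣ) (hg : IsPointGl 𝒜 (g : SuperMat p n P)) :
    SpfConverges b 𝒜 X ∧
    IsUnit (ber10 𝒜 (g : SuperMat p n P)) ∧
    (adjoint b (g : SuperMat p n P)).map toC * X * (g : SuperMat p n P).map toC
      ∈ spoDomain b 𝒜 ∧
    Spf b 𝒜 ((adjoint b (g : SuperMat p n P)).map toC * X * (g : SuperMat p n P).map toC)
      = toC ((Ring.inverse (ber10 𝒜 (g : SuperMat p n P)) : 𝒜 0) : P) * Spf b 𝒜 X ∧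
    (adjoint b (g : SuperMat p n P) = ((g⁻¹ : (SuperMat p n P)ˣ) : SuperMat p n P) →
      Spf b 𝒜 (((g⁻¹ : (SuperMat p n P)ˣ) : SuperMat p n P).map toC * X
          * (g : SuperMat p n P).map toC)
        = detBodyOdd 𝒜 (g : SuperMat p n P) • Spf b 𝒜 X) := by
  have hgk : (g : SuperMat p n P) * (g⁻¹ : (SuperMat p n P)ˣ) = 1 := g.mul_inv
  have hkg : ((g⁻¹ : (SuperMat p n P)ˣ) : SuperMat p n P) * g = 1 := g.inv_mul
  have hu := isUnit_ber10 𝒜 hg hgk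
  have hX' := conjAdjoint_mem_spoDomain b 𝒜 hX hg (det_bodyBlock_ne_zero 𝒜 hg hgk)
  have h1 := Spf_conjAdjoint_mul_ber10 b 𝒜 hX hg hgk
  refine ⟨spfConverges_of_mem b 𝒜 hX, hu, hX', ?_, fun hstar => ?_⟩
  · have h2 : toC (evenVal 𝒜 (ber10 𝒜 (g : SuperMat p n P))) *
        toC (evenVal 𝒜 (Ring.inverse (ber10 𝒜 (g : SuperMat p n P)))) = (1 : ℂ ⊗[ℝ] P) := by
      rw [← map_mul, ← map_mul, Ring.mul_inverse_cancel _ hu, map_one, map_one]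
    have h3 := toC_even_mul_comm 𝒜 (Ring.inverse (ber10 𝒜 (g : SuperMat p n P))) (Spf b 𝒜 X)
    refine Eq.trans ?_ h3.symm
    rw [← h1]
    exact ((mul_assoc _ _ _).trans ((congrArg _ h2).trans (mul_one _))).symm
  · obtain ⟨hb, hsq⟩ := evenBody_ber10_of_adjoint_mul b 𝒜 hg (hstar ▸ hkg) (hstar ▸ hgk)
    have hD := detBodyOdd_ne_zero 𝒜 hg hgk
    have hk : IsPointGl 𝒜 ((g⁻¹ : (SuperMat p n P)ˣ) : SuperMat p n P) :=
      hstar ▸ hg.adjoint b (isSupercomm 𝒜)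
    have hone : conjAdjoint b (1 : SuperMat p n P) X = X := by
      rw [conjAdjoint, adjoint_one, Matrix.map_one _ (map_zero _) (map_one _), one_mul, mul_one]
    -- The law for g⁻¹ at the point g^*Xg. Since g⁻¹ = g^* has the same Berezinian β as g, it
    -- becomes Spf(X)β = Spf(g^*Xg).
    have h2 := Spf_conjAdjoint_mul_ber10 b 𝒜 hX' hk hkg
    change Spf b 𝒜 (conjAdjoint b _ (conjAdjoint b _ X)) * _ = Spf b 𝒜 (conjAdjoint b _ X) at h2
    rw [← conjAdjoint_mul b 𝒜 hg hk, hgk, hone, ← hstar, ber10_adjoint b 𝒜 hg hD] at h2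
    rw [← hstar]
    change Spf b 𝒜 (conjAdjoint b _ X) = _
    set β := ber10 𝒜 (g : SuperMat p n P)
    set ε := detBodyOdd 𝒜 (g : SuperMat p n P)
    -- The body of β + ε is 2ε, which is nonzero.
    have hunit : IsUnit (toC (evenVal 𝒜 (β + algebraMap ℝ (𝒜 0) ε)) : ℂ ⊗[ℝ] P) := by
      refine IsUnit.map _ (IsUnit.map _ (isUnit_of_evenBody_ne_zero 𝒜 ?_))
      rw [map_add, hb, AlgHom.commutes]
      simpa [← two_mul] using hD
    -- Expanding gives Spf(X)β² - ε² Spf(X), which vanishes by the two transformation laws and ε² =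
    -- 1; the invertible factor β + ε can then be cancelled.
    have h3 : (Spf b 𝒜 X * toC (evenVal 𝒜 β) - ε • Spf b 𝒜 X) *
        toC (evenVal 𝒜 (β + algebraMap ℝ (𝒜 0) ε)) = 0 := by
      have h4 : Spf b 𝒜 X * toC (evenVal 𝒜 β) * toC (evenVal 𝒜 β) = Spf b 𝒜 X :=
        (congrArg (· * toC (evenVal 𝒜 β)) h2).trans h1
      rw [map_add, map_add, AlgHom.commutes, AlgHom.commutes, mul_add, sub_mul, sub_mul, h4,
        smul_mul_assoc, smul_mul_assoc, ← Algebra.commutes, ← Algebra.commutes,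
        ← Algebra.smul_def, ← Algebra.smul_def, smul_smul, hsq, one_smul]
      abel
    rw [hunit.mul_left_eq_zero, sub_eq_zero] at h3
    exact h2.symm.trans h3
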